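/- Let $(\Omega,\mathcal F,(\mathcal F_t)_{t\ge 0},\mathbb P)$ be a filtered probability space carrying two independent standard $(\mathcal F_t)$-Brownian motions $W$ and $B$, and an $(\mathcal F_t)$-Poisson random measure $\mu$ on $\mathbb R_+\times\mathbb R$ with compensator $\nu(\mathrm ds,\mathrm dx)=\mathrm ds\,F(\mathrm dx)$, where $F$ is $\sigma$-finite. **Efficient log-price.** Let $p=(p_t)_{t\ge0}$ be adapted with $$p_t=p_0+\int_0^t a_s\,\mathrm ds+\int_0^t\sigma_s\,\mathrm dW_s+\int_0^t\!\!\int_{\mathbb R}\delta(s,x)1_{\{|\delta(s,x)|\le1\}}(\mu-\nu)(\mathrm ds,\mathrm dx)+\int_0^t\!\!\int_{\mathbb R}\delta(s,x)1_{\{|\delta(s,x)|>1\}}\,\mu(\mathrm ds,\mathrm dx),$$ where $a$ is predictable and locally bounded, $\sigma$ is adapted and càdlàg, and $\delta$ is predictable. Assume that for some $\beta\in[0,2]$ there are stopping times $\tau_k\uparrow\infty$ and functions $\psi_k$ on $\mathbb R$ with $|\delta(\omega,s,x)|\wedge1\le\psi_k(x)$ for all $(\omega,s,x)$ with $s\le\tau_k(\omega)$,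 and $\int\psi_k^\beta\,\mathrm dF<\infty$ for all $k$ (with the convention $0^0=0$). **Assumption (V).** $\sigma_t=\sigma_0+\int_0^t\tilde a_s\,\mathrm ds+\int_0^t\tilde\sigma_s\,\mathrm dW_s+\int_0^t\tilde v_s\,\mathrm dB_s$ with $\sigma_0$ $\mathcal F_0$-measurable and $\tilde a,\tilde\sigma,\tilde v$ adapted and càdlàg. **Assumption (N).** With $\Delta_n=1/n$, the observations are $p^*_{i\Delta_n}=p_{i\Delta_n}+\omega_{i\Delta_n}\pi_i$, $i=0,\dots,n$, where 1. $\pi_i=u_i+\sum_{j=1}^{\ell}\theta_ju_{i-j}$ for an i.i.d. mean-zero sequence $(u_i)_{i\in\mathbb Z}$, a fixed integer $\ell\ge 0$ and constants $\theta_j$ with $1+\sum_{j=1}^\ell\theta_j\ne0$; the law of $\pi_0$ is symmetric, has unit variance and has moments of every order; 2. $\omega_t=\omega_0+\int_0^t\bar a_s\,\mathrm ds+\int_0^t\bar\sigma_s\,\mathrm dW_s+\int_0^t\bar v_s\,\mathrm dB_s$ with $\omega_0$ $\mathcal F_0$-measurable and $\bar a,\bar\sigma,\bar v$ adapted and càdlàg;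 3. $(\pi_i)_{i\ge0}$ is independent of $(p_t,\omega_t)_{t\ge0}$; 4. $\limsup_{|t|\to\infty}|\mathbb E[e^{\mathrm i tu_0}]|<1$. **Estimator.** For positive integers $h_n$ and $\ell_n$ put $\tilde p^*_{i\Delta_n}=\frac1{h_n}\sum_{j=0}^{h_n-1}p^*_{(i+j)\Delta_n}$, $$\rho_n(m)=\frac1{n-5h_n+1}\sum_{i=0}^{n-5h_n}\bigl(p^*_{i\Delta_n}-\tilde p^*_{(i+2h_n)\Delta_n}\bigr)\bigl(p^*_{(i+m)\Delta_n}-\tilde p^*_{(i+4h_n)\Delta_n}\bigr),\qquad \hat\omega_n^2=\rho_n(0)+2\sum_{m=1}^{\ell_n}\rho_n(m)$$ (well defined for all large $n$ under the rates below), and let $\rho^2=\rho(0)+2\sum_{m=1}^{\ell}\rho(m)$ with $\rho(m)=\mathbb E[\pi_0\pi_m]$. **Claim.** If $h_n\asymp n^{1/5}$ and $\ell_n\asymp n^{1/8}$ as $n\to\infty$, then $$\hat\omega_n^2-\int_0^1\rho^2\omega_s^2\,\mathrm ds=o_p\bigl(n^{-1/4}\bigr),$$ i.e. $n^{1/4}\bigl(\hat\omega_n^2-\int_0^1\rho^2\omega_s^2\,\mathrm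 ds\bigr)\to0$ in probability. -/

import Mathlib

open MeasureTheory ProbabilityTheory Filter Topology Asymptotics
open scoped NNReal ENNReal

noncomputable section

namespace NoisyPrice

variable {Ω : Type*} [mΩ : MeasurableSpace Ω]

/-! ### Paths, Brownian motion and stochastic integrals with respect to it -/

/-- Right-continuous with left limits. -/
def IsCadlag (f : ℝ≥0 → ℝ) : Prop :=
  ∀ t, ContinuousWithinAt f (Set.Ici t) t ∧ ∃ l, Tendsto f (𝓝[<] t) (𝓝 l)

/-- `X` is adapted to `𝓕` and has (almost surely) càdlàg paths. -/
def IsAdaptedCadlag (𝓕 : Filtration ℝ≥0 mΩ) (P : Measure Ω) (X : ℝ≥0 → Ω → ℝ) : Prop :=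
  Adapted 𝓕 X ∧ ∀ᵐ ω ∂P, IsCadlag (X · ω)

/-- A standard Brownian motion relative to the filtration `𝓕`. -/
structure IsBrownianWrt (𝓕 : Filtration ℝ≥0 mΩ) (P : Measure Ω) (W : ℝ≥0 → Ω → ℝ) : Prop where
  brownian : IsBrownianReal W P
  adapted : Adapted 𝓕 W
  indep : ∀ s t, s ≤ t →
    Indep (MeasurableSpace.comap (fun ω => W t ω - W s ω) inferInstance) (𝓕 s) P

/-- The left-endpoint sum `∑ i, H (t_i) (W (t_{i+1} ∧ t) - W (t_i ∧ t))` on the grid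
`t_i = i / N`. All terms with `t_i ≥ t` vanish, so the range of summation covers `[0, t]`. -/
def itoSum (H W : ℝ≥0 → Ω → ℝ) (N : ℕ) (t : ℝ≥0) (ω : Ω) : ℝ :=
  ∑ i ∈ Finset.range (N * ⌈t⌉₊),
    H ((i : ℝ≥0) / N) ω *
      (W (min (((i : ℝ≥0) + 1) / N) t) ω - W (min ((i : ℝ≥0) / N) t) ω)

/-- `Y` is the Itô integral process `Y t = ∫₀ᵗ H dW` of an adapted càdlàg integrand `H`:
it has continuous paths and is the limit in probability of the left-endpoint sums.
This determines `Y` up to indistinguishability. -/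
def IsItoIntegral (P : Measure Ω) (H W Y : ℝ≥0 → Ω → ℝ) : Prop :=
  (∀ᵐ ω ∂P, Continuous (Y · ω)) ∧
    ∀ t, TendstoInMeasure P (fun N => itoSum H W N t) atTop (Y t)

/-- The pathwise integral `∫₀ᵗ a_s ds`. -/
def timeIntegral (a : ℝ≥0 → Ω → ℝ) (t : ℝ≥0) (ω : Ω) : ℝ :=
  ∫ s in (0 : ℝ)..t, a s.toNNReal ω

/-- `X` is of the form `X t = X 0 + ∫₀ᵗ a ds + ∫₀ᵗ b dW + ∫₀ᵗ v dB`, where `X 0` is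
`𝓕 0`-measurable and `a`, `b`, `v` are adapted and càdlàg. -/
def HasItoForm (𝓕 : Filtration ℝ≥0 mΩ) (P : Measure Ω) (W B X : ℝ≥0 → Ω → ℝ) : Prop :=
  Adapted 𝓕 X ∧
  ∃ a b v : ℝ≥0 → Ω → ℝ,
    IsAdaptedCadlag 𝓕 P a ∧ IsAdaptedCadlag 𝓕 P b ∧ IsAdaptedCadlag 𝓕 P v ∧
    ∃ I J : ℝ≥0 → Ω → ℝ, IsItoIntegral P b W I ∧ IsItoIntegral P v B J ∧
      ∀ᵐ ω ∂P, ∀ t, X t ω = X 0 ω + timeIntegral a t ω + I t ω + J t ω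

/-! ### Poisson random measures and the jump part -/

/-- Lebesgue measure on the time axis `[0, ∞)`. -/
def timeMeasure : Measure ℝ≥0 := Measure.comap ((↑) : ℝ≥0 → ℝ) volume

/-- `N` is a Poisson random measure on `[0, ∞) × ℝ`, relative to `𝓕`, with compensator
(intensity) `ν (ds, dx) = ds F(dx)`. -/
structure IsPoissonRandomMeasure (𝓕 : Filtration ℝ≥0 mΩ) (P : Measure Ω) (F : Measure ℝ)
    (N : Ω → Measure (ℝ≥0 × ℝ)) : Prop where
  measurable : Measurable N
  law : ∀ A : Set (ℝ≥0 × ℝ), MeasurableSet A → (timeMeasure.prod F) A < ∞ →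
    P.map (fun ω => N ω A) =
      (poissonMeasure ((timeMeasure.prod F) A).toNNReal).map (fun k : ℕ => (k : ℝ≥0∞))
  indep_disjoint : ∀ (k : ℕ) (A : Fin k → Set (ℝ≥0 × ℝ)), (∀ i, MeasurableSet (A i)) →
    Pairwise (fun i j => Disjoint (A i) (A j)) → iIndepFun (fun i ω => N ω (A i)) P
  adapted : ∀ (t : ℝ≥0) (A : Set (ℝ≥0 × ℝ)), MeasurableSet A → A ⊆ Set.Iic t ×ˢ Set.univ →
    Measurable[𝓕 t] (fun ω => N ω A)
  indep_future : ∀ t : ℝ≥0,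
    Indep (MeasurableSpace.comap (fun ω => (N ω).restrict (Set.Ioi t ×ˢ Set.univ)) inferInstance)
      (𝓕 t) P

/-- The truncated compensated integral
`∫₀ᵗ ∫ δ(s,x) 1{ε < |δ(s,x)| ≤ 1} (μ - ν)(ds, dx)`, in which both parts are ordinary integrals. -/
def smallJumpSum (F : Measure ℝ) (N : Ω → Measure (ℝ≥0 × ℝ)) (δ : ℝ≥0 → Ω → ℝ → ℝ)
    (ε : ℝ) (t : ℝ≥0) (ω : Ω) : ℝ :=
  (∫ z in {z : ℝ≥0 × ℝ | z.1 ∈ Set.Ioc 0 t ∧ ε < |δ z.1 ω z.2| ∧ |δ z.1 ω z.2| ≤ 1},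
      δ z.1 ω z.2 ∂(N ω)) -
    ∫ z in {z : ℝ≥0 × ℝ | z.1 ∈ Set.Ioc 0 t ∧ ε < |δ z.1 ω z.2| ∧ |δ z.1 ω z.2| ≤ 1},
      δ z.1 ω z.2 ∂(timeMeasure.prod F)

/-- `M` is the compensated small-jump process `∫₀ᵗ ∫ δ 1{|δ| ≤ 1} d(μ - ν)`: it has càdlàg paths
and is the limit in probability, as `ε → 0`, of the integrals over jumps larger than `ε`. -/
def IsSmallJumpIntegral (P : Measure Ω) (F : Measure ℝ) (N : Ω → Measure (ℝ≥0 × ℝ))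
    (δ : ℝ≥0 → Ω → ℝ → ℝ) (M : ℝ≥0 → Ω → ℝ) : Prop :=
  (∀ᵐ ω ∂P, IsCadlag (M · ω)) ∧
    ∀ t, TendstoInMeasure P (fun m : ℕ => smallJumpSum F N δ (1 / ((m : ℝ) + 1)) t) atTop (M t)

/-- The big-jump process `∫₀ᵗ ∫ δ 1{|δ| > 1} dμ`. -/
def bigJumps (N : Ω → Measure (ℝ≥0 × ℝ)) (δ : ℝ≥0 → Ω → ℝ → ℝ) (t : ℝ≥0) (ω : Ω) : ℝ :=
  ∫ z in {z : ℝ≥0 × ℝ | z.1 ∈ Set.Ioc 0 t ∧ 1 < |δ z.1 ω z.2|}, δ z.1 ω z.2 ∂(N ω)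

/-- `δ` is a predictable function: measurable for the product of the predictable σ-algebra and
the Borel σ-algebra of `ℝ`. -/
def IsPredictableFunction (𝓕 : Filtration ℝ≥0 mΩ) (δ : ℝ≥0 → Ω → ℝ → ℝ) : Prop :=
  Measurable[𝓕.predictable.prod (inferInstance : MeasurableSpace ℝ)]
    (fun q : (ℝ≥0 × Ω) × ℝ => δ q.1.1 q.1.2 q.2)

/-- Local domination of the jump sizes with activity index `β`; the integral of `ψ ^ β` is taken
over `{ψ ≠ 0}`, i.e. with the convention `0 ^ 0 = 0`. -/
def IsDominated (𝓕 : Filtration ℝ≥0 mΩ) (P : Measure Ω) (F : Measure ℝ) (β : ℝ)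
    (δ : ℝ≥0 → Ω → ℝ → ℝ) : Prop :=
  ∃ (τ : ℕ → Ω → WithTop ℝ≥0) (ψ : ℕ → ℝ → ℝ), IsLocalizingSequence 𝓕 τ P ∧
    ∀ k, Measurable (ψ k) ∧
      (∀ (ω : Ω) (s : ℝ≥0) (x : ℝ), (s : WithTop ℝ≥0) ≤ τ k ω → min |δ s ω x| 1 ≤ ψ k x) ∧
      ∫⁻ x in {x | ψ k x ≠ 0}, ENNReal.ofReal (ψ k x ^ β) ∂F < ∞

/-- Local boundedness of a process (on `(0, ∞)`). -/
def IsLocallyBounded (𝓕 : Filtration ℝ≥0 mΩ) (P : Measure Ω) (a : ℝ≥0 → Ω → ℝ) : Prop :=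
  ∃ (τ : ℕ → Ω → WithTop ℝ≥0) (C : ℕ → ℝ), IsLocalizingSequence 𝓕 τ P ∧
    ∀ (k : ℕ) (ω : Ω) (s : ℝ≥0), 0 < s → (s : WithTop ℝ≥0) ≤ τ k ω → |a s ω| ≤ C k

/-- The efficient log-price `p t = p 0 + r t` with `r = r^c + r^d`: drift `a`, volatility `σ`,
jump sizes `δ` driven by the Poisson random measure `N` with intensity `ds F(dx)`, and jump
activity index `β`. -/
structure IsLogPrice (𝓕 : Filtration ℝ≥0 mΩ) (P : Measure Ω) (W : ℝ≥0 → Ω → ℝ)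
    (F : Measure ℝ) (N : Ω → Measure (ℝ≥0 × ℝ)) (β : ℝ)
    (a σ : ℝ≥0 → Ω → ℝ) (δ : ℝ≥0 → Ω → ℝ → ℝ) (p : ℝ≥0 → Ω → ℝ) : Prop where
  adapted : Adapted 𝓕 p
  drift_predictable : IsStronglyPredictable 𝓕 a
  drift_locallyBounded : IsLocallyBounded 𝓕 P a
  vol : IsAdaptedCadlag 𝓕 P σ
  jump_predictable : IsPredictableFunction 𝓕 δ
  jump_dominated : IsDominated 𝓕 P F β δ
  decomposition : ∃ I M : ℝ≥0 → Ω → ℝ, IsItoIntegral P σ W I ∧ IsSmallJumpIntegral P F N δ M ∧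
    ∀ᵐ ω ∂P, ∀ t, p t ω = p 0 ω + (timeIntegral a t ω + I t ω) + (M t ω + bigJumps N δ t ω)

/-! ### Microstructure noise -/

/-- The moving average `π i = u i + ∑_{j=1}^q θ j * u (i - j)`. -/
def movingAverage (q : ℕ) (θ : ℕ → ℝ) (u : ℤ → Ω → ℝ) (i : ℤ) (ω : Ω) : ℝ :=
  u i ω + ∑ j ∈ Finset.Icc 1 q, θ j * u (i - j) ω

/-- The autocovariance `ρ(m) = E[π_0 π_m]`. -/
def autocov (P : Measure Ω) (q : ℕ) (θ : ℕ → ℝ) (u : ℤ → Ω → ℝ) (m : ℕ) : ℝ :=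
  ∫ ω, movingAverage q θ u 0 ω * movingAverage q θ u m ω ∂P

/-- The long-run variance `ρ² = ρ(0) + 2 ∑_{m=1}^q ρ(m)` of `π`. -/
def longRunVar (P : Measure Ω) (q : ℕ) (θ : ℕ → ℝ) (u : ℤ → Ω → ℝ) : ℝ :=
  autocov P q θ u 0 + 2 * ∑ m ∈ Finset.Icc 1 q, autocov P q θ u m

/-- The conditions on the noise `ε_{i/n} = w_{i/n} π_i`, where `π` is the moving average of order
`q` of the innovations `u` and `w` is the noise volatility process. -/
structure IsNoise (𝓕 : Filtration ℝ≥0 mΩ) (P : Measure Ω) (W B : ℝ≥0 → Ω → ℝ)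
    (p w : ℝ≥0 → Ω → ℝ) (q : ℕ) (θ : ℕ → ℝ) (u : ℤ → Ω → ℝ) : Prop where
  measurable : ∀ i, Measurable (u i)
  indep : iIndepFun u P
  ident : ∀ i, IdentDistrib (u i) (u 0) P P
  integrable : Integrable (u 0) P
  mean_zero : ∫ ω, u 0 ω ∂P = 0
  sum_ne_zero : 1 + ∑ j ∈ Finset.Icc 1 q, θ j ≠ 0
  unit_variance : Var[movingAverage q θ u 0; P] = 1
  symmetric : IdentDistrib (movingAverage q θ u 0) (fun ω => -movingAverage q θ u 0 ω) P P
  moments : ∀ r : ℝ≥0, MemLp (movingAverage q θ u 0) r P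
  vol_form : HasItoForm 𝓕 P W B w
  indep_price : IndepFun (fun ω (i : ℕ) => movingAverage q θ u i ω) (fun ω t => (p t ω, w t ω)) P
  cramer : limsup (fun t : ℝ => ‖charFun (P.map (u 0)) t‖) (cocompact ℝ) < 1

/-! ### The estimator -/

/-- The observed log-price `p*_{i/n} = p_{i/n} + w_{i/n} π_i`. -/
def obsPrice (p w : ℝ≥0 → Ω → ℝ) (q : ℕ) (θ : ℕ → ℝ) (u : ℤ → Ω → ℝ) (n i : ℕ) (ω : Ω) : ℝ :=
  p ((i : ℝ≥0) / n) ω + w ((i : ℝ≥0) / n) ω * movingAverage q θ u i ω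

/-- The local average `h⁻¹ ∑_{j=0}^{h-1} x (i + j)`. -/
def localMean (x : ℕ → ℝ) (h i : ℕ) : ℝ :=
  1 / (h : ℝ) * ∑ j ∈ Finset.range h, x (i + j)

/-- The sample autocovariance `ρ_n(m)` computed from the observations `x 0, …, x n` with
window `h`, for `5 h ≤ n`. -/
def sampleAutocov (x : ℕ → ℝ) (n h m : ℕ) : ℝ :=
  1 / ((n : ℝ) - 5 * h + 1) *
    ∑ i ∈ Finset.range (n - 5 * h + 1),
      (x i - localMean x h (i + 2 * h)) * (x (i + m) - localMean x h (i + 4 * h))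

/-- The long-run noise variance estimator `ρ_n(0) + 2 ∑_{m=1}^{l} ρ_n(m)`. -/
def noiseVarEst (x : ℕ → ℝ) (n h l : ℕ) : ℝ :=
  sampleAutocov x n h 0 + 2 * ∑ m ∈ Finset.Icc 1 l, sampleAutocov x n h m

end NoisyPrice

end

/-!
The error of the estimator is small for second-moment reasons, conditionally on the price `p` and
the noise volatility `w`, of which `π` is independent.

The only properties of `p` and `w` that matter are local: outside an event of small probability
both are bounded on the grids of `[0, 1]`, and `𝔼 |X t - X s|² ≤ C (t - s)`. This is
`LocallyMeanSqLipschitz`, and each term of the semimartingale decompositions has it. Drifts are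
Lipschitz on the localising event. For Itô integrals (`IsItoIntegral.locallyMeanSqLipschitz`) the
integrand is clipped at its bound on that event; the left-endpoint sums of the clipped integrand
satisfy Itô's bound, which passes to the limit in probability by Fatou's lemma. For the compensated
small jumps the same scheme rests on the isometry `integral_sq_compensated` for integrals of
bounded predictable functions. It is derived from an abstract fact, `integral_sq_kernel_sub`: a
difference of two random measures whose values on a π-system are orthogonal with respect to a
control measure is an `L²` isometry, because the two measures on the product space that have to be
compared agree on rectangles. The large jumps come from finitely many points of the Poisson random
measure, and their sizes are bounded on a large event (`exists_jump_bound`): by the compensation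
formula the expected number of jumps larger than `K` is small, and this number is an integer.
`HasItoForm.regularity` and `IsLogPrice.regularity` collect these facts.

Given `p` and `w`, the estimator is an average over `i ≤ n - 5 h` of terms that depend on the
observations `i, …, i + 5 h` only, and `π` is `q`-dependent (`IsNoise.isFinitelyDependent`). Terms
at distance larger than `5 h + q` are therefore independent, each has variance `O(l²)`, and the
conditional variance is `O(l² h / n)` (`lintegral_sq_noiseVarEst_sub_le`). Its square root is
`O(n ^ (-11/40))`, which is `o(n ^ (-1/4))`.

The windows of the two local means are separated from each other and from `i` and `i + m` by more
than `q`, so in the conditional mean all cross terms vanish and only two parts remain. The first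
consists of products of price increments over times `O(h / n)` and contributes `O(l h / n)`. The
second is the average of `∑ c_m ρ(m) w_i w_{i+m}`, with `c_0 = 1` and `c_m = 2` otherwise. Replacing
`w_{i+m}` by `w_i` and the Riemann sum of `w²` by its integral costs `O(n ^ (-1/2))` each, and the
missing indices at the boundary cost `O(h / n)`. `IsNoise.eLpNorm_noiseVarEst_sub_le` adds up the
five errors in `L¹` on the localising event, and `tendsto_rpow_mul_error` compares the rates.
-/

namespace NoisyPrice

variable {Ω : Type*} [mΩ : MeasurableSpace Ω]

/-! ### Localisation -/

lemma IsCadlag.exists_bound {f : ℝ≥0 → ℝ} (hf : IsCadlag f) (T : ℝ≥0) :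
    ∃ K : ℝ≥0, ∀ t ≤ T, ‖f t‖ₑ ≤ K := by
  have h : ∃ K : ℝ≥0, ∀ t ∈ Set.Icc 0 T, ‖f t‖ₑ ≤ K := by
    refine isCompact_Icc.induction_on (p := fun s => ∃ K : ℝ≥0, ∀ t ∈ s, ‖f t‖ₑ ≤ K)
      ⟨0, by simp⟩ ?_ ?_ ?_
    · rintro s t hst ⟨K, hK⟩
      exact ⟨K, fun x hx => hK x (hst hx)⟩
    · rintro s t ⟨K, hK⟩ ⟨L, hL⟩
      refine ⟨max K L, ?_⟩
      rintro x (hx | hx)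
      · exact (hK x hx).trans (by simp)
      · exact (hL x hx).trans (by simp)
    · intro x _
      obtain ⟨h1, l, h2⟩ := hf x
      have e1 : ∀ᶠ y in 𝓝[≥] x, ‖f y‖ < ‖f x‖ + 1 :=
        h1.norm.eventually (gt_mem_nhds (by linarith))
      have e2 : ∀ᶠ y in 𝓝[<] x, ‖f y‖ < ‖l‖ + 1 :=
        h2.norm.eventually (gt_mem_nhds (by linarith))
      refine ⟨_, mem_nhdsWithin_of_mem_nhds (show {y | ‖f y‖ ≤ max (‖f x‖ + 1) (‖l‖ + 1)} ∈ 𝓝 x from ?_),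
        (max (‖f x‖ + 1) (‖l‖ + 1)).toNNReal, ?_⟩
      · rw [← nhdsLT_sup_nhdsGE, mem_sup]
        exact ⟨e2.mono fun y hy => hy.le.trans (le_max_right _ _),
          e1.mono fun y hy => hy.le.trans (le_max_left _ _)⟩
      · intro y hy
        rw [← ofReal_norm]
        exact ENNReal.ofReal_le_ofReal hy
  obtain ⟨K, hK⟩ := h
  exact ⟨K, fun t ht => hK t ⟨zero_le, ht⟩⟩

/-- The supremum of `|X t ω|` over the rational times `t ∈ [0, 1]`. The pairs with vanishing
denominator stand for the time `0`. -/
noncomputable def gridSup (X : ℝ≥0 → Ω → ℝ) (ω : Ω) : ℝ≥0∞ :=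
  ⨆ x : ℕ × ℕ, if x.1 ≤ x.2 then ‖X ((x.1 : ℝ≥0) / x.2) ω‖ₑ else 0

lemma measurable_gridSup {X : ℝ≥0 → Ω → ℝ} (hX : ∀ t, Measurable (X t)) :
    Measurable (gridSup X) := by
  unfold gridSup
  refine Measurable.iSup fun x => ?_
  split_ifs
  · exact (hX _).enorm
  · exact measurable_const

lemma le_gridSup {Ω : Type*} (X : ℝ≥0 → Ω → ℝ) (ω : Ω) {i n : ℕ} (h : i ≤ n) :
    ‖X ((i : ℝ≥0) / n) ω‖ₑ ≤ gridSup X ω := by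
  refine le_trans ?_ (le_iSup _ ((i, n) : ℕ × ℕ))
  simp [h]

lemma gridSup_lt_top {Ω : Type*} {X : ℝ≥0 → Ω → ℝ} {ω : Ω} {K : ℝ≥0}
    (h : ∀ t ≤ 1, ‖X t ω‖ₑ ≤ K) : gridSup X ω < ∞ := by
  refine lt_of_le_of_lt (iSup_le fun x => ?_) (ENNReal.coe_lt_top (r := K))
  split_ifs with hx
  · apply h
    rcases Nat.eq_zero_or_pos x.2 with h0 | h0
    · simp [h0]
    · rw [div_le_one (by exact_mod_cast h0)]
      exact_mod_cast hx
  · simp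

/-- An almost surely finite random variable is bounded up to an event of small probability. -/
lemma exists_measure_not_le_le {P : Measure Ω} [IsFiniteMeasure P] {R : Ω → ℝ≥0∞}
    (hR : Measurable R) (hfin : ∀ᵐ ω ∂P, R ω < ∞) {ζ : ℝ≥0∞} (hζ : 0 < ζ) :
    ∃ K : ℝ≥0, P {ω | R ω ≤ K}ᶜ ≤ ζ := by
  have h1 : Tendsto (fun n : ℕ => P {ω | R ω ≤ n}ᶜ) atTop (𝓝 (P (⋂ n : ℕ, {ω | R ω ≤ n}ᶜ))) := by
    refine tendsto_measure_iInter_atTop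
      (fun n => (measurableSet_le hR measurable_const).compl.nullMeasurableSet) ?_
      ⟨0, measure_ne_top _ _⟩
    intro m n hmn ω hω
    simp only [Set.mem_compl_iff, Set.mem_ofPred_eq, not_le] at hω ⊢
    exact lt_of_le_of_lt (by exact_mod_cast hmn) hω
  have h2 : P (⋂ n : ℕ, {ω | R ω ≤ n}ᶜ) = 0 := by
    refine measure_mono_null ?_ (ae_iff.1 hfin)
    intro ω hω
    simp only [Set.mem_iInter, Set.mem_compl_iff, Set.mem_ofPred_eq, not_le] at hω
    simp only [Set.mem_ofPred_eq, not_lt, top_le_iff]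
    exact ENNReal.eq_top_of_forall_nnreal_le fun r => by
      obtain ⟨n, hn⟩ := exists_nat_ge r
      exact le_trans (by exact_mod_cast hn) (hω n).le
  rw [h2] at h1
  obtain ⟨n, hn⟩ := ((h1.eventually (gt_mem_nhds hζ))).exists
  exact ⟨n, by simpa using hn.le⟩

/-- Up to an event of arbitrarily small probability, `𝔼 |X t - X s|² ≤ C (t - s)` on `[0, 1]`.
The bound is put on a measurable function dominating the squared increment because stochastic
integrals, being limits in probability, need not be measurable. -/
def LocallyMeanSqLipschitz (P : Measure Ω) (X : ℝ≥0 → Ω → ℝ) : Prop :=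
  ∀ ζ : ℝ≥0∞, 0 < ζ → ∃ G : Set Ω, P Gᶜ ≤ ζ ∧ ∃ C : ℝ≥0, ∀ s t : ℝ≥0, s ≤ t → t ≤ 1 →
    ∃ f : Ω → ℝ≥0∞, Measurable f ∧ (∀ᵐ ω ∂P, ω ∈ G → ‖X t ω - X s ω‖ₑ ^ 2 ≤ f ω) ∧
      ∫⁻ ω, f ω ∂P ≤ C * (t - s : ℝ≥0)

lemma measure_compl_inter_le {P : Measure Ω} {G H : Set Ω} {ζ : ℝ≥0∞} (hG : P Gᶜ ≤ ζ / 2)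
    (hH : P Hᶜ ≤ ζ / 2) : P (G ∩ H)ᶜ ≤ ζ := by
  rw [Set.compl_inter]
  refine (measure_union_le _ _).trans ((add_le_add hG hH).trans ?_)
  rw [ENNReal.add_halves]

lemma enorm_add_sq_le (a b : ℝ) : ‖a + b‖ₑ ^ 2 ≤ 2 * ‖a‖ₑ ^ 2 + 2 * ‖b‖ₑ ^ 2 := by
  have h : (a + b) ^ 2 ≤ 2 * a ^ 2 + 2 * b ^ 2 := by nlinarith [sq_nonneg (a - b)]
  have e : ∀ x : ℝ, ‖x‖ₑ ^ 2 = ENNReal.ofReal (x ^ 2) := fun x => by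
    rw [← ofReal_norm, ← ENNReal.ofReal_pow (norm_nonneg _), Real.norm_eq_abs, sq_abs]
  rw [e, e, e]
  have : (2 : ℝ≥0∞) = ENNReal.ofReal 2 := by simp
  rw [this, ← ENNReal.ofReal_mul (by norm_num), ← ENNReal.ofReal_mul (by norm_num),
    ← ENNReal.ofReal_add (by positivity) (by positivity)]
  exact ENNReal.ofReal_le_ofReal h

lemma LocallyMeanSqLipschitz.add {P : Measure Ω} {X Y : ℝ≥0 → Ω → ℝ}
    (hX : LocallyMeanSqLipschitz P X) (hY : LocallyMeanSqLipschitz P Y) :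
    LocallyMeanSqLipschitz P (fun t ω => X t ω + Y t ω) := by
  intro ζ hζ
  obtain ⟨G, hG, C, hC⟩ := hX (ζ / 2) (ENNReal.half_pos hζ.ne')
  obtain ⟨H, hH, D, hD⟩ := hY (ζ / 2) (ENNReal.half_pos hζ.ne')
  refine ⟨G ∩ H, measure_compl_inter_le hG hH, 2 * C + 2 * D, fun s t hst ht => ?_⟩
  obtain ⟨f, hf, hf1, hf2⟩ := hC s t hst ht
  obtain ⟨g, hg, hg1, hg2⟩ := hD s t hst ht
  refine ⟨fun ω => 2 * f ω + 2 * g ω, by fun_prop, ?_, ?_⟩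
  · filter_upwards [hf1, hg1] with ω h1 h2 hω
    rw [show X t ω + Y t ω - (X s ω + Y s ω) = (X t ω - X s ω) + (Y t ω - Y s ω) by ring]
    refine (enorm_add_sq_le _ _).trans ?_
    gcongr
    · exact h1 hω.1
    · exact h2 hω.2
  · rw [lintegral_add_left (by fun_prop), lintegral_const_mul _ hf, lintegral_const_mul _ hg]
    calc _ ≤ 2 * (C * (t - s : ℝ≥0)) + 2 * (D * (t - s : ℝ≥0) : ℝ≥0∞) := by gcongr
      _ = _ := by push_cast; ring

lemma LocallyMeanSqLipschitz.congr {P : Measure Ω} {X Y : ℝ≥0 → Ω → ℝ}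
    (hX : LocallyMeanSqLipschitz P X)
    (h : ∀ᵐ ω ∂P, ∀ s t, Y t ω - Y s ω = X t ω - X s ω) :
    LocallyMeanSqLipschitz P Y := by
  intro ζ hζ
  obtain ⟨G, hG, C, hC⟩ := hX ζ hζ
  refine ⟨G, hG, C, fun s t hst ht => ?_⟩
  obtain ⟨f, hf, hf1, hf2⟩ := hC s t hst ht
  refine ⟨f, hf, ?_, hf2⟩
  filter_upwards [hf1, h] with ω h1 h2 hω
  rw [h2]
  exact h1 hω

/-- Processes with Lipschitz paths on events of large probability; on `[0, 1]` one has
`(t - s) ^ 2 ≤ t - s`. -/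
lemma locallyMeanSqLipschitz_of_lipschitz {P : Measure Ω} [IsProbabilityMeasure P]
    {X : ℝ≥0 → Ω → ℝ}
    (h : ∀ ζ : ℝ≥0∞, 0 < ζ → ∃ G : Set Ω, P Gᶜ ≤ ζ ∧ ∃ K : ℝ≥0, ∀ᵐ ω ∂P, ω ∈ G →
      ∀ s t, s ≤ t → t ≤ 1 → ‖X t ω - X s ω‖ₑ ≤ K * (t - s : ℝ≥0)) :
    LocallyMeanSqLipschitz P X := by
  intro ζ hζ
  obtain ⟨G, hG, K, hK⟩ := h ζ hζ
  refine ⟨G, hG, K ^ 2, fun s t hst ht => ⟨fun _ => (K * (t - s : ℝ≥0)) ^ 2, measurable_const,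
    ?_, ?_⟩⟩
  · filter_upwards [hK] with ω h1 hω
    gcongr
    exact h1 hω s t hst ht
  · rw [lintegral_const, measure_univ, mul_one, mul_pow]
    push_cast
    gcongr
    norm_cast
    rw [sq]
    exact mul_le_of_le_one_left zero_le (tsub_le_self.trans ht)

/-- A limit in probability inherits second moment bounds (Fatou's lemma), even if the bounds only
hold for processes which coincide with the approximations on an event. -/
lemma exists_dominating_of_tendstoInMeasure {P : Measure Ω}
    {Y : ℕ → Ω → ℝ} {X : Ω → ℝ} (hY : TendstoInMeasure P Y atTop X) {G : Set Ω}
    {Z : ℕ → Ω → ℝ} (hZ : ∀ m, AEMeasurable (Z m) P)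
    (hYZ : ∀ m, ∀ᵐ ω ∂P, ω ∈ G → Y m ω = Z m ω) {c : ℝ≥0∞}
    (hc : ∀ m, ∫⁻ ω, ‖Z m ω‖ₑ ^ 2 ∂P ≤ c) :
    ∃ f : Ω → ℝ≥0∞, Measurable f ∧ (∀ᵐ ω ∂P, ω ∈ G → ‖X ω‖ₑ ^ 2 ≤ f ω) ∧ ∫⁻ ω, f ω ∂P ≤ c := by
  obtain ⟨ns, -, hns⟩ := hY.exists_seq_tendsto_ae
  let Z' : ℕ → Ω → ℝ := fun m => (hZ m).mk
  have hZ' : ∀ m, Measurable (Z' m) := fun m => (hZ m).measurable_mk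
  have hZZ' : ∀ m, Z m =ᵐ[P] Z' m := fun m => (hZ m).ae_eq_mk
  refine ⟨fun ω => liminf (fun i => ‖Z' (ns i) ω‖ₑ ^ 2) atTop,
    Measurable.liminf fun i => ((hZ' _).enorm.pow_const 2), ?_, ?_⟩
  · filter_upwards [hns, ae_all_iff.2 hYZ, ae_all_iff.2 hZZ'] with ω h1 h2 h3 hω
    have h4 : Tendsto (fun i => ‖Z' (ns i) ω‖ₑ ^ 2) atTop (𝓝 (‖X ω‖ₑ ^ 2)) := by
      have : (fun i => ‖Z' (ns i) ω‖ₑ ^ 2) = fun i => ‖Y (ns i) ω‖ₑ ^ 2 := by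
        funext i; rw [← h3, h2 _ hω]
      rw [this]
      exact ((ENNReal.continuous_pow 2).tendsto _).comp h1.enorm
    exact h4.liminf_eq.ge
  · refine (lintegral_liminf_le fun i => ((hZ' _).enorm.pow_const 2)).trans ?_
    refine liminf_le_of_le (by isBoundedDefault) fun b hb => ?_
    obtain ⟨i, hi⟩ := hb.exists
    refine hi.trans (le_trans (le_of_eq ?_) (hc (ns i)))
    refine lintegral_congr_ae ?_
    filter_upwards [hZZ' (ns i)] with ω h
    rw [h]

lemma tendstoInMeasure_sub {P : Measure Ω} {Y Y' : ℕ → Ω → ℝ} {X X' : Ω → ℝ}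
    (h : TendstoInMeasure P Y atTop X) (h' : TendstoInMeasure P Y' atTop X') :
    TendstoInMeasure P (fun m ω => Y m ω - Y' m ω) atTop (fun ω => X ω - X' ω) := by
  intro ε hε
  have h1 := h (ε / 2) (ENNReal.half_pos hε.ne')
  have h2 := h' (ε / 2) (ENNReal.half_pos hε.ne')
  have h3 := h1.add h2
  rw [add_zero] at h3
  refine tendsto_of_tendsto_of_tendsto_of_le_of_le tendsto_const_nhds h3 (fun _ => zero_le) ?_
  intro m
  refine (measure_mono ?_).trans (measure_union_le _ _)
  intro ω hω
  by_contra hcon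
  simp only [Set.mem_union, Set.mem_ofPred_eq, not_or, not_le] at hcon hω
  have : edist (Y m ω - Y' m ω) (X ω - X' ω) ≤ edist (Y m ω) (X ω) + edist (Y' m ω) (X' ω) := by
    rw [sub_eq_add_neg, sub_eq_add_neg]
    refine (edist_add_add_le _ _ _ _).trans ?_
    rw [edist_neg_neg]
  exact absurd hω (not_le.2 (this.trans_lt
    ((ENNReal.add_lt_add hcon.1 hcon.2).trans_eq (ENNReal.add_halves ε))))

/-- To prove convergence to zero in probability it suffices, up to events of small probability, to
dominate by measurable functions with vanishing integrals. -/
lemma tendstoInMeasure_zero_of_forall_exists {P : Measure Ω} {X : ℕ → Ω → ℝ}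
    (h : ∀ ζ : ℝ≥0∞, 0 < ζ → ∃ G : Set Ω, P Gᶜ ≤ ζ ∧ ∃ f : ℕ → Ω → ℝ≥0∞, (∀ n, Measurable (f n)) ∧
      (∀ᶠ n in atTop, ∀ᵐ ω ∂P, ω ∈ G → ‖X n ω‖ₑ ≤ f n ω) ∧
      Tendsto (fun n => ∫⁻ ω, f n ω ∂P) atTop (𝓝 0)) :
    TendstoInMeasure P X atTop (fun _ => 0) := by
  intro ε hε
  rw [ENNReal.tendsto_nhds_zero]
  intro η hη
  obtain ⟨G, hG, f, hf, hdom, hlim⟩ := h (η / 2) (ENNReal.half_pos hη.ne')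
  rcases eq_or_ne ε ∞ with rfl | hε'
  · refine Eventually.of_forall fun n => ?_
    have : {x | (∞ : ℝ≥0∞) ≤ edist (X n x) 0} = ∅ := by
      ext x; simp
    rw [this]; simp
  have h2 : ∀ᶠ n in atTop, (∫⁻ ω, f n ω ∂P) / ε ≤ η / 2 := by
    have h3 := ENNReal.Tendsto.div_const hlim (b := ε) (Or.inr hε.ne')
    rw [ENNReal.zero_div] at h3
    exact (ENNReal.tendsto_nhds_zero.1 h3) (η / 2) (ENNReal.half_pos hη.ne')
  filter_upwards [hdom, h2] with n h3 h4
  have h5 : P {x | ε ≤ edist (X n x) 0} ≤ P Gᶜ + P {x | ε ≤ f n x} := by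
    refine le_trans (measure_mono_ae ?_) (measure_union_le _ _)
    filter_upwards [h3] with ω hω hx
    change ω ∈ Gᶜ ∪ {x | ε ≤ f n x}
    by_cases hg : ω ∈ G
    · right
      have : ε ≤ edist (X n ω) 0 := hx
      rw [edist_zero_right] at this
      exact this.trans (hω hg)
    · exact Or.inl hg
  have h6 : P {x | ε ≤ f n x} ≤ η / 2 :=
    (meas_ge_le_lintegral_div (μ := P) (hf n).aemeasurable hε.ne' hε').trans h4
  calc _ ≤ η / 2 + η / 2 := h5.trans (add_le_add hG h6)
    _ = η := ENNReal.add_halves η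

/-! ### Second moments of Itô integrals -/

/-- Second moment bound for a discrete stochastic integral with a bounded adapted integrand: the
increments `D i` are centred and independent of the past, so the mixed terms vanish. -/
lemma memLp_and_integral_sq_martingale_sum_le {P : Measure Ω} [IsProbabilityMeasure P]
    {𝓖 : ℕ → MeasurableSpace Ω} (h𝓖 : ∀ i, 𝓖 i ≤ mΩ) (hmono : Monotone 𝓖)
    {H D : ℕ → Ω → ℝ} {K : ℝ} (hH : ∀ i, Measurable[𝓖 i] (H i)) (hHK : ∀ i ω, |H i ω| ≤ K)
    (hD : ∀ i, Measurable[𝓖 (i + 1)] (D i))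
    (hind : ∀ i, Indep (MeasurableSpace.comap (D i) inferInstance) (𝓖 i) P)
    (hL2 : ∀ i, MemLp (D i) 2 P) (hmean : ∀ i, ∫ ω, D i ω ∂P = 0)
    {v : ℕ → ℝ} (hv : ∀ i, ∫ ω, D i ω ^ 2 ∂P ≤ v i) (m : ℕ) :
    MemLp (fun ω => ∑ i ∈ Finset.range m, H i ω * D i ω) 2 P ∧
      ∫ ω, (∑ i ∈ Finset.range m, H i ω * D i ω) ^ 2 ∂P ≤ K ^ 2 * ∑ i ∈ Finset.range m, v i := by
  have hHD : ∀ i, MemLp (fun ω => H i ω * D i ω) 2 P := fun i => by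
    refine MemLp.of_le_mul (c := K) (hL2 i)
      (((hH i).mono (h𝓖 i) le_rfl).mul ((hD i).mono (h𝓖 _) le_rfl)).aestronglyMeasurable
      (ae_of_all _ fun ω => ?_)
    rw [norm_mul]
    exact mul_le_mul_of_nonneg_right (hHK i ω) (norm_nonneg _)
  have hS : ∀ m, MemLp (fun ω => ∑ i ∈ Finset.range m, H i ω * D i ω) 2 P := fun m =>
    memLp_finsetSum _ fun i _ => hHD i
  refine ⟨hS m, ?_⟩
  induction m with
  | zero => simp
  | succ m ih =>
    have hSm : Measurable[𝓖 m] (fun ω => ∑ i ∈ Finset.range m, H i ω * D i ω) := by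
      refine Finset.measurable_fun_sum _ fun i hi => ?_
      have hi' := Finset.mem_range.1 hi
      exact ((hH i).mono (hmono hi'.le) le_rfl).mul ((hD i).mono (hmono hi') le_rfl)
    have hSH : Measurable[𝓖 m] (fun ω => (∑ i ∈ Finset.range m, H i ω * D i ω) * H m ω) :=
      hSm.mul (hH m)
    have hindep : IndepFun (fun ω => (∑ i ∈ Finset.range m, H i ω * D i ω) * H m ω) (D m) P :=
      indep_of_indep_of_le_left (hind m).symm hSH.comap_le
    have hcross : ∫ ω, (∑ i ∈ Finset.range m, H i ω * D i ω) * H m ω * D m ω ∂P = 0 := by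
      rw [hindep.integral_fun_mul_eq_mul_integral
        (hSH.mono (h𝓖 m) le_rfl).aestronglyMeasurable (hL2 m).1, hmean, mul_zero]
    have hint : Integrable (fun ω => (∑ i ∈ Finset.range m, H i ω * D i ω) * H m ω * D m ω) P := by
      have := (hS m).integrable_mul (hHD m)
      refine this.congr (ae_of_all _ fun ω => ?_)
      simp only [Pi.mul_apply]; ring
    have hHD2 : ∫ ω, (H m ω * D m ω) ^ 2 ∂P ≤ K ^ 2 * v m := by
      calc _ ≤ ∫ ω, K ^ 2 * D m ω ^ 2 ∂P := by
            refine integral_mono (hHD m).integrable_sq ((hL2 m).integrable_sq.const_mul _)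
              fun ω => ?_
            simp only [mul_pow]
            exact mul_le_mul_of_nonneg_right (sq_le_sq' (abs_le.1 (hHK m ω)).1
              (abs_le.1 (hHK m ω)).2) (sq_nonneg _)
        _ ≤ _ := by
            rw [integral_const_mul]
            exact mul_le_mul_of_nonneg_left (hv m) (sq_nonneg _)
    calc ∫ ω, (∑ i ∈ Finset.range (m + 1), H i ω * D i ω) ^ 2 ∂P
        = ∫ ω, (∑ i ∈ Finset.range m, H i ω * D i ω) ^ 2
          + (2 * ((∑ i ∈ Finset.range m, H i ω * D i ω) * H m ω * D m ω)
            + (H m ω * D m ω) ^ 2) ∂P := by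
          refine integral_congr_ae (ae_of_all _ fun ω => ?_)
          simp only [Finset.sum_range_succ]; ring
      _ = ∫ ω, (∑ i ∈ Finset.range m, H i ω * D i ω) ^ 2 ∂P + ∫ ω, (H m ω * D m ω) ^ 2 ∂P := by
          have h2 := hint.const_mul 2
          have h3 := (hHD m).integrable_sq
          rw [integral_add (hS m).integrable_sq (by exact h2.add h3),
            integral_add h2 h3, integral_const_mul, hcross]
          ring
      _ ≤ K ^ 2 * ∑ i ∈ Finset.range (m + 1), v i := by
          rw [Finset.sum_range_succ, mul_add]
          exact add_le_add ih hHD2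

lemma IsBrownianWrt.memLp_sub {𝓕 : Filtration ℝ≥0 mΩ} {P : Measure Ω} {W : ℝ≥0 → Ω → ℝ}
    (hW : IsBrownianWrt 𝓕 P W) (s t : ℝ≥0) :
    MemLp (fun ω => W t ω - W s ω) 2 P :=
  (hW.brownian.isGaussianProcess.hasGaussianLaw_sub (s := t) (t := s)).memLp_two

lemma IsBrownianWrt.integral_sub {𝓕 : Filtration ℝ≥0 mΩ} {P : Measure Ω} {W : ℝ≥0 → Ω → ℝ}
    (hW : IsBrownianWrt 𝓕 P W) (s t : ℝ≥0) : ∫ ω, (W t ω - W s ω) ∂P = 0 := by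
  have := (hW.brownian.hasLaw_sub t s).integral_eq
  rw [integral_id_gaussianReal] at this
  exact this

lemma IsBrownianWrt.integral_sub_sq {𝓕 : Filtration ℝ≥0 mΩ} {P : Measure Ω} {W : ℝ≥0 → Ω → ℝ}
    (hW : IsBrownianWrt 𝓕 P W) {s t : ℝ≥0} (hst : s ≤ t) :
    ∫ ω, (W t ω - W s ω) ^ 2 ∂P = t - s := by
  have h := (hW.brownian.hasLaw_sub t s).variance_eq
  have h0 := hW.integral_sub s t
  rw [variance_eq_integral (hW.brownian.hasLaw_sub t s).aemeasurable] at h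
  simp only [Pi.sub_apply, h0, sub_zero] at h
  rw [h, variance_id_gaussianReal]
  exact (Real.dist_eq t s).trans (abs_of_nonneg (sub_nonneg.2 (by exact_mod_cast hst)))

/-- Left-endpoint sums with a bounded integrand satisfy the second moment bound of Itô's
isometry on every time interval. -/
lemma IsBrownianWrt.memLp_and_integral_sq_itoSum_sub_le {𝓕 : Filtration ℝ≥0 mΩ} {P : Measure Ω}
    [IsProbabilityMeasure P] {W : ℝ≥0 → Ω → ℝ} (hW : IsBrownianWrt 𝓕 P W) {H : ℝ≥0 → Ω → ℝ}
    (hH : Adapted 𝓕 H) {K : ℝ} (hK : ∀ t ω, |H t ω| ≤ K) {N : ℕ} (hN : 0 < N)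
    {s t : ℝ≥0} (hst : s ≤ t) (ht : t ≤ 1) :
    MemLp (fun ω => itoSum H W N t ω - itoSum H W N s ω) 2 P ∧
      ∫ ω, (itoSum H W N t ω - itoSum H W N s ω) ^ 2 ∂P ≤ K ^ 2 * (t - s) := by
  have hN' : (0 : ℝ≥0) < N := by exact_mod_cast hN
  -- all sums may be extended to the grid of `[0, 1]`
  have hext : ∀ r : ℝ≥0, r ≤ 1 → ∀ ω, itoSum H W N r ω = ∑ i ∈ Finset.range N,
      H ((i : ℝ≥0) / N) ω * (W (min (((i : ℝ≥0) + 1) / N) r) ω - W (min ((i : ℝ≥0) / N) r) ω) := by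
    intro r hr ω
    unfold itoSum
    rcases eq_or_lt_of_le (zero_le (a := r)) with h0 | h0
    · subst h0; simp
    · rw [show ⌈r⌉₊ = 1 from le_antisymm (by rw [Nat.ceil_le]; simpa using hr)
        (Nat.ceil_pos.2 h0), mul_one]
  let c : ℕ → ℝ≥0 := fun i => max s (min ((i : ℝ≥0) / N) t)
  have hcmono : Monotone c := by
    intro i j hij
    refine max_le_max le_rfl (min_le_min ?_ le_rfl)
    gcongr
  -- the times `i / N ≥ t` carry no increment
  let H' : ℕ → Ω → ℝ := fun i => if (i : ℝ≥0) / N ≤ c i then H ((i : ℝ≥0) / N) else 0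
  let D : ℕ → Ω → ℝ := fun i ω => W (c (i + 1)) ω - W (c i) ω
  have hmin : ∀ x ω, W (min x t) ω - W (min x s) ω = W (max s (min x t)) ω - W s ω := by
    intro x ω
    rcases le_total x s with h | h
    · rw [min_eq_left (h.trans hst), min_eq_left h, max_eq_left h]; simp
    · rw [min_eq_right h, max_eq_right (le_min h hst)]
  have hsum : ∀ ω, itoSum H W N t ω - itoSum H W N s ω
      = ∑ i ∈ Finset.range N, H' i ω * D i ω := by
    intro ω
    rw [hext t ht, hext s (hst.trans ht), ← Finset.sum_sub_distrib]
    refine Finset.sum_congr rfl fun i _ => ?_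
    have h1 : D i ω = (W (min (((i : ℝ≥0) + 1) / N) t) ω - W (min ((i : ℝ≥0) / N) t) ω) -
        (W (min (((i : ℝ≥0) + 1) / N) s) ω - W (min ((i : ℝ≥0) / N) s) ω) := by
      have e1 := hmin (((i : ℝ≥0) + 1) / N) ω
      have e2 := hmin ((i : ℝ≥0) / N) ω
      have : D i ω = W (max s (min (((i : ℝ≥0) + 1) / N) t)) ω - W (max s (min ((i : ℝ≥0) / N) t)) ω := by
        simp only [D, c]; push_cast; rfl
      rw [this]; linarith
    rw [← mul_sub, ← h1]
    by_cases hi : (i : ℝ≥0) / N ≤ c i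
    · simp only [H', if_pos hi]
    · have hti : t ≤ (i : ℝ≥0) / N := by
        by_contra hcon
        exact hi (by simp only [c]; rw [min_eq_left (not_le.1 hcon).le]; exact le_max_right _ _)
      have : D i ω = 0 := by
        have h2 : t ≤ ((i : ℝ≥0) + 1) / N := hti.trans (by gcongr; simp)
        simp only [D, c]; push_cast
        rw [min_eq_right hti, min_eq_right h2, sub_self]
      rw [this]; simp
  have key := memLp_and_integral_sq_martingale_sum_le (P := P) (𝓖 := fun i => 𝓕 (c i))
    (fun i => 𝓕.le _) (fun i j hij => 𝓕.mono (hcmono hij)) (H := H') (D := D) (K := K) ?_ ?_ ?_ ?_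
    (fun i => hW.memLp_sub _ _) (fun i => hW.integral_sub _ _)
    (v := fun i => (c (i + 1) : ℝ) - c i)
    (fun i => (hW.integral_sub_sq (hcmono (Nat.le_succ i))).le) N
  · simp only [hsum]
    refine ⟨key.1, key.2.trans ?_⟩
    rw [Finset.sum_range_sub (fun i => (c i : ℝ))]
    refine mul_le_mul_of_nonneg_left ?_ (sq_nonneg _)
    have h1 : (c N : ℝ) ≤ t := by
      exact_mod_cast max_le hst (min_le_right _ _)
    have h2 : (s : ℝ) ≤ c 0 := by exact_mod_cast le_max_left _ _
    linarith
  · intro i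
    simp only [H']
    split_ifs with hi
    · exact (hH _).mono (𝓕.mono hi) le_rfl
    · exact measurable_const
  · intro i ω
    simp only [H']
    split_ifs with hi
    · exact hK _ _
    · simpa using (abs_nonneg _).trans (hK 0 ω)
  · intro i
    exact (hW.adapted _).sub ((hW.adapted _).mono (𝓕.mono (hcmono (Nat.le_succ i))) le_rfl)
  · intro i
    exact hW.indep _ _ (hcmono (Nat.le_succ i))

lemma lintegral_enorm_sq_le {P : Measure Ω} {f : Ω → ℝ} (hf : MemLp f 2 P) {c : ℝ≥0}
    (h : ∫ ω, f ω ^ 2 ∂P ≤ c) : ∫⁻ ω, ‖f ω‖ₑ ^ 2 ∂P ≤ c := by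
  have e : ∀ ω, ‖f ω‖ₑ ^ 2 = ENNReal.ofReal (f ω ^ 2) := fun ω => by
    rw [← ofReal_norm, ← ENNReal.ofReal_pow (norm_nonneg _), Real.norm_eq_abs, sq_abs]
  simp only [e]
  rw [← ofReal_integral_eq_lintegral_ofReal hf.integrable_sq (ae_of_all _ fun _ => sq_nonneg _)]
  exact ENNReal.ofReal_le_of_le_toReal (by simpa using h)

/-- An Itô integral inherits the second moment bounds of the left-endpoint sums, after clipping the
integrand at a level which it exceeds with small probability only. -/
lemma IsItoIntegral.locallyMeanSqLipschitz {𝓕 : Filtration ℝ≥0 mΩ} {P : Measure Ω}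
    [IsProbabilityMeasure P] {W : ℝ≥0 → Ω → ℝ} (hW : IsBrownianWrt 𝓕 P W) {H Y : ℝ≥0 → Ω → ℝ}
    (hH : IsAdaptedCadlag 𝓕 P H) (hY : IsItoIntegral P H W Y) :
    LocallyMeanSqLipschitz P Y := by
  intro ζ hζ
  have hmeas : ∀ t, Measurable (H t) := fun t => (hH.1 t).mono (𝓕.le t) le_rfl
  obtain ⟨K, hK⟩ := exists_measure_not_le_le (measurable_gridSup hmeas) (P := P)
    (by filter_upwards [hH.2] with ω hω
        obtain ⟨L, hL⟩ := hω.exists_bound 1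
        exact gridSup_lt_top hL) hζ
  refine ⟨_, hK, K ^ 2, fun s t hst ht => ?_⟩
  -- the clipped integrand has the same left-endpoint sums on the event where `|H| ≤ K`
  let H' : ℝ≥0 → Ω → ℝ := fun t ω => max (-K) (min (H t ω) K)
  have hH' : Adapted 𝓕 H' := fun t =>
    measurable_const.max ((hH.1 t).min measurable_const)
  have hH'K : ∀ t ω, |H' t ω| ≤ K := fun t ω => by
    have : (0 : ℝ) ≤ K := K.2
    exact abs_le.2 ⟨le_max_left _ _, max_le (by linarith) (min_le_right _ _)⟩
  have hEq : ∀ N ω r, r ≤ 1 → gridSup H ω ≤ K → itoSum H W N r ω = itoSum H' W N r ω := by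
    intro N ω r hr hω
    refine Finset.sum_congr rfl fun i hi => ?_
    have hi' : i ≤ N := by
      have h1 := Finset.mem_range.1 hi
      have : ⌈r⌉₊ ≤ 1 := by rw [Nat.ceil_le]; simpa using hr
      nlinarith
    have h2 := (le_gridSup H ω hi').trans hω
    have h3 : |H ((i : ℝ≥0) / N) ω| ≤ K := by
      rw [← ofReal_norm] at h2
      have := ENNReal.toReal_mono ENNReal.coe_ne_top h2
      simpa [ENNReal.toReal_ofReal] using this
    have h4 : H' ((i : ℝ≥0) / N) ω = H ((i : ℝ≥0) / N) ω := by
      simp only [H']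
      rw [min_eq_left (abs_le.1 h3).2, max_eq_right (abs_le.1 h3).1]
    rw [h4]
  have key : ∀ m : ℕ, _ := fun m => hW.memLp_and_integral_sq_itoSum_sub_le hH' hH'K
    (N := m + 1) (Nat.succ_pos m) hst ht
  refine exists_dominating_of_tendstoInMeasure
    (Y := fun m ω => itoSum H W (m + 1) t ω - itoSum H W (m + 1) s ω)
    (Z := fun m ω => itoSum H' W (m + 1) t ω - itoSum H' W (m + 1) s ω)
    ?_ (fun m => (key m).1.1.aemeasurable) ?_ ?_
  · exact tendstoInMeasure_sub (fun ε hε => (hY.2 t ε hε).comp (tendsto_add_atTop_nat 1))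
      (fun ε hε => (hY.2 s ε hε).comp (tendsto_add_atTop_nat 1))
  · refine fun m => ae_of_all _ fun ω hω => ?_
    rw [hEq _ _ _ ht hω, hEq _ _ _ (hst.trans ht) hω]
  · intro m
    have := lintegral_enorm_sq_le (c := K ^ 2 * (t - s)) (key m).1 (by
      rw [NNReal.coe_mul, NNReal.coe_sub hst]; exact (key m).2)
    simpa using this

/-! ### Drift terms -/

/-- Only the times in `(0, 1)` matter: a locally bounded integrand is controlled at positive times, and a
càdlàg one before time one, by right limits along the grids of `[0, 1]`. -/
lemma timeIntegral_sub_le {Ω : Type*} {a : ℝ≥0 → Ω → ℝ} {ω : Ω} {K : ℝ≥0}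
    (hmeas : AEStronglyMeasurable (fun s : ℝ => a s.toNNReal ω) (volume.restrict (Set.Ioc 0 1)))
    (hK : ∀ s : ℝ≥0, 0 < s → s < 1 → ‖a s ω‖ₑ ≤ K) {s t : ℝ≥0} (hst : s ≤ t) (ht : t ≤ 1) :
    ‖timeIntegral a t ω - timeIntegral a s ω‖ₑ ≤ K * (t - s : ℝ≥0) := by
  have hb : ∀ x : ℝ, x ∈ Set.Ioo (0 : ℝ) 1 → ‖a x.toNNReal ω‖ ≤ K := fun x hx => by
    have := hK x.toNNReal (by simpa using hx.1) (by
      rw [← NNReal.coe_lt_coe, Real.coe_toNNReal _ hx.1.le]; simpa using hx.2)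
    rw [← ofReal_norm] at this
    simpa [ENNReal.toReal_ofReal] using ENNReal.toReal_mono ENNReal.coe_ne_top this
  have hae : ∀ᵐ x : ℝ ∂(volume.restrict (Set.Ioc (0 : ℝ) 1)), ‖a x.toNNReal ω‖ ≤ K := by
    rw [← Measure.restrict_congr_set (Ioo_ae_eq_Ioc (μ := volume) (a := (0 : ℝ)) (b := 1))]
    exact (ae_restrict_iff' measurableSet_Ioo).2 (ae_of_all _ hb)
  have hint : IntegrableOn (fun s : ℝ => a s.toNNReal ω) (Set.Ioc 0 1) :=
    ⟨hmeas, HasFiniteIntegral.of_bounded hae⟩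
  have hsub : ∀ r : ℝ≥0, r ≤ 1 →
      IntervalIntegrable (fun s : ℝ => a s.toNNReal ω) volume 0 r := fun r hr => by
    rw [intervalIntegrable_iff_integrableOn_Ioc_of_le r.coe_nonneg]
    exact hint.mono_set (Set.Ioc_subset_Ioc_right (by exact_mod_cast hr))
  unfold timeIntegral
  rw [intervalIntegral.integral_interval_sub_left (hsub t ht) (hsub s (hst.trans ht))]
  have hle : ‖∫ x in (s : ℝ)..t, a x.toNNReal ω‖ ≤ K * (t - s : ℝ≥0) := by
    rw [intervalIntegral.integral_of_le (by exact_mod_cast hst)]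
    have h1 := norm_setIntegral_le_of_norm_le_const_ae' (μ := volume) (s := Set.Ioc (s : ℝ) t)
      (f := fun x : ℝ => a x.toNNReal ω) (C := K) (by simp) (by
        have := (ae_restrict_iff' measurableSet_Ioc).1 hae
        filter_upwards [this] with x hx hx'
        exact hx ⟨lt_of_le_of_lt s.2 hx'.1, hx'.2.trans (by exact_mod_cast ht)⟩)
    refine h1.trans (le_of_eq ?_)
    rw [Real.volume_real_Ioc_of_le (by exact_mod_cast hst), NNReal.coe_sub hst]
  rw [← ofReal_norm]
  refine ENNReal.ofReal_le_of_le_toReal ?_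
  rwa [ENNReal.toReal_mul, ENNReal.coe_toReal, ENNReal.coe_toReal]

/-- The next point after `s` of the grid with mesh `1 / (N + 1)` converges to `s` from the right. -/
lemma tendsto_next_grid (s : ℝ≥0) :
    Tendsto (fun N : ℕ => (((⌊s * (N + 1 : ℝ≥0)⌋₊ : ℕ) : ℝ≥0) + 1) / (N + 1)) atTop
      (𝓝[≥] s) := by
  refine tendsto_nhdsWithin_iff.2 ⟨?_, ?_⟩
  · have h1 : Tendsto (fun N : ℕ => s + 1 / ((N : ℝ≥0) + 1)) atTop (𝓝 s) := by
      have : Tendsto (fun N : ℕ => 1 / ((N : ℝ≥0) + 1)) atTop (𝓝 0) :=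
        tendsto_one_div_add_atTop_nhds_zero_nat
      simpa using tendsto_const_nhds.add this
    refine tendsto_of_tendsto_of_tendsto_of_le_of_le tendsto_const_nhds h1 (fun N => ?_)
      (fun N => ?_)
    · change s ≤ _
      rw [le_div_iff₀ (by positivity)]
      exact (Nat.lt_floor_add_one _).le
    · change _ ≤ s + 1 / ((N : ℝ≥0) + 1)
      rw [add_div]
      gcongr
      rw [div_le_iff₀ (by positivity)]
      exact Nat.floor_le zero_le
  · refine Eventually.of_forall fun N => ?_
    change s ≤ _
    rw [le_div_iff₀ (by positivity)]
    exact (Nat.lt_floor_add_one _).le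

/-- A càdlàg function is the limit of its values at the next point of a grid, hence measurable. -/
lemma IsCadlag.measurable_comp_toNNReal {f : ℝ≥0 → ℝ} (hf : IsCadlag f) :
    Measurable fun s : ℝ => f s.toNNReal := by
  refine measurable_of_tendsto_metrizable (f := fun (N : ℕ) (s : ℝ) =>
    f ((((⌊s.toNNReal * (N + 1 : ℝ≥0)⌋₊ : ℕ) : ℝ≥0) + 1) / (N + 1))) (fun N => ?_) ?_
  · exact (measurable_from_nat (f := fun k : ℕ => f (((k : ℝ≥0) + 1) / (N + 1)))).comp
      (Nat.measurable_floor.comp (by fun_prop))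
  · rw [tendsto_pi_nhds]
    intro s
    exact (hf s.toNNReal).1.tendsto.comp (tendsto_next_grid _)

/-- By right-continuity, a bound at the rational times of `[0, 1]` is a bound on `[0, 1)`. -/
lemma IsCadlag.enorm_le_of_forall_grid {f : ℝ≥0 → ℝ} (hf : IsCadlag f) {K : ℝ≥0}
    (hK : ∀ i n : ℕ, i ≤ n → ‖f ((i : ℝ≥0) / n)‖ₑ ≤ K) {s : ℝ≥0} (hs : s < 1) :
    ‖f s‖ₑ ≤ K := by
  refine le_of_tendsto ((hf s).1.tendsto.comp (tendsto_next_grid s)).enorm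
    (Eventually.of_forall fun N => ?_)
  have h2 : ⌊s * (N + 1 : ℝ≥0)⌋₊ + 1 ≤ N + 1 := by
    have : ⌊s * (N + 1 : ℝ≥0)⌋₊ < N + 1 := by
      rw [Nat.floor_lt zero_le]
      push_cast
      exact mul_lt_of_lt_one_left (by positivity) hs
    omega
  have := hK _ _ h2
  push_cast at this
  exact this

lemma IsAdaptedCadlag.exists_gridSup_le {𝓕 : Filtration ℝ≥0 mΩ} {P : Measure Ω}
    [IsProbabilityMeasure P] {a : ℝ≥0 → Ω → ℝ} (ha : IsAdaptedCadlag 𝓕 P a) {ζ : ℝ≥0∞}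
    (hζ : 0 < ζ) : ∃ K : ℝ≥0, P {ω | gridSup a ω ≤ K}ᶜ ≤ ζ := by
  refine exists_measure_not_le_le
    (measurable_gridSup fun t => (ha.1 t).mono (𝓕.le t) le_rfl) ?_ hζ
  filter_upwards [ha.2] with ω hω
  obtain ⟨L, hL⟩ := hω.exists_bound 1
  exact gridSup_lt_top hL

lemma IsAdaptedCadlag.exists_timeIntegral_lipschitz {𝓕 : Filtration ℝ≥0 mΩ} {P : Measure Ω}
    [IsProbabilityMeasure P] {a : ℝ≥0 → Ω → ℝ} (ha : IsAdaptedCadlag 𝓕 P a) {ζ : ℝ≥0∞}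
    (hζ : 0 < ζ) : ∃ G : Set Ω, P Gᶜ ≤ ζ ∧ ∃ K : ℝ≥0, ∀ᵐ ω ∂P, ω ∈ G →
      ∀ s t, s ≤ t → t ≤ 1 →
        ‖timeIntegral a t ω - timeIntegral a s ω‖ₑ ≤ K * (t - s : ℝ≥0) := by
  obtain ⟨K, hK⟩ := ha.exists_gridSup_le hζ
  refine ⟨_, hK, K, ?_⟩
  filter_upwards [ha.2] with ω hω hG s t hst ht
  exact timeIntegral_sub_le hω.measurable_comp_toNNReal.aestronglyMeasurable
    (fun s _ hs => hω.enorm_le_of_forall_grid (f := (a · ω))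
      (fun i n hin => (le_gridSup a ω hin).trans hG) hs) hst ht

/-- A localising sequence exceeds time one with probability close to one. -/
lemma exists_measure_localizing_lt_one_le {𝓕 : Filtration ℝ≥0 mΩ} {P : Measure Ω}
    [IsProbabilityMeasure P] {τ : ℕ → Ω → WithTop ℝ≥0} (hτ : IsLocalizingSequence 𝓕 τ P)
    {ζ : ℝ≥0∞} (hζ : 0 < ζ) :
    ∃ k, P {ω | ((1 : ℝ≥0) : WithTop ℝ≥0) < τ k ω}ᶜ ≤ ζ := by
  let A : ℕ → Set Ω := fun k => {ω | τ k ω ≤ ((1 : ℝ≥0) : WithTop ℝ≥0)}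
  have hA : ∀ k, MeasurableSet (A k) := fun k => 𝓕.le _ _ (hτ.isStoppingTime k 1)
  have h1 : Tendsto (fun k => P (⋃ j ≥ k, A j)) atTop (𝓝 (P (⋂ k, ⋃ j ≥ k, A j))) := by
    refine tendsto_measure_iInter_atTop (fun n =>
      (MeasurableSet.biUnion (Set.to_countable _) fun j _ => hA j).nullMeasurableSet) ?_
      ⟨0, measure_ne_top _ _⟩
    intro m n hmn
    exact Set.biUnion_subset_biUnion_left fun j hj => le_trans hmn hj
  have h2 : P (⋂ k, ⋃ j ≥ k, A j) = 0 := by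
    refine measure_mono_null ?_ (ae_iff.1 hτ.tendsto_top)
    intro ω hω hlim
    have : ∀ᶠ k in atTop, ((1 : ℝ≥0) : WithTop ℝ≥0) < τ k ω :=
      hlim.eventually (lt_mem_nhds (WithTop.coe_lt_top _))
    obtain ⟨k, hk⟩ := eventually_atTop.1 this
    obtain ⟨j, hj, hj'⟩ := Set.mem_iUnion₂.1 (Set.mem_iInter.1 hω k)
    exact absurd (hk j hj) (not_lt.2 hj')
  rw [h2] at h1
  obtain ⟨k, hk⟩ := ((h1.eventually (gt_mem_nhds hζ))).exists
  refine ⟨k, (measure_mono fun ω hω => ?_).trans hk.le⟩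
  have h3 : τ k ω ≤ ((1 : ℝ≥0) : WithTop ℝ≥0) := not_lt.1 fun h => hω h
  exact Set.mem_iUnion₂.2 ⟨k, le_refl k, h3⟩

/-- The paths of a predictable process are Borel functions of time. -/
lemma measurable_section_of_predictable {𝓕 : Filtration ℝ≥0 mΩ} (ω : Ω) :
    Measurable[_, 𝓕.predictable] fun s : ℝ≥0 => (s, ω) := by
  refine measurable_generateFrom ?_
  rintro _ (⟨A, -, rfl⟩ | ⟨i, A, -, rfl⟩)
  · by_cases h : ω ∈ A
    · have : (fun s : ℝ≥0 => (s, ω)) ⁻¹' ({⊥} ×ˢ A) = {⊥} := by ext; simp [h]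
      rw [this]; exact measurableSet_singleton _
    · have : (fun s : ℝ≥0 => (s, ω)) ⁻¹' ({⊥} ×ˢ A) = ∅ := by ext; simp [h]
      rw [this]; exact MeasurableSet.empty
  · by_cases h : ω ∈ A
    · have : (fun s : ℝ≥0 => (s, ω)) ⁻¹' (Set.Ioi i ×ˢ A) = Set.Ioi i := by ext; simp [h]
      rw [this]; exact measurableSet_Ioi
    · have : (fun s : ℝ≥0 => (s, ω)) ⁻¹' (Set.Ioi i ×ˢ A) = ∅ := by ext; simp [h]
      rw [this]; exact MeasurableSet.empty

lemma IsLocallyBounded.exists_timeIntegral_lipschitz {𝓕 : Filtration ℝ≥0 mΩ} {P : Measure Ω}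
    [IsProbabilityMeasure P] {a : ℝ≥0 → Ω → ℝ} (hpred : IsStronglyPredictable 𝓕 a)
    (ha : IsLocallyBounded 𝓕 P a) {ζ : ℝ≥0∞}
    (hζ : 0 < ζ) : ∃ G : Set Ω, P Gᶜ ≤ ζ ∧ ∃ K : ℝ≥0, ∀ᵐ ω ∂P, ω ∈ G →
      ∀ s t, s ≤ t → t ≤ 1 →
        ‖timeIntegral a t ω - timeIntegral a s ω‖ₑ ≤ K * (t - s : ℝ≥0) := by
  obtain ⟨τ, C, hτ, hC⟩ := ha
  obtain ⟨k, hk⟩ := exists_measure_localizing_lt_one_le hτ hζ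
  refine ⟨_, hk, (C k).toNNReal, ae_of_all _ fun ω hω s t hst ht => ?_⟩
  refine timeIntegral_sub_le (Measurable.aestronglyMeasurable ?_) (fun s hs hs1 => ?_) hst ht
  · exact (hpred.measurable.comp (measurable_section_of_predictable ω)).comp
      measurable_real_toNNReal
  · have h1 := hC k ω s hs (le_trans (by exact_mod_cast hs1.le) (le_of_lt hω))
    rw [← ofReal_norm]
    exact ENNReal.ofReal_le_ofReal h1

/-! ### Moments of a Poisson random measure -/

lemma hasSum_poisson_id (r : ℝ≥0) :
    HasSum (fun n : ℕ => Real.exp (-r) * r ^ n / n.factorial * n) r := by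
  rw [← hasSum_nat_add_iff' 1]
  simp only [Finset.range_one, Finset.sum_singleton, Nat.cast_zero, mul_zero, sub_zero]
  have h := (hasSum_one_poissonMeasure r).mul_left (r : ℝ)
  rw [mul_one] at h
  refine h.congr_fun fun n => ?_
  rw [Nat.factorial_succ]
  push_cast
  field_simp
  ring

lemma hasSum_poisson_sq (r : ℝ≥0) :
    HasSum (fun n : ℕ => Real.exp (-r) * r ^ n / n.factorial * (n : ℝ) ^ 2) (r + r ^ 2) := by
  rw [← hasSum_nat_add_iff' 1]
  simp only [Finset.range_one, Finset.sum_singleton, Nat.cast_zero, ne_eq, OfNat.ofNat_ne_zero,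
    not_false_eq_true, zero_pow, mul_zero, sub_zero]
  have h := ((hasSum_one_poissonMeasure r).mul_left (r : ℝ)).add
    ((hasSum_poisson_id r).mul_left (r : ℝ))
  rw [mul_one, ← sq] at h
  refine h.congr_fun fun n => ?_
  rw [Nat.factorial_succ]
  push_cast
  field_simp
  ring

lemma measurableEmbedding_coe : MeasurableEmbedding ((↑) : ℝ≥0 → ℝ) :=
  MeasurableEmbedding.subtype_coe measurableSet_Ici

instance : SigmaFinite timeMeasure := by
  refine ⟨⟨⟨fun n => Set.Iic n, fun _ => trivial, fun n => ?_, ?_⟩⟩⟩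
  · rw [timeMeasure, measurableEmbedding_coe.comap_apply]
    refine lt_of_le_of_lt (measure_mono (t := Set.Icc (0 : ℝ) n) ?_) (by simp)
    rintro _ ⟨x, hx, rfl⟩
    exact ⟨x.2, by exact_mod_cast (show x ≤ (n : ℝ≥0) from hx)⟩
  · refine Set.eq_univ_of_forall fun x => Set.mem_iUnion.2 ?_
    obtain ⟨n, hn⟩ := exists_nat_ge x
    exact ⟨n, hn⟩

lemma timeMeasure_Ioc (s t : ℝ≥0) : timeMeasure (Set.Ioc s t) = (t - s : ℝ≥0) := by
  rw [timeMeasure, measurableEmbedding_coe.comap_apply]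
  have : ((↑) : ℝ≥0 → ℝ) '' (Set.Ioc s t) = Set.Ioc (s : ℝ) t := by
    ext x
    constructor
    · rintro ⟨y, hy, rfl⟩
      exact ⟨by exact_mod_cast hy.1, by exact_mod_cast hy.2⟩
    · intro hx
      exact ⟨⟨x, s.2.trans hx.1.le⟩, ⟨by exact_mod_cast hx.1, by exact_mod_cast hx.2⟩, rfl⟩
  rw [this, Real.volume_Ioc, ENNReal.ofReal]
  congr 1

namespace IsPoissonRandomMeasure

variable {𝓕 : Filtration ℝ≥0 mΩ} {P : Measure Ω} {F : Measure ℝ}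
  {N : Ω → Measure (ℝ≥0 × ℝ)} {A : Set (ℝ≥0 × ℝ)}

lemma measurable_apply (hN : IsPoissonRandomMeasure 𝓕 P F N) (hA : MeasurableSet A) :
    Measurable fun ω => N ω A :=
  (Measure.measurable_coe hA).comp hN.measurable

lemma ae_exists_nat (hN : IsPoissonRandomMeasure 𝓕 P F N) (hA : MeasurableSet A)
    (hfin : (timeMeasure.prod F) A < ∞) : ∀ᵐ ω ∂P, ∃ k : ℕ, N ω A = k := by
  have hset : MeasurableSet {x : ℝ≥0∞ | ∃ k : ℕ, x = k} := by
    have : {x : ℝ≥0∞ | ∃ k : ℕ, x = k} = Set.range fun k : ℕ => (k : ℝ≥0∞) := by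
      ext x; simp [eq_comm]
    rw [this]
    exact (Set.countable_range _).measurableSet
  have h1 : ∀ᵐ x ∂(P.map fun ω => N ω A), ∃ k : ℕ, x = (k : ℝ≥0∞) := by
    rw [hN.law A hA hfin, ae_map_iff (μ := poissonMeasure _) measurable_from_nat.aemeasurable hset]
    exact Eventually.of_forall fun k => ⟨k, rfl⟩
  exact (ae_map_iff (hN.measurable_apply hA).aemeasurable hset).1 h1

/-- Transfer of integrals of a function of the number of points in `A` to the Poisson law. -/
lemma integral_comp_toReal (hN : IsPoissonRandomMeasure 𝓕 P F N) (hA : MeasurableSet A)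
    (hfin : (timeMeasure.prod F) A < ∞) {g : ℝ → ℝ} (hg : Measurable g) :
    (Integrable (fun ω => g (N ω A).toReal) P ↔
      Integrable (fun k : ℕ => g k) (poissonMeasure ((timeMeasure.prod F) A).toNNReal)) ∧
    ∫ ω, g (N ω A).toReal ∂P =
      ∫ k : ℕ, g k ∂poissonMeasure ((timeMeasure.prod F) A).toNNReal := by
  have hg' : Measurable fun x : ℝ≥0∞ => g x.toReal := hg.comp ENNReal.measurable_toReal
  constructor
  · have h1 := integrable_map_measure (μ := P) (f := fun ω => N ω A) (g := fun x => g x.toReal)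
      hg'.aestronglyMeasurable (hN.measurable_apply hA).aemeasurable
    rw [hN.law A hA hfin, integrable_map_measure hg'.aestronglyMeasurable (by fun_prop)] at h1
    simpa [Function.comp_def] using h1.symm
  · have h1 := integral_map (μ := P) (φ := fun ω => N ω A) (f := fun x => g x.toReal)
      (hN.measurable_apply hA).aemeasurable hg'.aestronglyMeasurable
    rw [hN.law A hA hfin, integral_map (by fun_prop) hg'.aestronglyMeasurable] at h1
    simpa using h1.symm

lemma memLp_toReal (hN : IsPoissonRandomMeasure 𝓕 P F N) (hA : MeasurableSet A)
    (hfin : (timeMeasure.prod F) A < ∞) : MemLp (fun ω => (N ω A).toReal) 2 P := by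
  rw [memLp_two_iff_integrable_sq (hN.measurable_apply hA).ennreal_toReal.aestronglyMeasurable,
    (hN.integral_comp_toReal hA hfin (g := fun x => x ^ 2) (by fun_prop)).1,
    integrable_poissonMeasure_iff]
  simpa using (hasSum_poisson_sq _).summable

lemma integral_toReal [IsProbabilityMeasure P] (hN : IsPoissonRandomMeasure 𝓕 P F N)
    (hA : MeasurableSet A)
    (hfin : (timeMeasure.prod F) A < ∞) :
    ∫ ω, (N ω A).toReal ∂P = ((timeMeasure.prod F) A).toReal := by
  have h1 := hN.integral_comp_toReal hA hfin (g := fun x => x) (by fun_prop)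
  have h2 := h1.1.1 ((hN.memLp_toReal hA hfin).integrable (by norm_num))
  have h3 := hasSum_integral_poissonMeasure h2
  rw [h1.2]
  exact h3.unique (hasSum_poisson_id _)

lemma integral_toReal_sq (hN : IsPoissonRandomMeasure 𝓕 P F N) (hA : MeasurableSet A)
    (hfin : (timeMeasure.prod F) A < ∞) :
    ∫ ω, (N ω A).toReal ^ 2 ∂P =
      ((timeMeasure.prod F) A).toReal + ((timeMeasure.prod F) A).toReal ^ 2 := by
  have h1 := hN.integral_comp_toReal hA hfin (g := fun x => x ^ 2) (by fun_prop)
  have h2 := h1.1.1 (hN.memLp_toReal hA hfin).integrable_sq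
  have h3 := hasSum_integral_poissonMeasure h2
  rw [h1.2]
  exact h3.unique (hasSum_poisson_sq _)

lemma ae_lt_top (hN : IsPoissonRandomMeasure 𝓕 P F N) (hA : MeasurableSet A)
    (hfin : (timeMeasure.prod F) A < ∞) : ∀ᵐ ω ∂P, N ω A < ∞ := by
  filter_upwards [hN.ae_exists_nat hA hfin] with ω ⟨k, hk⟩
  rw [hk]; exact ENNReal.natCast_lt_top k

end IsPoissonRandomMeasure

/-- The compensated mass `N A - ν A` of a set of finite intensity. -/
noncomputable def compensated (F : Measure ℝ) (N : Ω → Measure (ℝ≥0 × ℝ)) (A : Set (ℝ≥0 × ℝ)) (ω : Ω) : ℝ :=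
  (N ω A).toReal - ((timeMeasure.prod F) A).toReal

namespace IsPoissonRandomMeasure

variable {𝓕 : Filtration ℝ≥0 mΩ} {P : Measure Ω} [IsProbabilityMeasure P] {F : Measure ℝ}
  {N : Ω → Measure (ℝ≥0 × ℝ)} {A B : Set (ℝ≥0 × ℝ)}

lemma memLp_compensated (hN : IsPoissonRandomMeasure 𝓕 P F N) (hA : MeasurableSet A)
    (hfin : (timeMeasure.prod F) A < ∞) : MemLp (compensated F N A) 2 P :=
  (hN.memLp_toReal hA hfin).sub (memLp_const _)

lemma integral_compensated (hN : IsPoissonRandomMeasure 𝓕 P F N) (hA : MeasurableSet A)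
    (hfin : (timeMeasure.prod F) A < ∞) : ∫ ω, compensated F N A ω ∂P = 0 := by
  unfold compensated
  rw [integral_sub ((hN.memLp_toReal hA hfin).integrable (by norm_num)) (integrable_const _),
    hN.integral_toReal hA hfin]
  simp

lemma integral_compensated_sq (hN : IsPoissonRandomMeasure 𝓕 P F N) (hA : MeasurableSet A)
    (hfin : (timeMeasure.prod F) A < ∞) :
    ∫ ω, compensated F N A ω * compensated F N A ω ∂P = ((timeMeasure.prod F) A).toReal := by
  have hi := (hN.memLp_toReal hA hfin)
  set c := ((timeMeasure.prod F) A).toReal with hc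
  have h1 : Integrable (fun ω => (N ω A).toReal ^ 2) P := hi.integrable_sq
  have h2 : Integrable (fun ω => (2 * c) * (N ω A).toReal) P :=
    (hi.integrable (by norm_num)).const_mul _
  calc ∫ ω, compensated F N A ω * compensated F N A ω ∂P
      = ∫ ω, ((N ω A).toReal ^ 2 - (2 * c) * (N ω A).toReal) + c ^ 2 ∂P := by
        refine integral_congr_ae (ae_of_all _ fun ω => ?_)
        simp only [compensated, ← hc]; ring
    _ = c := by
        rw [integral_add (by exact h1.sub h2) (integrable_const _), integral_sub h1 h2,
          integral_const_mul, hN.integral_toReal_sq hA hfin, hN.integral_toReal hA hfin, ← hc]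
        simp; ring

lemma integral_compensated_mul_of_disjoint (hN : IsPoissonRandomMeasure 𝓕 P F N)
    (hA : MeasurableSet A) (hB : MeasurableSet B)
    (hAfin : (timeMeasure.prod F) A < ∞) (hBfin : (timeMeasure.prod F) B < ∞)
    (hAB : Disjoint A B) :
    ∫ ω, compensated F N A ω * compensated F N B ω ∂P = 0 := by
  have h := hN.indep_disjoint 2 ![A, B] (by intro i; fin_cases i <;> assumption) (by
    intro i j hij
    fin_cases i <;> fin_cases j <;> simp_all [disjoint_comm])
  have h1 : IndepFun (fun ω => N ω A) (fun ω => N ω B) P :=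
    h.indepFun (i := 0) (j := 1) (by decide)
  have h2 : IndepFun (compensated F N A) (compensated F N B) P :=
    h1.comp (φ := fun x : ℝ≥0∞ => x.toReal - ((timeMeasure.prod F) A).toReal)
      (ψ := fun x : ℝ≥0∞ => x.toReal - ((timeMeasure.prod F) B).toReal) (ENNReal.measurable_toReal.sub_const _)
      (ENNReal.measurable_toReal.sub_const _)
  rw [h2.integral_fun_mul_eq_mul_integral (hN.memLp_compensated hA hAfin).1
    (hN.memLp_compensated hB hBfin).1, hN.integral_compensated hA hAfin, zero_mul]

lemma compensated_union_ae {P : Measure Ω} (hN : IsPoissonRandomMeasure 𝓕 P F N)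
    (hA : MeasurableSet A) (hB : MeasurableSet B)
    (hAfin : (timeMeasure.prod F) A < ∞) (hBfin : (timeMeasure.prod F) B < ∞)
    (hAB : Disjoint A B) :
    ∀ᵐ ω ∂P, compensated F N (A ∪ B) ω = compensated F N A ω + compensated F N B ω := by
  filter_upwards [hN.ae_lt_top hA hAfin, hN.ae_lt_top hB hBfin] with ω h1 h2
  simp only [compensated]
  rw [measure_union hAB hB, measure_union hAB hB, ENNReal.toReal_add h1.ne h2.ne,
    ENNReal.toReal_add hAfin.ne hBfin.ne]
  ring

/-- The compensated masses form an orthogonal random measure with control measure `ds F(dx)`. Both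
sets are split along their intersection, and masses of disjoint sets are independent. -/
lemma integral_compensated_mul (hN : IsPoissonRandomMeasure 𝓕 P F N)
    (hA : MeasurableSet A) (hB : MeasurableSet B)
    (hAfin : (timeMeasure.prod F) A < ∞) (hBfin : (timeMeasure.prod F) B < ∞) :
    ∫ ω, compensated F N A ω * compensated F N B ω ∂P
      = ((timeMeasure.prod F) (A ∩ B)).toReal := by
  have mAB := hA.inter hB
  have mA := hA.diff hB
  have mB := hB.diff hA
  have fAB : (timeMeasure.prod F) (A ∩ B) < ∞ :=
    (measure_mono Set.inter_subset_left).trans_lt hAfin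
  have fA : (timeMeasure.prod F) (A \ B) < ∞ := (measure_mono Set.sdiff_subset).trans_lt hAfin
  have fB : (timeMeasure.prod F) (B \ A) < ∞ := (measure_mono Set.sdiff_subset).trans_lt hBfin
  have d1 : Disjoint (A ∩ B) (A \ B) := Set.disjoint_sdiff_inter.symm
  have d2 : Disjoint (A ∩ B) (B \ A) := by
    rw [Set.inter_comm]; exact Set.disjoint_sdiff_inter.symm
  have d3 : Disjoint (A \ B) (B \ A) := disjoint_sdiff_sdiff
  have eA := hN.compensated_union_ae mAB mA fAB fA d1
  have eB := hN.compensated_union_ae mAB mB fAB fB d2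
  rw [Set.inter_union_sdiff] at eA
  rw [Set.inter_comm, Set.inter_union_sdiff, Set.inter_comm] at eB
  have lAB := hN.memLp_compensated mAB fAB
  have lA := hN.memLp_compensated mA fA
  have lB := hN.memLp_compensated mB fB
  have i1 := lAB.integrable_mul lAB
  have i2 := lAB.integrable_mul lB
  have i3 := lA.integrable_mul lAB
  have i4 := lA.integrable_mul lB
  calc ∫ ω, compensated F N A ω * compensated F N B ω ∂P
      = ∫ ω, ((compensated F N (A ∩ B) * compensated F N (A ∩ B)
          + compensated F N (A ∩ B) * compensated F N (B \ A))
        + (compensated F N (A \ B) * compensated F N (A ∩ B)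
          + compensated F N (A \ B) * compensated F N (B \ A))) ω ∂P := by
        refine integral_congr_ae ?_
        filter_upwards [eA, eB] with ω h1 h2
        rw [h1, h2]
        simp only [Pi.add_apply, Pi.mul_apply]
        ring
    _ = _ := by
        rw [integral_add' (i1.add i2) (i3.add i4), integral_add' i1 i2, integral_add' i3 i4]
        simp only [Pi.mul_apply]
        rw [hN.integral_compensated_sq mAB fAB,
          hN.integral_compensated_mul_of_disjoint mAB mB fAB fB d2,
          hN.integral_compensated_mul_of_disjoint mA mAB fA fAB d1.symm,
          hN.integral_compensated_mul_of_disjoint mA mB fA fB d3]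
        ring

end IsPoissonRandomMeasure

/-! ### Isometry for differences of random measures -/

section Isometry

variable {E : Type*} [mE : MeasurableSpace E] {P : Measure Ω}

/-- The measure `P.bind (κ ×ₖ η)` on `E × E` represents the expectation of the product of two random
measures. -/
lemma bind_prod_rect (κ η : Kernel Ω E) [IsSFiniteKernel κ] [IsSFiniteKernel η] {A B : Set E}
    (hA : MeasurableSet A) (hB : MeasurableSet B) :
    P.bind (κ ×ₖ η) (A ×ˢ B) = ∫⁻ ω, κ ω A * η ω B ∂P := by
  rw [Measure.bind_apply (hA.prod hB) (Kernel.aemeasurable _)]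
  simp_rw [Kernel.prod_apply, Measure.prod_prod]

lemma lintegral_kernel_mul_lt_top {κ η : Kernel Ω E}
    (hκ : MemLp (fun ω => (κ ω Set.univ).toReal) 2 P) (hη : MemLp (fun ω => (η ω Set.univ).toReal) 2 P)
    (hκf : ∀ ω, κ ω Set.univ < ∞) (hηf : ∀ ω, η ω Set.univ < ∞) (A B : Set E) :
    ∫⁻ ω, κ ω A * η ω B ∂P < ∞ := by
  have h := (hκ.integrable_mul hη).lintegral_lt_top
  refine lt_of_le_of_lt (lintegral_mono fun ω => ?_) h
  rw [Pi.mul_apply, ENNReal.ofReal_mul ENNReal.toReal_nonneg, ENNReal.ofReal_toReal (hκf ω).ne,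
    ENNReal.ofReal_toReal (hηf ω).ne]
  exact mul_le_mul' (measure_mono (Set.subset_univ _)) (measure_mono (Set.subset_univ _))

lemma integral_kernel_mul {κ η : Kernel Ω E}
    (hκ : MemLp (fun ω => (κ ω Set.univ).toReal) 2 P) (hη : MemLp (fun ω => (η ω Set.univ).toReal) 2 P)
    (hκf : ∀ ω, κ ω Set.univ < ∞) (hηf : ∀ ω, η ω Set.univ < ∞) {A B : Set E}
    (hA : MeasurableSet A) (hB : MeasurableSet B) :
    Integrable (fun ω => (κ ω A).toReal * (η ω B).toReal) P ∧
    ∫ ω, (κ ω A).toReal * (η ω B).toReal ∂P = (∫⁻ ω, κ ω A * η ω B ∂P).toReal := by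
  have hm : Measurable fun ω => κ ω A * η ω B :=
    (Kernel.measurable_coe κ hA).mul (Kernel.measurable_coe η hB)
  have hlt := lintegral_kernel_mul_lt_top hκ hη hκf hηf A B
  simp only [← ENNReal.toReal_mul]
  refine ⟨integrable_toReal_of_lintegral_ne_top hm.aemeasurable hlt.ne, ?_⟩
  rw [integral_toReal hm.aemeasurable (ae_lt_top hm hlt.ne)]

lemma integral_bind_prod_mul (κ η : Kernel Ω E) [IsSFiniteKernel κ] [IsSFiniteKernel η]
    [IsFiniteMeasure (P.bind (κ ×ₖ η))] {H : E → ℝ} (hH : Measurable H) {c : ℝ}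
    (hc : ∀ z, |H z| ≤ c) :
    ∫ z, H z.1 * H z.2 ∂(P.bind (κ ×ₖ η)) = ∫ ω, (∫ z, H z ∂κ ω) * ∫ z, H z ∂η ω ∂P := by
  have hint : Integrable (fun z : E × E => H z.1 * H z.2) (P.bind (κ ×ₖ η)) := by
    refine Integrable.of_bound (by fun_prop) (c * c) (ae_of_all _ fun z => ?_)
    rw [norm_mul]
    exact mul_le_mul (hc _) (hc _) (norm_nonneg _) ((abs_nonneg _).trans (hc z.1))
  have h := Kernel.integral_comp (κ := Kernel.const Unit P) (η := κ ×ₖ η) (a := ())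
    (f := fun z : E × E => H z.1 * H z.2) (by rwa [Kernel.comp_apply, Kernel.const_apply])
  rw [Kernel.comp_apply, Kernel.const_apply] at h
  rw [h]
  refine integral_congr_ae (ae_of_all _ fun ω => ?_)
  simp only [Kernel.prod_apply]
  rw [integral_prod_mul]

/-- If the random signed measure `κ₁ - κ₂` has orthogonal values with control measure `m` on a
π-system, then `𝔼 (∫ H d(κ₁ - κ₂))² = ∫ H² dm` for all bounded `H`. Both sides are integrals of
`H ⊗ H` against measures on `E × E`, which are compared on rectangles. -/
theorem integral_sq_kernel_sub {κ₁ κ₂ : Kernel Ω E} [IsSFiniteKernel κ₁] [IsSFiniteKernel κ₂]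
    (hf₁ : ∀ ω, κ₁ ω Set.univ < ∞) (hf₂ : ∀ ω, κ₂ ω Set.univ < ∞)
    (hL₁ : MemLp (fun ω => (κ₁ ω Set.univ).toReal) 2 P)
    (hL₂ : MemLp (fun ω => (κ₂ ω Set.univ).toReal) 2 P)
    {m : Measure E} [IsFiniteMeasure m] {C : Set (Set E)} (hC : mE = MeasurableSpace.generateFrom C)
    (hpi : IsPiSystem C) (huniv : Set.univ ∈ C)
    (horth : ∀ A ∈ C, ∀ B ∈ C, ∫ ω, ((κ₁ ω A).toReal - (κ₂ ω A).toReal) *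
      ((κ₁ ω B).toReal - (κ₂ ω B).toReal) ∂P = (m (A ∩ B)).toReal)
    {H : E → ℝ} (hH : Measurable H) {c : ℝ} (hc : ∀ z, |H z| ≤ c) :
    MemLp (fun ω => ∫ z, H z ∂κ₁ ω - ∫ z, H z ∂κ₂ ω) 2 P ∧
    ∫ ω, (∫ z, H z ∂κ₁ ω - ∫ z, H z ∂κ₂ ω) ^ 2 ∂P = ∫ z, H z ^ 2 ∂m := by
  have hCm : ∀ A ∈ C, MeasurableSet A := fun A hA => by
    rw [hC]; exact MeasurableSpace.measurableSet_generateFrom hA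
  have hfin : ∀ (κ η : Kernel Ω E) [IsSFiniteKernel κ] [IsSFiniteKernel η],
      MemLp (fun ω => (κ ω Set.univ).toReal) 2 P → MemLp (fun ω => (η ω Set.univ).toReal) 2 P →
      (∀ ω, κ ω Set.univ < ∞) → (∀ ω, η ω Set.univ < ∞) →
      IsFiniteMeasure (P.bind (κ ×ₖ η)) := by
    intro κ η _ _ h1 h2 h3 h4
    refine ⟨?_⟩
    rw [← Set.univ_prod_univ, bind_prod_rect _ _ MeasurableSet.univ MeasurableSet.univ]
    exact lintegral_kernel_mul_lt_top h1 h2 h3 h4 _ _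
  have i11 := hfin κ₁ κ₁ hL₁ hL₁ hf₁ hf₁
  have i12 := hfin κ₁ κ₂ hL₁ hL₂ hf₁ hf₂
  have i21 := hfin κ₂ κ₁ hL₂ hL₁ hf₂ hf₁
  have i22 := hfin κ₂ κ₂ hL₂ hL₂ hf₂ hf₂
  have hdiag : Measurable fun z : E => (z, z) := by fun_prop
  -- orthogonality, written without subtraction as an identity of positive measures on `E × E`
  have hmeas : P.bind (κ₁ ×ₖ κ₁) + P.bind (κ₂ ×ₖ κ₂)
      = (P.bind (κ₁ ×ₖ κ₂) + P.bind (κ₂ ×ₖ κ₁)) + m.map fun z => (z, z) := by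
    have hrect : ∀ A ∈ C, ∀ B ∈ C, (P.bind (κ₁ ×ₖ κ₁) + P.bind (κ₂ ×ₖ κ₂)) (A ×ˢ B)
      = ((P.bind (κ₁ ×ₖ κ₂) + P.bind (κ₂ ×ₖ κ₁)) + m.map fun z => (z, z)) (A ×ˢ B) := by
      intro A hA B hB
      have mA := hCm A hA
      have mB := hCm B hB
      have h := horth A hA B hB
      simp only [Measure.add_apply, bind_prod_rect _ _ mA mB]
      rw [Measure.map_apply hdiag (mA.prod mB)]
      have hpre : (fun z : E => (z, z)) ⁻¹' (A ×ˢ B) = A ∩ B := by ext; simp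
      rw [hpre]
      obtain ⟨j11, e11⟩ := integral_kernel_mul hL₁ hL₁ hf₁ hf₁ mA mB
      obtain ⟨j12, e12⟩ := integral_kernel_mul hL₁ hL₂ hf₁ hf₂ mA mB
      obtain ⟨j21, e21⟩ := integral_kernel_mul hL₂ hL₁ hf₂ hf₁ mA mB
      obtain ⟨j22, e22⟩ := integral_kernel_mul hL₂ hL₂ hf₂ hf₂ mA mB
      have t11 := (lintegral_kernel_mul_lt_top hL₁ hL₁ hf₁ hf₁ A B).ne
      have t12 := (lintegral_kernel_mul_lt_top hL₁ hL₂ hf₁ hf₂ A B).ne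
      have t21 := (lintegral_kernel_mul_lt_top hL₂ hL₁ hf₂ hf₁ A B).ne
      have t22 := (lintegral_kernel_mul_lt_top hL₂ hL₂ hf₂ hf₂ A B).ne
      have hexp : ∫ ω, ((κ₁ ω A).toReal - (κ₂ ω A).toReal) *
          ((κ₁ ω B).toReal - (κ₂ ω B).toReal) ∂P
          = (∫⁻ ω, κ₁ ω A * κ₁ ω B ∂P).toReal + (∫⁻ ω, κ₂ ω A * κ₂ ω B ∂P).toReal
            - ((∫⁻ ω, κ₁ ω A * κ₂ ω B ∂P).toReal + (∫⁻ ω, κ₂ ω A * κ₁ ω B ∂P).toReal) := by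
        rw [← e11, ← e12, ← e21, ← e22, ← integral_add j11 j22, ← integral_add j12 j21,
          ← integral_sub (by exact j11.add j22) (by exact j12.add j21)]
        refine integral_congr_ae (ae_of_all _ fun ω => ?_)
        simp only []
        ring
      rw [hexp] at h
      rw [← ENNReal.toReal_eq_toReal_iff' (by finiteness) (by finiteness),
        ENNReal.toReal_add t11 t22, ENNReal.toReal_add (by finiteness) (by finiteness),
        ENNReal.toReal_add t12 t21]
      linarith
    refine ext_of_generate_finite _ (generateFrom_eq_prod hC.symm hC.symm
      ⟨fun _ => Set.univ, fun _ => huniv, Set.iUnion_const _⟩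
      ⟨fun _ => Set.univ, fun _ => huniv, Set.iUnion_const _⟩).symm (hpi.prod hpi) ?_ ?_
    · rintro _ ⟨A, hA, B, hB, rfl⟩
      exact hrect A hA B hB
    · rw [← Set.univ_prod_univ]
      exact hrect _ huniv _ huniv
  have hbound : ∀ (κ : Kernel Ω E), (∀ ω, κ ω Set.univ < ∞) →
      MemLp (fun ω => (κ ω Set.univ).toReal) 2 P → MemLp (fun ω => ∫ z, H z ∂κ ω) 2 P := by
    intro κ hf hL
    refine MemLp.of_le_mul (c := c) hL
      (StronglyMeasurable.integral_kernel hH.stronglyMeasurable).aestronglyMeasurable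
      (ae_of_all _ fun ω => ?_)
    rw [Real.norm_of_nonneg ENNReal.toReal_nonneg]
    have : IsFiniteMeasure (κ ω) := ⟨hf ω⟩
    exact norm_integral_le_of_norm_le_const (ae_of_all _ hc)
  have l1 := hbound κ₁ hf₁ hL₁
  have l2 := hbound κ₂ hf₂ hL₂
  refine ⟨l1.sub l2, ?_⟩
  have hI : ∀ μ : Measure (E × E), IsFiniteMeasure μ →
      Integrable (fun z : E × E => H z.1 * H z.2) μ := fun μ _ => by
    refine Integrable.of_bound (by fun_prop) (c * c) (ae_of_all _ fun z => ?_)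
    rw [norm_mul]
    exact mul_le_mul (hc _) (hc _) (norm_nonneg _) ((abs_nonneg _).trans (hc z.1))
  have hfm : IsFiniteMeasure (m.map fun z : E => (z, z)) := inferInstance
  have h := congrArg (fun μ => ∫ z, H z.1 * H z.2 ∂μ) hmeas
  beta_reduce at h
  rw [integral_add_measure (hI _ i11) (hI _ i22), integral_add_measure
    ((hI _ i12).add_measure (hI _ i21)) (hI _ hfm), integral_add_measure (hI _ i12) (hI _ i21),
    integral_map hdiag.aemeasurable (by fun_prop), integral_bind_prod_mul κ₁ κ₁ hH hc,
    integral_bind_prod_mul κ₁ κ₂ hH hc, integral_bind_prod_mul κ₂ κ₁ hH hc,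
    integral_bind_prod_mul κ₂ κ₂ hH hc] at h
  have k11 := l1.integrable_mul l1
  have k12 := l1.integrable_mul l2
  have k21 := l2.integrable_mul l1
  have k22 := l2.integrable_mul l2
  have hexp : ∫ ω, (∫ z, H z ∂κ₁ ω - ∫ z, H z ∂κ₂ ω) ^ 2 ∂P
      = (∫ ω, (∫ z, H z ∂κ₁ ω) * ∫ z, H z ∂κ₁ ω ∂P + ∫ ω, (∫ z, H z ∂κ₂ ω) * ∫ z, H z ∂κ₂ ω ∂P)
        - (∫ ω, (∫ z, H z ∂κ₁ ω) * ∫ z, H z ∂κ₂ ω ∂P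
          + ∫ ω, (∫ z, H z ∂κ₂ ω) * ∫ z, H z ∂κ₁ ω ∂P) := by
    rw [← integral_add (by exact k11) (by exact k22), ← integral_add (by exact k12) (by exact k21),
      ← integral_sub (by exact k11.add k22) (by exact k12.add k21)]
    refine integral_congr_ae (ae_of_all _ fun ω => ?_)
    simp only []
    ring
  rw [hexp, h]
  simp only [sq]
  ring

end Isometry

/-! ### Predictable integrands -/

/-- The space of triples `(s, ω, x)`, to carry the σ-algebra of predictable functions. -/
structure PredSpace (𝓕 : Filtration ℝ≥0 mΩ) where
  /-- The time `s`. -/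
  time : ℝ≥0
  /-- The outcome `ω`. -/
  point : Ω
  /-- The mark `x`. -/
  mark : ℝ

/-- The product of the predictable σ-algebra and the Borel σ-algebra of `ℝ`. -/
instance (𝓕 : Filtration ℝ≥0 mΩ) : MeasurableSpace (PredSpace 𝓕) :=
  (𝓕.predictable.prod (inferInstance : MeasurableSpace ℝ)).comap
    fun z : PredSpace 𝓕 => ((z.time, z.point), z.mark)

/-- The rectangle `T × D × B` in the space of triples. -/
def predRect (𝓕 : Filtration ℝ≥0 mΩ) (T : Set ℝ≥0) (D : Set Ω) (B : Set ℝ) :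
    Set (PredSpace 𝓕) := {z | z.time ∈ T ∧ z.point ∈ D ∧ z.mark ∈ B}

lemma measurable_predSpace_prod (𝓕 : Filtration ℝ≥0 mΩ) :
    Measurable[_, 𝓕.predictable.prod (inferInstance : MeasurableSpace ℝ)]
      fun z : PredSpace 𝓕 => ((z.time, z.point), z.mark) :=
  comap_measurable _

lemma measurableSet_predRect {𝓕 : Filtration ℝ≥0 mΩ} {T : Set ℝ≥0} {D : Set Ω} {B : Set ℝ}
    (hTD : MeasurableSet[𝓕.predictable] (T ×ˢ D)) (hB : MeasurableSet B) :
    MeasurableSet (predRect 𝓕 T D B) := by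
  have h := measurable_predSpace_prod 𝓕 (@MeasurableSet.prod _ _ 𝓕.predictable _ _ _ hTD hB)
  convert h using 1
  ext z
  simp [predRect, and_assoc]

/-- The generating π-system of the predictable sets consisting of the rectangles
`(s, ∞) × D × B` with `D ∈ 𝓕 s` and `{0} × D × B` with `D ∈ 𝓕 0`, and of the whole space. -/
def predGenerator (𝓕 : Filtration ℝ≥0 mΩ) : Set (Set (PredSpace 𝓕)) :=
  insert Set.univ ({R | ∃ D B, MeasurableSet[𝓕 0] D ∧ MeasurableSet B ∧ R = predRect 𝓕 {0} D B} ∪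
    {R | ∃ s D B, MeasurableSet[𝓕 s] D ∧ MeasurableSet B ∧ R = predRect 𝓕 (Set.Ioi s) D B})

lemma predRect_inter (𝓕 : Filtration ℝ≥0 mΩ) (T T' : Set ℝ≥0) (D D' : Set Ω) (B B' : Set ℝ) :
    predRect 𝓕 T D B ∩ predRect 𝓕 T' D' B' = predRect 𝓕 (T ∩ T') (D ∩ D') (B ∩ B') := by
  ext z
  simp only [predRect, Set.mem_inter_iff, Set.mem_ofPred_eq]
  tauto

lemma isPiSystem_predGenerator (𝓕 : Filtration ℝ≥0 mΩ) : IsPiSystem (predGenerator 𝓕) := by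
  refine IsPiSystem.insert_univ ?_
  rintro _ h1 _ h2 hne
  have hlow : ∀ s D, MeasurableSet[𝓕 (0 : ℝ≥0)] D → MeasurableSet[𝓕 s] D :=
    fun s D hD => 𝓕.mono zero_le _ hD
  rcases h1 with ⟨D, B, hD, hB, rfl⟩ | ⟨s, D, B, hD, hB, rfl⟩ <;>
  rcases h2 with ⟨D', B', hD', hB', rfl⟩ | ⟨s', D', B', hD', hB', rfl⟩ <;>
  rw [predRect_inter] at hne ⊢
  · left
    exact ⟨_, _, hD.inter hD', hB.inter hB', by rw [Set.inter_self]⟩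
  · obtain ⟨z, hz⟩ := hne
    have h3 : z.time = 0 := hz.1.1
    have h4 : s' < z.time := hz.1.2
    rw [h3] at h4
    exact absurd h4 not_lt_zero
  · obtain ⟨z, hz⟩ := hne
    have h3 : z.time = 0 := hz.1.2
    have h4 : s < z.time := hz.1.1
    rw [h3] at h4
    exact absurd h4 not_lt_zero
  · right
    refine ⟨max s s', D ∩ D', B ∩ B', ?_, hB.inter hB', by rw [Set.Ioi_inter_Ioi]⟩
    exact MeasurableSet.inter (𝓕.mono (le_max_left _ _) _ hD) (𝓕.mono (le_max_right _ _) _ hD')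

lemma generateFrom_predGenerator (𝓕 : Filtration ℝ≥0 mΩ) :
    (inferInstance : MeasurableSpace (PredSpace 𝓕)) =
      MeasurableSpace.generateFrom (predGenerator 𝓕) := by
  refine le_antisymm ?_ ?_
  · change MeasurableSpace.comap (fun z : PredSpace 𝓕 => ((z.time, z.point), z.mark))
      (MeasurableSpace.comap Prod.fst 𝓕.predictable ⊔ MeasurableSpace.comap Prod.snd _) ≤ _
    rw [MeasurableSpace.comap_sup, MeasurableSpace.comap_comp, MeasurableSpace.comap_comp]
    refine sup_le ?_ ?_
    · unfold Filtration.predictable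
      rw [MeasurableSpace.comap_generateFrom]
      refine MeasurableSpace.generateFrom_le ?_
      rintro _ ⟨_, ⟨D, hD, rfl⟩ | ⟨s, D, hD, rfl⟩, rfl⟩
      · refine MeasurableSpace.measurableSet_generateFrom (Or.inr (Or.inl
          ⟨D, Set.univ, hD, MeasurableSet.univ, ?_⟩))
        ext z; simp [predRect]
      · refine MeasurableSpace.measurableSet_generateFrom (Or.inr (Or.inr
          ⟨s, D, Set.univ, hD, MeasurableSet.univ, ?_⟩))
        ext z; simp [predRect]
    · rintro _ ⟨B, hB, rfl⟩
      have : (Prod.snd ∘ fun z : PredSpace 𝓕 => ((z.time, z.point), z.mark)) ⁻¹' B =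
          predRect 𝓕 {0} Set.univ B ∪ predRect 𝓕 (Set.Ioi 0) Set.univ B := by
        ext z
        rcases eq_or_lt_of_le (zero_le (a := z.time)) with h | h
        · simp [predRect, ← h]
        · simp [predRect, h]
      rw [this]
      refine MeasurableSet.union ?_ ?_
      · exact MeasurableSpace.measurableSet_generateFrom (Or.inr (Or.inl
          ⟨_, _, MeasurableSet.univ, hB, rfl⟩))
      · exact MeasurableSpace.measurableSet_generateFrom (Or.inr (Or.inr
          ⟨_, _, _, MeasurableSet.univ, hB, rfl⟩))
  · refine MeasurableSpace.generateFrom_le ?_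
    rintro _ (rfl | ⟨D, B, hD, hB, rfl⟩ | ⟨s, D, B, hD, hB, rfl⟩)
    · exact MeasurableSet.univ
    · exact measurableSet_predRect (measurableSet_predictable_singleton_bot_prod hD) hB
    · exact measurableSet_predRect (measurableSet_predictable_Ioi_prod hD) hB

/-- The map `(ω, (s, x)) ↦ (s, ω, x)`. -/
def toPredSpace (𝓕 : Filtration ℝ≥0 mΩ) (y : Ω × (ℝ≥0 × ℝ)) : PredSpace 𝓕 :=
  ⟨y.2.1, y.1, y.2.2⟩

lemma predictable_le (𝓕 : Filtration ℝ≥0 mΩ) :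
    𝓕.predictable ≤ (inferInstance : MeasurableSpace (ℝ≥0 × Ω)) :=
  measurableSpace_le_predictable_of_measurableSet
    (fun _ hA => (measurableSet_singleton _).prod (𝓕.le _ _ hA))
    fun _ _ hA => measurableSet_Ioi.prod (𝓕.le _ _ hA)

lemma measurable_toPredSpace (𝓕 : Filtration ℝ≥0 mΩ) : Measurable (toPredSpace 𝓕) := by
  refine measurable_comap_iff.2 ?_
  refine @Measurable.prodMk _ _ _ _ 𝓕.predictable _
    (fun y : Ω × (ℝ≥0 × ℝ) => (y.2.1, y.1)) (fun y => y.2.2) ?_ (by fun_prop)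
  exact Measurable.mono (by fun_prop : Measurable fun y : Ω × (ℝ≥0 × ℝ) => (y.2.1, y.1)) le_rfl
    (predictable_le 𝓕)

/-- Stochastic intervals `{s ≤ τ}` are predictable; the complement is a union over rational times. -/
lemma measurableSet_stochasticInterval {𝓕 : Filtration ℝ≥0 mΩ} {τ : Ω → WithTop ℝ≥0}
    (hτ : IsStoppingTime 𝓕 τ) :
    MeasurableSet {z : PredSpace 𝓕 | (z.time : WithTop ℝ≥0) ≤ τ z.point} := by
  have h : {z : PredSpace 𝓕 | (z.time : WithTop ℝ≥0) ≤ τ z.point}ᶜ =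
      ⋃ q : ℚ, predRect 𝓕 (Set.Ioi (Real.toNNReal q))
        {ω | τ ω ≤ ((Real.toNNReal q : ℝ≥0) : WithTop ℝ≥0)} Set.univ := by
    ext z
    simp only [Set.mem_compl_iff, Set.mem_ofPred_eq, not_le, Set.mem_iUnion, predRect,
      Set.mem_Ioi, Set.mem_univ, and_true]
    constructor
    · intro hz
      obtain ⟨t, ht⟩ := WithTop.ne_top_iff_exists.1 (ne_top_of_lt hz)
      rw [← ht] at hz ⊢
      have hz' : t < z.time := by exact_mod_cast hz
      obtain ⟨q, -, h1, h2⟩ := (NNReal.lt_iff_exists_rat_btwn _ _).1 hz'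
      exact ⟨q, h2, WithTop.coe_le_coe.2 h1.le⟩
    · rintro ⟨q, h1, h2⟩
      exact lt_of_le_of_lt h2 (WithTop.coe_lt_coe.2 h1)
  rw [← MeasurableSet.compl_iff, h]
  refine MeasurableSet.iUnion fun q => ?_
  exact measurableSet_predRect (measurableSet_predictable_Ioi_prod (hτ _)) MeasurableSet.univ

/-! ### The random measure on predictable sets -/

/-- The random measure `N` restricted to `(0, 1] × A`, as a kernel; the value is changed to zero
where the mass of `(0, 1] × A` is infinite. -/
noncomputable def jumpKernel (N : Ω → Measure (ℝ≥0 × ℝ)) (hN : Measurable N) (A : Set ℝ)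
    (hA : MeasurableSet A) : Kernel Ω (ℝ≥0 × ℝ) where
  toFun ω := {ω | N ω (Set.Ioc 0 1 ×ˢ A) < ∞}.indicator
    (fun ω => (N ω).restrict (Set.Ioc 0 1 ×ˢ A)) ω
  measurable' := by
    have hS : MeasurableSet ((Set.Ioc (0 : ℝ≥0) 1) ×ˢ A) := measurableSet_Ioc.prod hA
    refine Measurable.indicator (Measure.measurable_of_measurable_coe _ fun t ht => ?_) ?_
    · simp_rw [Measure.restrict_apply ht]
      exact (Measure.measurable_coe (ht.inter hS)).comp hN
    exact measurableSet_lt ((Measure.measurable_coe hS).comp hN) measurable_const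

lemma jumpKernel_univ_lt_top {N : Ω → Measure (ℝ≥0 × ℝ)} (hN : Measurable N) {A : Set ℝ}
    (hA : MeasurableSet A) (ω : Ω) : jumpKernel N hN A hA ω Set.univ < ∞ := by
  change {ω | N ω (Set.Ioc 0 1 ×ˢ A) < ∞}.indicator
    (fun ω => (N ω).restrict (Set.Ioc 0 1 ×ˢ A)) ω Set.univ < ∞
  by_cases h : N ω (Set.Ioc 0 1 ×ˢ A) < ∞
  · rw [Set.indicator_of_mem (by exact h), Measure.restrict_apply_univ]
    exact h
  · rw [Set.indicator_of_notMem (by exact h)]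
    simp

/-- A kernel with finite values is the sum of its restrictions to the events on which the total mass
lies in `[n, n + 1)`. -/
lemma isSFiniteKernel_of_lt_top {E : Type*} [MeasurableSpace E] (κ : Kernel Ω E)
    (h : ∀ ω, κ ω Set.univ < ∞) : IsSFiniteKernel κ := by
  classical
  have hm : Measurable fun ω => κ ω Set.univ := Kernel.measurable_coe κ MeasurableSet.univ
  have hset : ∀ n : ℕ, MeasurableSet {ω | (n : ℝ≥0∞) ≤ κ ω Set.univ ∧ κ ω Set.univ < n + 1} :=
    fun n => (measurableSet_le measurable_const hm).inter (measurableSet_lt hm measurable_const)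
  let κs : ℕ → Kernel Ω E := fun n => Kernel.piecewise (hset n) κ 0
  have hfin : ∀ n, IsFiniteKernel (κs n) := fun n => by
    refine ⟨⟨n + 1, by finiteness, fun ω => ?_⟩⟩
    simp only [κs, Kernel.piecewise_apply]
    split_ifs with hω
    · exact hω.2.le
    · simp
  refine ⟨⟨κs, hfin, ?_⟩⟩
  ext ω s hs
  rw [Kernel.sum_apply' _ _ hs]
  obtain ⟨n, hn1, hn2⟩ : ∃ n : ℕ, (n : ℝ≥0∞) ≤ κ ω Set.univ ∧ κ ω Set.univ < n + 1 := by
    refine ⟨⌊(κ ω Set.univ).toReal⌋₊, ?_, ?_⟩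
    · rw [← ENNReal.ofReal_toReal (h ω).ne, ← ENNReal.ofReal_natCast]
      exact ENNReal.ofReal_le_ofReal (by simpa using Nat.floor_le ENNReal.toReal_nonneg)
    · conv_lhs => rw [← ENNReal.ofReal_toReal (h ω).ne]
      have : ((⌊(κ ω Set.univ).toReal⌋₊ : ℝ≥0∞) + 1)
          = ENNReal.ofReal ((⌊(κ ω Set.univ).toReal⌋₊ : ℝ) + 1) := by
        rw [ENNReal.ofReal_add (by positivity) (by norm_num)]; simp
      rw [this]
      exact (ENNReal.ofReal_lt_ofReal_iff (by positivity)).2 (Nat.lt_floor_add_one _)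
  rw [tsum_eq_single n]
  · simp only [κs, Kernel.piecewise_apply]
    rw [if_pos ⟨hn1, hn2⟩]
  · intro k hk
    simp only [κs, Kernel.piecewise_apply]
    rw [if_neg]
    · simp
    · rintro ⟨h1, h2⟩
      have a1 : (n : ℝ≥0∞) < k + 1 := lt_of_le_of_lt hn1 h2
      have a2 : (k : ℝ≥0∞) < n + 1 := lt_of_le_of_lt h1 hn2
      norm_cast at a1 a2
      omega

instance {N : Ω → Measure (ℝ≥0 × ℝ)} (hN : Measurable N) {A : Set ℝ}
    (hA : MeasurableSet A) : IsSFiniteKernel (jumpKernel N hN A hA) :=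
  isSFiniteKernel_of_lt_top _ (jumpKernel_univ_lt_top hN hA)

/-- The lift of a kernel on `[0, ∞) × ℝ` to the space of triples `(s, ω, x)`. -/
noncomputable def predKernel (𝓕 : Filtration ℝ≥0 mΩ) (κ : Kernel Ω (ℝ≥0 × ℝ)) :
    Kernel Ω (PredSpace 𝓕) :=
  (Kernel.id ×ₖ κ).map (toPredSpace 𝓕)

instance (𝓕 : Filtration ℝ≥0 mΩ) (κ : Kernel Ω (ℝ≥0 × ℝ)) [IsSFiniteKernel κ] :
    IsSFiniteKernel (predKernel 𝓕 κ) := by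
  unfold predKernel; infer_instance

lemma predKernel_eq_map (𝓕 : Filtration ℝ≥0 mΩ) (κ : Kernel Ω (ℝ≥0 × ℝ)) [IsSFiniteKernel κ]
    (ω : Ω) : predKernel 𝓕 κ ω = (κ ω).map fun z => toPredSpace 𝓕 (ω, z) := by
  have := measurable_toPredSpace 𝓕
  rw [predKernel, Kernel.map_apply _ this, Kernel.prod_apply, Kernel.id_apply, Measure.dirac_prod,
    Measure.map_map this (by fun_prop)]
  rfl

lemma measurable_toPredSpace_section (𝓕 : Filtration ℝ≥0 mΩ) (ω : Ω) :
    Measurable fun z : ℝ≥0 × ℝ => toPredSpace 𝓕 (ω, z) :=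
  (measurable_toPredSpace 𝓕).comp (by fun_prop)

lemma predKernel_apply (𝓕 : Filtration ℝ≥0 mΩ) (κ : Kernel Ω (ℝ≥0 × ℝ)) [IsSFiniteKernel κ]
    (ω : Ω) {R : Set (PredSpace 𝓕)} (hR : MeasurableSet R) :
    predKernel 𝓕 κ ω R = κ ω ((fun z => toPredSpace 𝓕 (ω, z)) ⁻¹' R) := by
  rw [predKernel_eq_map, Measure.map_apply (measurable_toPredSpace_section 𝓕 ω) hR]

lemma integral_predKernel (𝓕 : Filtration ℝ≥0 mΩ) (κ : Kernel Ω (ℝ≥0 × ℝ)) [IsSFiniteKernel κ]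
    (ω : Ω) {H : PredSpace 𝓕 → ℝ} (hH : Measurable H) :
    ∫ z, H z ∂predKernel 𝓕 κ ω = ∫ z, H (toPredSpace 𝓕 (ω, z)) ∂κ ω := by
  rw [predKernel_eq_map, integral_map (measurable_toPredSpace_section 𝓕 ω).aemeasurable
    hH.aestronglyMeasurable]

/-! ### The isometry for compensated Poisson integrals of predictable functions -/

lemma prod_Ioc_lt_top {F : Measure ℝ} [SFinite F] {B : Set ℝ} (hB : F B < ∞) (s t : ℝ≥0) :
    (timeMeasure.prod F) (Set.Ioc s t ×ˢ B) < ∞ := by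
  rw [Measure.prod_prod, timeMeasure_Ioc]
  exact ENNReal.mul_lt_top ENNReal.coe_lt_top hB

namespace IsPoissonRandomMeasure

variable {𝓕 : Filtration ℝ≥0 mΩ} {P : Measure Ω} {F : Measure ℝ}
  {N : Ω → Measure (ℝ≥0 × ℝ)}

lemma measurable_compensated_past (hN : IsPoissonRandomMeasure 𝓕 P F N) {t : ℝ≥0}
    {A : Set (ℝ≥0 × ℝ)} (hA : MeasurableSet A) (hAt : A ⊆ Set.Iic t ×ˢ Set.univ) :
    Measurable[𝓕 t] (compensated F N A) :=
  (hN.adapted t A hA hAt).ennreal_toReal.sub_const _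

lemma measurable_compensated_future {Ω : Type*} {N : Ω → Measure (ℝ≥0 × ℝ)} {t : ℝ≥0}
    {A : Set (ℝ≥0 × ℝ)} (hA : MeasurableSet A) (hAt : A ⊆ Set.Ioi t ×ˢ Set.univ) :
    Measurable[MeasurableSpace.comap (fun ω => (N ω).restrict (Set.Ioi t ×ˢ Set.univ))
      inferInstance] (compensated F N A) := by
  have h : compensated F N A = (fun μ : Measure (ℝ≥0 × ℝ) => (μ A).toReal -
      ((timeMeasure.prod F) A).toReal) ∘ fun ω => (N ω).restrict (Set.Ioi t ×ˢ Set.univ) := by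
    funext ω
    simp only [compensated, Function.comp_apply]
    rw [Measure.restrict_apply hA, Set.inter_eq_self_of_subset_left hAt]
  rw [h]
  exact ((Measure.measurable_coe hA).ennreal_toReal.sub_const _).comp (comap_measurable _)

/-- The past up to time `t` is independent of the random measure after time `t`. -/
lemma integral_mul_of_past_future (hN : IsPoissonRandomMeasure 𝓕 P F N) {t : ℝ≥0} {Y Z : Ω → ℝ}
    (hY : Measurable[𝓕 t] Y)
    (hZ : Measurable[MeasurableSpace.comap (fun ω => (N ω).restrict (Set.Ioi t ×ˢ Set.univ))
      inferInstance] Z) (hZm : AEStronglyMeasurable Z P) :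
    ∫ ω, Y ω * Z ω ∂P = (∫ ω, Y ω ∂P) * ∫ ω, Z ω ∂P := by
  have hind : IndepFun Y Z P :=
    indep_of_indep_of_le_left (indep_of_indep_of_le_right (hN.indep_future t).symm hZ.comap_le)
      hY.comap_le
  exact hind.integral_fun_mul_eq_mul_integral (hY.mono (𝓕.le t) le_rfl).aestronglyMeasurable hZm

variable [IsProbabilityMeasure P] [SigmaFinite F]

/-- The masses of two rectangles `(s, 1] × B`, each switched on by an event of the past, have the
orthogonality required by the isometry. -/
lemma integral_indicator_compensated_mul (hN : IsPoissonRandomMeasure 𝓕 P F N) {s₁ s₂ : ℝ≥0}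
    (hs : s₁ ≤ s₂) {D₁ D₂ : Set Ω} (hD₁ : MeasurableSet[𝓕 s₁] D₁) (hD₂ : MeasurableSet[𝓕 s₂] D₂)
    {B₁ B₂ : Set ℝ} (hB₁ : MeasurableSet B₁) (hB₂ : MeasurableSet B₂) (hF₁ : F B₁ < ∞)
    (hF₂ : F B₂ < ∞) :
    ∫ ω, D₁.indicator (compensated F N (Set.Ioc s₁ 1 ×ˢ B₁)) ω *
      D₂.indicator (compensated F N (Set.Ioc s₂ 1 ×ˢ B₂)) ω ∂P
      = P.real (D₁ ∩ D₂) * ((timeMeasure.prod F)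
        ((Set.Ioc s₁ 1 ×ˢ B₁) ∩ (Set.Ioc s₂ 1 ×ˢ B₂))).toReal := by
  -- the part `T₀` of the first rectangle up to time `s₂` belongs to the past of `s₂`
  set T₀ := Set.Ioc s₁ (min s₂ 1) ×ˢ B₁ with hT₀
  set T₁ := Set.Ioc s₂ 1 ×ˢ B₁ with hT₁
  set T₂ := Set.Ioc s₂ 1 ×ˢ B₂ with hT₂
  have hD₁' : MeasurableSet[𝓕 s₂] D₁ := 𝓕.mono hs _ hD₁
  have hDD : MeasurableSet[𝓕 s₂] (D₁ ∩ D₂) := MeasurableSet.inter hD₁' hD₂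
  have m0 : MeasurableSet T₀ := measurableSet_Ioc.prod hB₁
  have m1 : MeasurableSet T₁ := measurableSet_Ioc.prod hB₁
  have m2 : MeasurableSet T₂ := measurableSet_Ioc.prod hB₂
  have f0 : (timeMeasure.prod F) T₀ < ∞ := prod_Ioc_lt_top hF₁ _ _
  have f1 : (timeMeasure.prod F) T₁ < ∞ := prod_Ioc_lt_top hF₁ _ _
  have f2 : (timeMeasure.prod F) T₂ < ∞ := prod_Ioc_lt_top hF₂ _ _
  have hunion : Set.Ioc s₁ 1 ×ˢ B₁ = T₀ ∪ T₁ := by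
    rw [hT₀, hT₁, ← Set.union_prod]
    congr 1
    ext x
    simp only [Set.mem_Ioc, Set.mem_union, le_min_iff]
    constructor
    · rintro ⟨h1, h2⟩
      rcases le_or_gt x s₂ with h | h
      · exact Or.inl ⟨h1, h, h2⟩
      · exact Or.inr ⟨h, h2⟩
    · rintro (⟨h1, h2, h3⟩ | ⟨h1, h2⟩)
      · exact ⟨h1, h3⟩
      · exact ⟨hs.trans_lt h1, h2⟩
  have hdisj : Disjoint T₀ T₁ := by
    rw [Set.disjoint_left]
    rintro z ⟨h1, -⟩ ⟨h2, -⟩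
    exact absurd (h1.2.trans (min_le_left _ _)) (not_le.2 h2.1)
  have l0 := hN.memLp_compensated m0 f0
  have l1 := hN.memLp_compensated m1 f1
  have l2 := hN.memLp_compensated m2 f2
  have sub1 : T₁ ⊆ Set.Ioi s₂ ×ˢ Set.univ := fun z hz => ⟨hz.1.1, trivial⟩
  have sub2 : T₂ ⊆ Set.Ioi s₂ ×ˢ Set.univ := fun z hz => ⟨hz.1.1, trivial⟩
  have sub0 : T₀ ⊆ Set.Iic s₂ ×ˢ Set.univ := fun z hz => ⟨hz.1.2.trans (min_le_left _ _), trivial⟩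
  have g1 : Measurable[𝓕 s₂] ((D₁ ∩ D₂).indicator (compensated F N T₀)) :=
    (hN.measurable_compensated_past m0 sub0).indicator hDD
  have g2 : Measurable[𝓕 s₂] ((D₁ ∩ D₂).indicator (fun _ => (1 : ℝ))) :=
    measurable_const.indicator hDD
  have c1 := measurable_compensated_future (F := F) (N := N) m1 sub1
  have c2 := measurable_compensated_future (F := F) (N := N) m2 sub2
  have e1 := hN.integral_mul_of_past_future g1 c2 l2.1
  have e2 := hN.integral_mul_of_past_future g2 (c1.mul c2) (l1.1.mul l2.1)
  have hDDm := 𝓕.le _ _ hDD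
  have i1 : Integrable (fun ω => (D₁ ∩ D₂).indicator (compensated F N T₀) ω *
      compensated F N T₂ ω) P := (l0.indicator hDDm).integrable_mul l2
  have i2 : Integrable (fun ω => (D₁ ∩ D₂).indicator (fun _ => (1 : ℝ)) ω *
      (compensated F N T₁ * compensated F N T₂) ω) P := by
    refine ((l1.integrable_mul l2).indicator hDDm).congr (ae_of_all _ fun ω => ?_)
    by_cases h : ω ∈ D₁ ∩ D₂ <;> simp [h]
  calc _ = ∫ ω, ((D₁ ∩ D₂).indicator (compensated F N T₀) ω * compensated F N T₂ ω
        + (D₁ ∩ D₂).indicator (fun _ => (1 : ℝ)) ω *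
          (compensated F N T₁ * compensated F N T₂) ω) ∂P := by
        refine integral_congr_ae ?_
        rw [hunion]
        filter_upwards [hN.compensated_union_ae m0 m1 f0 f1 hdisj] with ω h
        by_cases h1 : ω ∈ D₁ <;> by_cases h2 : ω ∈ D₂ <;> simp [h1, h2, h]
        ring
    _ = _ := by
        rw [integral_add i1 i2, e1, e2, hN.integral_compensated m2 f2, mul_zero, zero_add,
          integral_indicator_const _ hDDm]
        simp only [Pi.mul_apply]
        rw [hN.integral_compensated_mul m1 m2 f1 f2, smul_eq_mul, mul_one]
        congr 3
        rw [hunion, Set.union_inter_distrib_right]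
        refine (Set.union_eq_self_of_subset_left ?_).symm
        rintro z ⟨hz0, hz2⟩
        have h1 : z.1 ≤ s₂ := (sub0 hz0).1
        exact absurd h1 (not_le.2 (sub2 hz2).1)

/-- The compensated mass of `(s, 1] × B`, switched on by an event of the past of `s`, is centred. -/
lemma integral_indicator_compensated (hN : IsPoissonRandomMeasure 𝓕 P F N) {s : ℝ≥0}
    {D : Set Ω} (hD : MeasurableSet[𝓕 s] D) {B : Set ℝ} (hB : MeasurableSet B) (hF : F B < ∞) :
    ∫ ω, D.indicator (compensated F N (Set.Ioc s 1 ×ˢ B)) ω ∂P = 0 := by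
  have m1 : MeasurableSet (Set.Ioc s 1 ×ˢ B) := measurableSet_Ioc.prod hB
  have f1 : (timeMeasure.prod F) (Set.Ioc s 1 ×ˢ B) < ∞ := prod_Ioc_lt_top hF _ _
  have g : Measurable[𝓕 s] (D.indicator (fun _ => (1 : ℝ))) := measurable_const.indicator hD
  have e := hN.integral_mul_of_past_future g
    (measurable_compensated_future (F := F) (N := N) (t := s) m1 fun z hz => ⟨hz.1.1, trivial⟩)
    (hN.memLp_compensated m1 f1).1
  rw [hN.integral_compensated m1 f1, mul_zero] at e
  rw [← e]
  refine integral_congr_ae (ae_of_all _ fun ω => ?_)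
  by_cases h : ω ∈ D <;> simp [h]

end IsPoissonRandomMeasure

/-- On `(0, 1] × A`, the sections of the generators are intervals times Borel sets. -/
lemma exists_section_predGenerator {𝓕 : Filtration ℝ≥0 mΩ} {R : Set (PredSpace 𝓕)}
    (hR : R ∈ predGenerator 𝓕) (A : Set ℝ) : ∃ s D B, MeasurableSet[𝓕 s] D ∧ MeasurableSet B ∧
      ∀ ω, ((fun z => toPredSpace 𝓕 (ω, z)) ⁻¹' R) ∩ (Set.Ioc 0 1 ×ˢ A)
        = {_z | ω ∈ D} ∩ (Set.Ioc s 1 ×ˢ (A ∩ B)) := by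
  rcases hR with rfl | ⟨D, B, hD, hB, rfl⟩ | ⟨s, D, B, hD, hB, rfl⟩
  · exact ⟨0, Set.univ, Set.univ, MeasurableSet.univ, MeasurableSet.univ, fun ω => by simp⟩
  -- sets of the form `{0} × D × B` do not meet `(0, 1] × A`
  · refine ⟨0, ∅, Set.univ, @MeasurableSet.empty _ (𝓕 0), MeasurableSet.univ, fun ω => ?_⟩
    ext z
    simp only [predRect, toPredSpace, Set.mem_inter_iff, Set.mem_preimage, Set.mem_ofPred_eq,
      Set.mem_singleton_iff, Set.mem_prod, Set.mem_Ioc, Set.mem_empty_iff_false, false_and,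
      iff_false]
    rintro ⟨⟨h1, -⟩, ⟨h2, -⟩, -⟩
    exact h2.ne' h1
  · refine ⟨s, D, B, hD, hB, fun ω => ?_⟩
    ext z
    simp only [predRect, toPredSpace, Set.mem_inter_iff, Set.mem_preimage, Set.mem_ofPred_eq,
      Set.mem_Ioi, Set.mem_prod, Set.mem_Ioc]
    constructor
    · tauto
    · rintro ⟨h1, ⟨h2, h3⟩, h4, h5⟩
      exact ⟨⟨h2, h1, h5⟩, ⟨lt_of_le_of_lt zero_le h2, h3⟩, h4⟩

/-- The lifted restriction of the Poisson random measure to `(0, 1] × A`. -/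
noncomputable def jumpPredKernel (𝓕 : Filtration ℝ≥0 mΩ) (N : Ω → Measure (ℝ≥0 × ℝ))
    (hN : Measurable N) (A : Set ℝ) (hA : MeasurableSet A) : Kernel Ω (PredSpace 𝓕) :=
  predKernel 𝓕 (jumpKernel N hN A hA)

/-- The lifted restriction of the intensity `ds F(dx)` to `(0, 1] × A`. -/
noncomputable def intensityPredKernel (𝓕 : Filtration ℝ≥0 mΩ) (F : Measure ℝ) (A : Set ℝ) :
    Kernel Ω (PredSpace 𝓕) :=
  predKernel 𝓕 (Kernel.const Ω ((timeMeasure.prod F).restrict (Set.Ioc 0 1 ×ˢ A)))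

section

variable {𝓕 : Filtration ℝ≥0 mΩ} {P : Measure Ω} [IsProbabilityMeasure P] {F : Measure ℝ}
  [SigmaFinite F] {N : Ω → Measure (ℝ≥0 × ℝ)} {A : Set ℝ}

instance (hN : Measurable N) (hA : MeasurableSet A) :
    IsSFiniteKernel (jumpPredKernel 𝓕 N hN A hA) := by
  unfold jumpPredKernel; infer_instance

instance : IsSFiniteKernel (intensityPredKernel 𝓕 F A) := by
  unfold intensityPredKernel; infer_instance

lemma jumpKernel_of_lt_top (hN : Measurable N) (hA : MeasurableSet A) {ω : Ω}
    (h : N ω (Set.Ioc 0 1 ×ˢ A) < ∞) :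
    jumpKernel N hN A hA ω = (N ω).restrict (Set.Ioc 0 1 ×ˢ A) :=
  Set.indicator_of_mem (s := {ω | N ω (Set.Ioc 0 1 ×ˢ A) < ∞}) h
    fun ω => (N ω).restrict (Set.Ioc 0 1 ×ˢ A)

lemma ae_jumpKernel_eq {P : Measure Ω} (hN : IsPoissonRandomMeasure 𝓕 P F N) (hA : MeasurableSet A)
    (hF : F A < ∞) : ∀ᵐ ω ∂P, jumpKernel N hN.measurable A hA ω
      = (N ω).restrict (Set.Ioc 0 1 ×ˢ A) := by
  filter_upwards [hN.ae_lt_top (measurableSet_Ioc.prod hA) (prod_Ioc_lt_top hF 0 1)] with ω h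
  exact jumpKernel_of_lt_top _ _ h

lemma jumpPredKernel_univ_lt_top (hN : Measurable N) (hA : MeasurableSet A) (ω : Ω) :
    jumpPredKernel 𝓕 N hN A hA ω Set.univ < ∞ := by
  rw [jumpPredKernel, predKernel_apply _ _ _ MeasurableSet.univ]
  exact jumpKernel_univ_lt_top hN hA ω

lemma intensityPredKernel_univ_lt_top (hF : F A < ∞) (ω : Ω) :
    intensityPredKernel 𝓕 F A ω Set.univ < ∞ := by
  rw [intensityPredKernel, predKernel_apply _ _ _ MeasurableSet.univ, Kernel.const_apply,
    Set.preimage_univ, Measure.restrict_apply_univ]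
  exact prod_Ioc_lt_top hF 0 1

lemma intensityPredKernel_apply_of_section {R : Set (PredSpace 𝓕)} (hR : MeasurableSet R)
    (hA : MeasurableSet A) (ω : Ω) : intensityPredKernel 𝓕 F A ω R = (timeMeasure.prod F)
      (((fun z => toPredSpace 𝓕 (ω, z)) ⁻¹' R) ∩ (Set.Ioc 0 1 ×ˢ A)) := by
  rw [intensityPredKernel, predKernel_apply _ _ _ hR, Kernel.const_apply,
    Measure.restrict_apply' (measurableSet_Ioc.prod hA)]

lemma ae_jumpPredKernel_apply_of_section {P : Measure Ω} (hN : IsPoissonRandomMeasure 𝓕 P F N)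
    (hA : MeasurableSet A) (hF : F A < ∞) : ∀ᵐ ω ∂P, ∀ R : Set (PredSpace 𝓕), MeasurableSet R →
      jumpPredKernel 𝓕 N hN.measurable A hA ω R
      = N ω (((fun z => toPredSpace 𝓕 (ω, z)) ⁻¹' R) ∩ (Set.Ioc 0 1 ×ˢ A)) := by
  filter_upwards [ae_jumpKernel_eq hN hA hF] with ω h R hR
  rw [jumpPredKernel, predKernel_apply _ _ _ hR, h,
    Measure.restrict_apply' (measurableSet_Ioc.prod hA)]

lemma measurableSet_of_mem_predGenerator {R : Set (PredSpace 𝓕)} (hR : R ∈ predGenerator 𝓕) :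
    MeasurableSet R :=
  (generateFrom_predGenerator 𝓕).ge _ (MeasurableSpace.measurableSet_generateFrom hR)

lemma memLp_jumpPredKernel {P : Measure Ω} (hN : IsPoissonRandomMeasure 𝓕 P F N)
    (hA : MeasurableSet A) (hF : F A < ∞) :
    MemLp (fun ω => (jumpPredKernel 𝓕 N hN.measurable A hA ω Set.univ).toReal) 2 P := by
  refine (memLp_congr_ae ?_).2 (hN.memLp_toReal (measurableSet_Ioc.prod hA)
    (prod_Ioc_lt_top hF 0 1))
  filter_upwards [ae_jumpPredKernel_apply_of_section hN hA hF] with ω h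
  rw [h _ MeasurableSet.univ, Set.preimage_univ, Set.univ_inter]

/-- Differences of the lifted kernels on a generator, in terms of compensated masses. -/
lemma ae_jumpPredKernel_sub {P : Measure Ω} (hN : IsPoissonRandomMeasure 𝓕 P F N)
    (hA : MeasurableSet A) (hF : F A < ∞) {R : Set (PredSpace 𝓕)} (hR : MeasurableSet R)
    {s : ℝ≥0} {D : Set Ω} {B : Set ℝ}
    (hsec : ∀ ω, ((fun z => toPredSpace 𝓕 (ω, z)) ⁻¹' R) ∩ (Set.Ioc 0 1 ×ˢ A)
        = {_z | ω ∈ D} ∩ (Set.Ioc s 1 ×ˢ (A ∩ B))) :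
    ∀ᵐ ω ∂P, (jumpPredKernel 𝓕 N hN.measurable A hA ω R).toReal
      - (intensityPredKernel 𝓕 F A ω R).toReal
      = D.indicator (compensated F N (Set.Ioc s 1 ×ˢ (A ∩ B))) ω := by
  filter_upwards [ae_jumpPredKernel_apply_of_section hN hA hF] with ω h
  rw [h _ hR, intensityPredKernel_apply_of_section hR hA, hsec]
  by_cases hω : ω ∈ D <;> simp [hω, compensated]

/-- The isometry for compensated Poisson integrals of bounded predictable functions `H`, over marks in
a set `A` of finite intensity:
`𝔼 (∫ H d(N - ν))² = 𝔼 ∫ H² dν`, with integrals over `(0, 1] × A`. -/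
theorem integral_sq_compensated (hN : IsPoissonRandomMeasure 𝓕 P F N) (hA : MeasurableSet A)
    (hF : F A < ∞) {H : PredSpace 𝓕 → ℝ} (hH : Measurable H) {c : ℝ} (hc : ∀ z, |H z| ≤ c) :
    MemLp (fun ω => ∫ z, H z ∂jumpPredKernel 𝓕 N hN.measurable A hA ω
      - ∫ z, H z ∂intensityPredKernel 𝓕 F A ω) 2 P ∧
    ∫ ω, (∫ z, H z ∂jumpPredKernel 𝓕 N hN.measurable A hA ω
      - ∫ z, H z ∂intensityPredKernel 𝓕 F A ω) ^ 2 ∂P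
      = ∫ z, H z ^ 2 ∂(P.bind (intensityPredKernel 𝓕 F A)) := by
  have hfin : ∀ ω, intensityPredKernel 𝓕 F A ω Set.univ
      = (timeMeasure.prod F) (Set.Ioc 0 1 ×ˢ A) := fun ω => by
    rw [intensityPredKernel_apply_of_section MeasurableSet.univ hA]; simp
  have hm : IsFiniteMeasure (P.bind (intensityPredKernel 𝓕 F A)) := by
    refine ⟨?_⟩
    rw [Measure.bind_apply MeasurableSet.univ (Kernel.aemeasurable _)]
    simp_rw [hfin]
    simpa using (prod_Ioc_lt_top hF 0 1)
  refine integral_sq_kernel_sub (jumpPredKernel_univ_lt_top _ hA)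
    (intensityPredKernel_univ_lt_top hF) (memLp_jumpPredKernel hN hA hF) ?_
    (generateFrom_predGenerator 𝓕) (isPiSystem_predGenerator 𝓕) (Set.mem_insert _ _) ?_ hH hc
  · simp_rw [hfin]
    exact memLp_const _
  · intro R₁ hR₁ R₂ hR₂
    obtain ⟨s₁, D₁, B₁, hD₁, hB₁, hsec₁⟩ := exists_section_predGenerator hR₁ A
    obtain ⟨s₂, D₂, B₂, hD₂, hB₂, hsec₂⟩ := exists_section_predGenerator hR₂ A
    have mR₁ := measurableSet_of_mem_predGenerator hR₁
    have mR₂ := measurableSet_of_mem_predGenerator hR₂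
    have hF₁ : F (A ∩ B₁) < ∞ := (measure_mono Set.inter_subset_left).trans_lt hF
    have hF₂ : F (A ∩ B₂) < ∞ := (measure_mono Set.inter_subset_left).trans_lt hF
    have hlhs : ∫ ω, ((jumpPredKernel 𝓕 N hN.measurable A hA ω R₁).toReal
        - (intensityPredKernel 𝓕 F A ω R₁).toReal) *
        ((jumpPredKernel 𝓕 N hN.measurable A hA ω R₂).toReal
        - (intensityPredKernel 𝓕 F A ω R₂).toReal) ∂P
        = P.real (D₁ ∩ D₂) * ((timeMeasure.prod F)
          ((Set.Ioc s₁ 1 ×ˢ (A ∩ B₁)) ∩ (Set.Ioc s₂ 1 ×ˢ (A ∩ B₂)))).toReal := by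
      have e1 := ae_jumpPredKernel_sub hN hA hF mR₁ hsec₁
      have e2 := ae_jumpPredKernel_sub hN hA hF mR₂ hsec₂
      rcases le_total s₁ s₂ with h | h
      · rw [← hN.integral_indicator_compensated_mul h hD₁ hD₂ (hA.inter hB₁) (hA.inter hB₂) hF₁ hF₂]
        refine integral_congr_ae ?_
        filter_upwards [e1, e2] with ω h1 h2
        rw [h1, h2]
      · rw [Set.inter_comm D₁, Set.inter_comm (Set.Ioc s₁ 1 ×ˢ _),
          ← hN.integral_indicator_compensated_mul h hD₂ hD₁ (hA.inter hB₂) (hA.inter hB₁) hF₂ hF₁]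
        refine integral_congr_ae ?_
        filter_upwards [e1, e2] with ω h1 h2
        rw [h1, h2, mul_comm]
    rw [hlhs, Measure.bind_apply (mR₁.inter mR₂) (Kernel.aemeasurable _)]
    have hrhs : ∀ ω, intensityPredKernel 𝓕 F A ω (R₁ ∩ R₂) = (D₁ ∩ D₂).indicator
        (fun _ => (timeMeasure.prod F)
          ((Set.Ioc s₁ 1 ×ˢ (A ∩ B₁)) ∩ (Set.Ioc s₂ 1 ×ˢ (A ∩ B₂)))) ω := by
      intro ω
      rw [intensityPredKernel_apply_of_section (mR₁.inter mR₂) hA, Set.preimage_inter,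
        Set.inter_inter_distrib_right, hsec₁, hsec₂]
      by_cases h1 : ω ∈ D₁ <;> by_cases h2 : ω ∈ D₂ <;> simp [h1, h2]
    simp_rw [hrhs]
    rw [lintegral_indicator_const
      ((𝓕.le _ _ hD₁).inter (𝓕.le _ _ hD₂)), ENNReal.toReal_mul, mul_comm]
    rfl

/-- The compensation formula: the intensity is the compensator of the random measure on
predictable sets. -/
lemma bind_jumpPredKernel (hN : IsPoissonRandomMeasure 𝓕 P F N) (hA : MeasurableSet A)
    (hF : F A < ∞) :
    P.bind (jumpPredKernel 𝓕 N hN.measurable A hA) = P.bind (intensityPredKernel 𝓕 F A) := by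
  have key : ∀ R ∈ predGenerator 𝓕, P.bind (jumpPredKernel 𝓕 N hN.measurable A hA) R
      = P.bind (intensityPredKernel 𝓕 F A) R ∧
      P.bind (jumpPredKernel 𝓕 N hN.measurable A hA) R < ∞ := by
    intro R hR
    obtain ⟨s, D, B, hD, hB, hsec⟩ := exists_section_predGenerator hR A
    have mR := measurableSet_of_mem_predGenerator hR
    have hF' : F (A ∩ B) < ∞ := (measure_mono Set.inter_subset_left).trans_lt hF
    have mT : MeasurableSet (Set.Ioc s 1 ×ˢ (A ∩ B)) := measurableSet_Ioc.prod (hA.inter hB)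
    have fT := prod_Ioc_lt_top hF' s 1
    have h1 := ae_jumpPredKernel_sub hN hA hF mR hsec
    have h2 := hN.integral_indicator_compensated hD (hA.inter hB) hF'
    rw [← integral_congr_ae h1] at h2
    have i1 : Integrable (fun ω => (jumpPredKernel 𝓕 N hN.measurable A hA ω R).toReal) P := by
      refine ((memLp_jumpPredKernel hN hA hF).integrable (by norm_num)).mono'
        (Kernel.measurable_coe _ mR).ennreal_toReal.aestronglyMeasurable (ae_of_all _ fun ω => ?_)
      rw [Real.norm_of_nonneg ENNReal.toReal_nonneg]
      exact ENNReal.toReal_mono (jumpPredKernel_univ_lt_top _ hA ω).ne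
        (measure_mono (Set.subset_univ _))
    have i2 : Integrable (fun ω => (intensityPredKernel 𝓕 F A ω R).toReal) P := by
      refine Integrable.of_bound
        (Kernel.measurable_coe _ mR).ennreal_toReal.aestronglyMeasurable
        ((timeMeasure.prod F) (Set.Ioc 0 1 ×ˢ A)).toReal (ae_of_all _ fun ω => ?_)
      rw [Real.norm_of_nonneg ENNReal.toReal_nonneg, intensityPredKernel_apply_of_section mR hA]
      exact ENNReal.toReal_mono (prod_Ioc_lt_top hF 0 1).ne (measure_mono Set.inter_subset_right)
    rw [integral_sub i1 i2, sub_eq_zero,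
      integral_toReal (Kernel.measurable_coe _ mR).aemeasurable (ae_of_all _ fun ω =>
        (measure_mono (Set.subset_univ _)).trans_lt (jumpPredKernel_univ_lt_top _ hA ω)),
      integral_toReal (Kernel.measurable_coe _ mR).aemeasurable (ae_of_all _ fun ω =>
        (measure_mono (Set.subset_univ _)).trans_lt (intensityPredKernel_univ_lt_top hF ω))] at h2
    rw [Measure.bind_apply mR (Kernel.aemeasurable _), Measure.bind_apply mR (Kernel.aemeasurable _)]
    have t : ∀ κ : Kernel Ω (PredSpace 𝓕), (∀ ω, κ ω Set.univ < ∞) →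
        Integrable (fun ω => (κ ω R).toReal) P → ∫⁻ ω, κ ω R ∂P < ∞ := by
      intro κ hκ hi
      have := hi.lintegral_lt_top
      refine lt_of_le_of_lt (lintegral_mono fun ω => ?_) this
      rw [ENNReal.ofReal_toReal ((measure_mono (Set.subset_univ _)).trans_lt (hκ ω)).ne]
    have t1 := t _ (jumpPredKernel_univ_lt_top _ hA) i1
    have t2 := t _ (intensityPredKernel_univ_lt_top hF) i2
    exact ⟨(ENNReal.toReal_eq_toReal_iff' t1.ne t2.ne).1 h2, t1⟩
  have hfin : IsFiniteMeasure (P.bind (jumpPredKernel 𝓕 N hN.measurable A hA)) :=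
    ⟨(key _ (Set.mem_insert _ _)).2⟩
  exact ext_of_generate_finite _ (generateFrom_predGenerator 𝓕) (isPiSystem_predGenerator 𝓕)
    (fun R hR => (key R hR).1) (key _ (Set.mem_insert _ _)).1

end

/-! ### Jump integrals -/

/-- Markov's inequality: only a set of marks of finite intensity can produce jumps larger than `ε`. -/
lemma measure_lt_dominating_lt_top {F : Measure ℝ} {β : ℝ} (hβ : 0 ≤ β) {ψ : ℝ → ℝ}
    (hψ : Measurable ψ) (hint : ∫⁻ x in {x | ψ x ≠ 0}, ENNReal.ofReal (ψ x ^ β) ∂F < ∞)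
    {ε : ℝ} (hε : 0 < ε) : F {x | ε < ψ x} < ∞ := by
  have hc : ENNReal.ofReal (ε ^ β) ≠ 0 := by
    simpa using Real.rpow_pos_of_pos hε β
  have h1 : ENNReal.ofReal (ε ^ β) * F {x | ε < ψ x} ≤
      ∫⁻ x in {x | ψ x ≠ 0}, ENNReal.ofReal (ψ x ^ β) ∂F := by
    rw [← setLIntegral_const]
    refine (setLIntegral_mono' (measurableSet_lt measurable_const hψ) fun x hx => ?_).trans
      (lintegral_mono_set fun x (hx : ε < ψ x) => (hε.trans hx).ne')
    exact ENNReal.ofReal_le_ofReal (Real.rpow_le_rpow hε.le (le_of_lt hx) hβ)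
  by_contra hcon
  rw [not_lt, top_le_iff] at hcon
  rw [hcon, ENNReal.mul_top hc, top_le_iff] at h1
  exact hint.ne h1

/-- As `β ≤ 2`, the dominating function, truncated at one, is square integrable. -/
lemma lintegral_min_one_sq_lt_top {F : Measure ℝ} {β : ℝ} (hβ : β ∈ Set.Icc (0 : ℝ) 2)
    {ψ : ℝ → ℝ} (hψ : Measurable ψ) (hψ0 : ∀ x, 0 ≤ ψ x)
    (hint : ∫⁻ x in {x | ψ x ≠ 0}, ENNReal.ofReal (ψ x ^ β) ∂F < ∞) :
    ∫⁻ x, ENNReal.ofReal (min (ψ x) 1 ^ 2) ∂F < ∞ := by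
  refine lt_of_le_of_lt ?_ hint
  rw [← lintegral_indicator (show MeasurableSet {x | ψ x ≠ 0} from
    (measurableSet_eq_fun hψ measurable_const).compl)]
  refine lintegral_mono fun x => ?_
  by_cases h0 : ψ x = 0
  · simp [h0]
  · rw [Set.indicator_of_mem (by exact h0)]
    refine ENNReal.ofReal_le_ofReal ?_
    have hpos : 0 < ψ x := lt_of_le_of_ne (hψ0 x) (Ne.symm h0)
    rcases le_total (ψ x) 1 with h | h
    · rw [min_eq_left h, ← Real.rpow_natCast]
      exact Real.rpow_le_rpow_of_exponent_ge hpos h (by simpa using hβ.2)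
    · rw [min_eq_right h, one_pow]
      exact Real.one_le_rpow h hβ.1

/-- Increments of integrals over `(0, t]` are integrals over `(s, t]`. -/
lemma setIntegral_Ioc_sub {μ : Measure (ℝ≥0 × ℝ)} {f : ℝ≥0 × ℝ → ℝ} {U : Set (ℝ≥0 × ℝ)}
    (hU : MeasurableSet U) {s t : ℝ≥0} (hst : s ≤ t)
    (hint : IntegrableOn f {z | z.1 ∈ Set.Ioc 0 t ∧ z ∈ U} μ) :
    (∫ z in {z | z.1 ∈ Set.Ioc 0 t ∧ z ∈ U}, f z ∂μ) - ∫ z in {z | z.1 ∈ Set.Ioc 0 s ∧ z ∈ U}, f z ∂μ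
      = ∫ z in {z | z.1 ∈ Set.Ioc s t ∧ z ∈ U}, f z ∂μ := by
  have hm : MeasurableSet {z : ℝ≥0 × ℝ | z.1 ∈ Set.Ioc 0 s ∧ z ∈ U} :=
    (measurable_fst measurableSet_Ioc).inter hU
  have hsub : {z : ℝ≥0 × ℝ | z.1 ∈ Set.Ioc 0 s ∧ z ∈ U} ⊆ {z | z.1 ∈ Set.Ioc 0 t ∧ z ∈ U} :=
    fun z hz => ⟨⟨hz.1.1, hz.1.2.trans hst⟩, hz.2⟩
  rw [← setIntegral_sdiff hm hint hsub]
  congr 2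
  ext z
  simp only [Set.mem_sdiff, Set.mem_ofPred_eq, Set.mem_Ioc]
  constructor
  · rintro ⟨⟨⟨h1, h2⟩, h3⟩, h4⟩
    refine ⟨⟨?_, h2⟩, h3⟩
    by_contra hcon
    exact h4 ⟨⟨h1, not_lt.1 hcon⟩, h3⟩
  · rintro ⟨⟨h1, h2⟩, h3⟩
    exact ⟨⟨⟨zero_le.trans_lt h1, h2⟩, h3⟩, fun h => absurd h.1.2 (not_le.2 h1)⟩

/-- Over a set of finite measure containing the relevant marks, increments of integrals of small
jumps are integrals of a bounded function. -/
lemma setIntegral_jumps_sub {μ : Measure (ℝ≥0 × ℝ)} {f : ℝ≥0 × ℝ → ℝ} (hf : Measurable f)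
    {S : Set (ℝ≥0 × ℝ)} (hμS : μ S < ∞) {ε : ℝ} {s t : ℝ≥0} (hst : s ≤ t)
    (hsub : {z | z.1 ∈ Set.Ioc 0 t ∧ ε < |f z| ∧ |f z| ≤ 1} ⊆ S) :
    (∫ z in {z | z.1 ∈ Set.Ioc 0 t ∧ ε < |f z| ∧ |f z| ≤ 1}, f z ∂μ)
      - ∫ z in {z | z.1 ∈ Set.Ioc 0 s ∧ ε < |f z| ∧ |f z| ≤ 1}, f z ∂μ
      = ∫ z, {z | z.1 ∈ Set.Ioc s t ∧ ε < |f z| ∧ |f z| ≤ 1}.indicator f z ∂(μ.restrict S) := by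
  have hU : MeasurableSet {z | ε < |f z| ∧ |f z| ≤ 1} :=
    (measurableSet_lt measurable_const hf.norm).inter
      (measurableSet_le hf.norm measurable_const)
  have hT : ∀ r r' : ℝ≥0, MeasurableSet {z : ℝ≥0 × ℝ | z.1 ∈ Set.Ioc r r' ∧ ε < |f z| ∧ |f z| ≤ 1} :=
    fun r r' => (measurable_fst measurableSet_Ioc).inter hU
  have hint : IntegrableOn f {z | z.1 ∈ Set.Ioc 0 t ∧ ε < |f z| ∧ |f z| ≤ 1} μ := by
    refine Measure.integrableOn_of_bounded (M := 1) ((measure_mono hsub).trans_lt hμS).ne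
      hf.aestronglyMeasurable ?_
    exact (ae_restrict_iff' (hT _ _)).2 (ae_of_all _ fun z hz => hz.2.2)
  refine (setIntegral_Ioc_sub hU hst hint).trans ?_
  rw [← integral_indicator (by exact hT s t)]
  refine (setIntegral_eq_integral_of_forall_compl_eq_zero fun z hz => ?_).symm
  refine Set.indicator_of_notMem (fun h => hz ?_) _
  exact hsub ⟨⟨zero_le.trans_lt h.1.1, h.1.2⟩, h.2⟩

lemma measurable_jump_section {𝓕 : Filtration ℝ≥0 mΩ} {δ : ℝ≥0 → Ω → ℝ → ℝ}
    (hδ : IsPredictableFunction 𝓕 δ) :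
    Measurable fun z : PredSpace 𝓕 => δ z.time z.point z.mark :=
  Measurable.comp (g := fun q : (ℝ≥0 × Ω) × ℝ => δ q.1.1 q.1.2 q.2) hδ
    (measurable_predSpace_prod 𝓕)

lemma measurable_predSpace_time (𝓕 : Filtration ℝ≥0 mΩ) :
    Measurable fun z : PredSpace 𝓕 => z.time := by
  refine Measurable.comp (g := Prod.fst) (f := fun z : PredSpace 𝓕 => (z.time, z.point)) ?_
    (measurable_fst.comp (measurable_predSpace_prod 𝓕))
  rintro B hB
  -- the time projection is measurable as the identity process is predictable
  refine (?_ : Measurable[𝓕.predictable] (Prod.fst : ℝ≥0 × Ω → ℝ≥0)) hB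
  refine measurable_of_Ioi fun a => ?_
  have : (Prod.fst : ℝ≥0 × Ω → ℝ≥0) ⁻¹' Set.Ioi a = Set.Ioi a ×ˢ Set.univ := by ext; simp
  rw [this]
  exact measurableSet_predictable_Ioi_prod (@MeasurableSet.univ _ (𝓕 a))

lemma lintegral_bind_intensityPredKernel {𝓕 : Filtration ℝ≥0 mΩ} {P : Measure Ω} {F : Measure ℝ}
    [SigmaFinite F] {A : Set ℝ} {H : PredSpace 𝓕 → ℝ≥0∞} (hH : Measurable H) :
    ∫⁻ z, H z ∂(P.bind (intensityPredKernel 𝓕 F A)) =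
      ∫⁻ ω, ∫⁻ z in Set.Ioc 0 1 ×ˢ A, H (toPredSpace 𝓕 (ω, z)) ∂(timeMeasure.prod F) ∂P := by
  rw [Measure.lintegral_bind (Kernel.aemeasurable _) hH.aemeasurable]
  refine lintegral_congr fun ω => ?_
  rw [intensityPredKernel, predKernel_eq_map,
    lintegral_map hH (measurable_toPredSpace_section 𝓕 ω), Kernel.const_apply]

section

variable {𝓕 : Filtration ℝ≥0 mΩ} {P : Measure Ω} [IsProbabilityMeasure P] {F : Measure ℝ}
  [SigmaFinite F] {N : Ω → Measure (ℝ≥0 × ℝ)} {δ : ℝ≥0 → Ω → ℝ → ℝ}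

/-- Second moments of the compensated sums of small jumps: up to time `τ`, these are integrals of
predictable functions bounded by `min ψ 1`. -/
lemma exists_smallJumpSum_approx (hN : IsPoissonRandomMeasure 𝓕 P F N)
    (hδ : IsPredictableFunction 𝓕 δ) {τ : Ω → WithTop ℝ≥0} (hτ : IsStoppingTime 𝓕 τ) {ψ : ℝ → ℝ}
    (hψ : Measurable ψ)
    (hdom : ∀ (ω : Ω) (s : ℝ≥0) (x : ℝ), (s : WithTop ℝ≥0) ≤ τ ω → min |δ s ω x| 1 ≤ ψ x)
    {ε : ℝ} (hε : 0 < ε) (hF : F {x | ε / 2 < ψ x} < ∞) {s t : ℝ≥0} (hst : s ≤ t)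
    (ht : t ≤ 1) :
    ∃ Z : Ω → ℝ, AEMeasurable Z P ∧
      (∀ᵐ ω ∂P, ((1 : ℝ≥0) : WithTop ℝ≥0) < τ ω →
        smallJumpSum F N δ ε t ω - smallJumpSum F N δ ε s ω = Z ω) ∧
      ∫⁻ ω, ‖Z ω‖ₑ ^ 2 ∂P ≤ (∫⁻ x, ENNReal.ofReal (min (ψ x) 1 ^ 2) ∂F) * (t - s : ℝ≥0) := by
  -- any level below `ε` serves here: jumps larger than `ε` have marks with `ε < ψ`
  set A : Set ℝ := {x | ε / 2 < ψ x} with hAdef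
  have hA : MeasurableSet A := measurableSet_lt measurable_const hψ
  have hS : MeasurableSet (Set.Ioc (0 : ℝ≥0) 1 ×ˢ A) := measurableSet_Ioc.prod hA
  have hδm := measurable_jump_section hδ
  -- stopping at `τ` makes the integrand bounded by `min ψ 1` and keeps it predictable
  let V : Set (PredSpace 𝓕) := {z | (z.time ∈ Set.Ioc s t ∧ (z.time : WithTop ℝ≥0) ≤ τ z.point) ∧
    ε < |δ z.time z.point z.mark| ∧ |δ z.time z.point z.mark| ≤ 1}
  have hV : MeasurableSet V := by
    refine MeasurableSet.inter (MeasurableSet.inter ?_ (measurableSet_stochasticInterval hτ))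
      (MeasurableSet.inter ?_ ?_)
    · exact measurable_predSpace_time 𝓕 measurableSet_Ioc
    · exact measurableSet_lt measurable_const hδm.norm
    · exact measurableSet_le hδm.norm measurable_const
  let H : PredSpace 𝓕 → ℝ := V.indicator fun z => δ z.time z.point z.mark
  have hH : Measurable H := hδm.indicator hV
  have hH1 : ∀ z, |H z| ≤ 1 := fun z => by
    by_cases h : z ∈ V
    · simp only [H, Set.indicator_of_mem h]; exact h.2.2
    · simp [H, Set.indicator_of_notMem h]
  obtain ⟨hL, hiso⟩ := integral_sq_compensated hN hA hF hH hH1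
  refine ⟨_, hL.aemeasurable, ?_, ?_⟩
  · filter_upwards [ae_jumpKernel_eq hN hA hF, hN.ae_lt_top hS (prod_Ioc_lt_top hF 0 1)]
      with ω h1 h2 hω
    rw [jumpPredKernel, integral_predKernel _ _ _ hH, h1, intensityPredKernel,
      integral_predKernel _ _ _ hH, Kernel.const_apply]
    have hsec : Measurable fun z : ℝ≥0 × ℝ => δ z.1 ω z.2 :=
      hδm.comp (measurable_toPredSpace_section 𝓕 ω)
    have hle : ∀ r : ℝ≥0, r ≤ 1 → (r : WithTop ℝ≥0) ≤ τ ω := fun r hr =>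
      (WithTop.coe_le_coe.2 hr).trans hω.le
    have hsub : {z : ℝ≥0 × ℝ | z.1 ∈ Set.Ioc 0 t ∧ ε < |δ z.1 ω z.2| ∧ |δ z.1 ω z.2| ≤ 1}
        ⊆ Set.Ioc (0 : ℝ≥0) 1 ×ˢ A := by
      rintro z ⟨⟨hz1, hz2⟩, hz3, hz4⟩
      refine ⟨⟨hz1, hz2.trans ht⟩, ?_⟩
      have := hdom ω z.1 z.2 (hle _ (hz2.trans ht))
      rw [min_eq_left hz4] at this
      change ε / 2 < ψ z.2
      linarith
    have hHeq : ∀ z : ℝ≥0 × ℝ, H (toPredSpace 𝓕 (ω, z)) =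
        {z : ℝ≥0 × ℝ | z.1 ∈ Set.Ioc s t ∧ ε < |δ z.1 ω z.2| ∧ |δ z.1 ω z.2| ≤ 1}.indicator
          (fun z => δ z.1 ω z.2) z := by
      intro z
      by_cases hz : z ∈ {z : ℝ≥0 × ℝ | z.1 ∈ Set.Ioc s t ∧ ε < |δ z.1 ω z.2| ∧ |δ z.1 ω z.2| ≤ 1}
      · have : toPredSpace 𝓕 (ω, z) ∈ V := ⟨⟨hz.1, hle _ (hz.1.2.trans ht)⟩, hz.2⟩
        simp only [H]
        rw [Set.indicator_of_mem this, Set.indicator_of_mem hz]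
        rfl
      · have : toPredSpace 𝓕 (ω, z) ∉ V := fun h => hz ⟨h.1.1, h.2⟩
        simp only [H]
        rw [Set.indicator_of_notMem this, Set.indicator_of_notMem hz]
    simp_rw [hHeq]
    rw [← setIntegral_jumps_sub hsec h2 hst hsub,
      ← setIntegral_jumps_sub hsec (prod_Ioc_lt_top hF 0 1) hst hsub]
    simp only [smallJumpSum]
    ring
  · have e : ∀ x : ℝ, ‖x‖ₑ ^ 2 = ENNReal.ofReal (x ^ 2) := fun x => by
      rw [← ofReal_norm, ← ENNReal.ofReal_pow (norm_nonneg _), Real.norm_eq_abs, sq_abs]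
    simp_rw [e]
    rw [← ofReal_integral_eq_lintegral_ofReal hL.integrable_sq (ae_of_all _ fun _ => sq_nonneg _),
      hiso]
    rw [integral_eq_lintegral_of_nonneg_ae (ae_of_all _ fun _ => sq_nonneg _)
      (by fun_prop)]
    refine ENNReal.ofReal_toReal_le.trans ?_
    rw [lintegral_bind_intensityPredKernel (by fun_prop)]
    have hb : ∀ ω (z : ℝ≥0 × ℝ), ENNReal.ofReal (H (toPredSpace 𝓕 (ω, z)) ^ 2) ≤
        (Set.Ioc s t).indicator 1 z.1 * ENNReal.ofReal (min (ψ z.2) 1 ^ 2) := by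
      intro ω z
      by_cases h : toPredSpace 𝓕 (ω, z) ∈ V
      · have hz1 : z.1 ∈ Set.Ioc s t := h.1.1
        simp only [H]
        rw [Set.indicator_of_mem h, Set.indicator_of_mem hz1, Pi.one_apply, one_mul]
        refine ENNReal.ofReal_le_ofReal ?_
        have h3 : |δ z.1 ω z.2| ≤ 1 := h.2.2
        have h4 := hdom ω z.1 z.2 h.1.2
        rw [min_eq_left h3] at h4
        change δ z.1 ω z.2 ^ 2 ≤ _
        rw [← sq_abs]
        gcongr
        exact le_min h4 h3
      · simp only [H]
        rw [Set.indicator_of_notMem h]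
        simp
    calc _ ≤ ∫⁻ _ω, (timeMeasure (Set.Ioc s t) * ∫⁻ x, ENNReal.ofReal (min (ψ x) 1 ^ 2) ∂F) ∂P := by
          refine lintegral_mono fun ω => ?_
          refine (setLIntegral_le_lintegral _ _).trans ((lintegral_mono (hb ω)).trans ?_)
          rw [lintegral_prod_mul (f := (Set.Ioc s t).indicator 1)
            (g := fun x => ENNReal.ofReal (min (ψ x) 1 ^ 2))
            (measurable_one.indicator measurableSet_Ioc).aemeasurable (by fun_prop),
            lintegral_indicator_one measurableSet_Ioc]
      _ = _ := by
          rw [lintegral_const, measure_univ, mul_one, timeMeasure_Ioc, mul_comm]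

/-- The truncated sums satisfy a second moment bound uniformly in the truncation level, and their
limit in probability inherits it. -/
lemma IsSmallJumpIntegral.locallyMeanSqLipschitz (hN : IsPoissonRandomMeasure 𝓕 P F N)
    (hδ : IsPredictableFunction 𝓕 δ) {β : ℝ} (hβ : β ∈ Set.Icc (0 : ℝ) 2)
    (hdom : IsDominated 𝓕 P F β δ) {M : ℝ≥0 → Ω → ℝ} (hM : IsSmallJumpIntegral P F N δ M) :
    LocallyMeanSqLipschitz P M := by
  obtain ⟨τ, ψ, hτ, hψ⟩ := hdom
  intro ζ hζ
  obtain ⟨k, hk⟩ := exists_measure_localizing_lt_one_le hτ hζ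
  obtain ⟨hψm, hψd, hψi⟩ := hψ k
  have hψ0 : ∀ x, 0 ≤ ψ k x := fun x => by
    obtain ⟨ω⟩ : Nonempty Ω := nonempty_of_isProbabilityMeasure P
    exact (le_min (abs_nonneg _) zero_le_one).trans (hψd ω 0 x (by
      rw [WithTop.coe_zero]; exact bot_le))
  have hC := lintegral_min_one_sq_lt_top hβ hψm hψ0 hψi
  refine ⟨_, hk, (∫⁻ x, ENNReal.ofReal (min (ψ k x) 1 ^ 2) ∂F).toNNReal, fun s t hst ht => ?_⟩
  rw [ENNReal.coe_toNNReal hC.ne]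
  choose Z hZ1 hZ2 hZ3 using fun m : ℕ => exists_smallJumpSum_approx hN hδ
    (hτ.isStoppingTime k) hψm hψd (ε := 1 / ((m : ℝ) + 1)) (by positivity)
    (measure_lt_dominating_lt_top hβ.1 hψm hψi (by positivity)) hst ht
  exact exists_dominating_of_tendstoInMeasure
    (tendstoInMeasure_sub (hM.2 t) (hM.2 s)) hZ1 hZ2 hZ3

/-! ### Large jumps -/

/-- A Poisson random measure takes integer values on predictable sets. -/
lemma ae_exists_nat_jumpPredKernel {P : Measure Ω} (hN : IsPoissonRandomMeasure 𝓕 P F N) {A : Set ℝ}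
    (hA : MeasurableSet A) (hF : F A < ∞) {R : Set (PredSpace 𝓕)} (hR : MeasurableSet R) :
    ∀ᵐ ω ∂P, ∃ k : ℕ, jumpPredKernel 𝓕 N hN.measurable A hA ω R = k := by
  have hfin := jumpPredKernel_univ_lt_top (𝓕 := 𝓕) hN.measurable hA
  have hgen : ∀ R ∈ predGenerator 𝓕,
      ∀ᵐ ω ∂P, ∃ k : ℕ, jumpPredKernel 𝓕 N hN.measurable A hA ω R = k := by
    intro R hR
    obtain ⟨s, D, B, hD, hB, hsec⟩ := exists_section_predGenerator hR A
    have hF' : F (A ∩ B) < ∞ := (measure_mono Set.inter_subset_left).trans_lt hF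
    filter_upwards [ae_jumpPredKernel_apply_of_section hN hA hF,
      hN.ae_exists_nat (measurableSet_Ioc.prod (hA.inter hB)) (prod_Ioc_lt_top hF' s 1)]
      with ω h1 h2
    rw [h1 _ (measurableSet_of_mem_predGenerator hR), hsec]
    by_cases h : ω ∈ D
    · simpa [h] using h2
    · exact ⟨0, by simp [h]⟩
  refine MeasurableSpace.induction_on_inter (C := fun R _ =>
    ∀ᵐ ω ∂P, ∃ k : ℕ, jumpPredKernel 𝓕 N hN.measurable A hA ω R = k)
    (generateFrom_predGenerator 𝓕) (isPiSystem_predGenerator 𝓕) ?_ hgen ?_ ?_ R hR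
  · exact ae_of_all _ fun ω => ⟨0, by simp⟩
  · intro R hR h
    filter_upwards [h, hgen _ (Set.mem_insert _ _)] with ω ⟨k, hk⟩ ⟨n, hn⟩
    refine ⟨n - k, ?_⟩
    rw [measure_compl hR (by rw [hk]; exact ENNReal.natCast_ne_top k), hk, hn, ENNReal.natCast_sub]
  · intro f hdisj hf h
    filter_upwards [ae_all_iff.2 h] with ω hω
    choose k hk using hω
    have hsum : jumpPredKernel 𝓕 N hN.measurable A hA ω (⋃ i, f i) = ∑' i, (k i : ℝ≥0∞) := by
      rw [measure_iUnion hdisj hf]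
      exact tsum_congr hk
    have hne : ∑' i, (k i : ℝ≥0∞) ≠ ∞ := by
      rw [← hsum]
      exact ((measure_mono (Set.subset_univ _)).trans_lt (hfin ω)).ne
    -- only finitely many terms are at least one
    have hfs : {i | k i ≠ 0}.Finite := by
      refine (ENNReal.finite_const_le_of_tsum_ne_top hne one_ne_zero).subset fun i hi => ?_
      exact_mod_cast Nat.one_le_iff_ne_zero.2 hi
    refine ⟨∑ i ∈ hfs.toFinset, k i, ?_⟩
    rw [hsum, tsum_eq_sum (s := hfs.toFinset) fun i hi => ?_]
    · push_cast; rfl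
    · simpa using hi

/-- With large probability the jumps up to time one with mark in `A` are bounded by a constant:
the compensation formula makes the expected number of jumps larger than `K` small, and this
number is an integer. -/
lemma exists_jump_bound (hN : IsPoissonRandomMeasure 𝓕 P F N)
    (hδ : IsPredictableFunction 𝓕 δ) {A : Set ℝ} (hA : MeasurableSet A) (hF : F A < ∞)
    {ζ : ℝ≥0∞} (hζ : 0 < ζ) :
    ∃ (G : Set Ω) (K : ℝ≥0), P Gᶜ ≤ ζ ∧ ∀ᵐ ω ∂P, ω ∈ G →
      ∀ᵐ z ∂((N ω).restrict (Set.Ioc 0 1 ×ˢ A)), |δ z.1 ω z.2| ≤ K := by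
  have hδm := measurable_jump_section hδ
  let R : ℕ → Set (PredSpace 𝓕) := fun K => {z | (K : ℝ) < |δ z.time z.point z.mark|}
  have hR : ∀ K, MeasurableSet (R K) := fun K => measurableSet_lt measurable_const hδm.norm
  have hfin : IsFiniteMeasure (P.bind (intensityPredKernel 𝓕 F A)) := by
    refine ⟨?_⟩
    rw [Measure.bind_apply MeasurableSet.univ (Kernel.aemeasurable _)]
    have : ∀ ω, intensityPredKernel 𝓕 F A ω Set.univ
        = (timeMeasure.prod F) (Set.Ioc 0 1 ×ˢ A) := fun ω => by
      rw [intensityPredKernel_apply_of_section MeasurableSet.univ hA]; simp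
    simp_rw [this]
    simpa using (prod_Ioc_lt_top hF 0 1)
  have h1 : Tendsto (fun K => P.bind (intensityPredKernel 𝓕 F A) (R K)) atTop (𝓝 0) := by
    have : ⋂ K, R K = ∅ := by
      refine Set.eq_empty_of_forall_notMem fun z hz => ?_
      obtain ⟨n, hn⟩ := exists_nat_gt |δ z.time z.point z.mark|
      exact absurd (Set.mem_iInter.1 hz n) (not_lt.2 hn.le)
    rw [← measure_empty (μ := P.bind (intensityPredKernel 𝓕 F A)), ← this]
    refine tendsto_measure_iInter_atTop (fun K => (hR K).nullMeasurableSet) ?_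
      ⟨0, measure_ne_top _ _⟩
    intro m n hmn z hz
    have hmn' : (m : ℝ) ≤ n := by exact_mod_cast hmn
    exact hmn'.trans_lt (show (n : ℝ) < |δ z.time z.point z.mark| from hz)
  obtain ⟨K, hK⟩ := (h1.eventually (gt_mem_nhds hζ)).exists
  rw [← bind_jumpPredKernel hN hA hF, Measure.bind_apply (hR K) (Kernel.aemeasurable _)] at hK
  refine ⟨{ω | 1 ≤ jumpPredKernel 𝓕 N hN.measurable A hA ω (R K)}ᶜ, K, ?_, ?_⟩
  · rw [compl_compl]
    have := mul_meas_ge_le_lintegral (μ := P)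
      (Kernel.measurable_coe (jumpPredKernel 𝓕 N hN.measurable A hA) (hR K)) 1
    rw [one_mul] at this
    exact this.trans hK.le
  · filter_upwards [ae_exists_nat_jumpPredKernel hN hA hF (hR K),
      ae_jumpPredKernel_apply_of_section hN hA hF] with ω ⟨k, hk⟩ h2 hω
    have h3 : jumpPredKernel 𝓕 N hN.measurable A hA ω (R K) = 0 := by
      have h4 : ¬ (1 : ℝ≥0∞) ≤ jumpPredKernel 𝓕 N hN.measurable A hA ω (R K) := hω
      rw [hk] at h4 ⊢
      have : ¬ 1 ≤ k := fun h => h4 (by exact_mod_cast h)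
      simp [Nat.lt_one_iff.1 (not_le.1 this)]
    rw [h2 _ (hR K)] at h3
    rw [ae_iff, Measure.restrict_apply' (measurableSet_Ioc.prod hA)]
    convert h3 using 3
    ext z
    simp [R, toPredSpace]

/-- With large probability, increments of the sum of large jumps are bounded by a multiple of the
number of points of the Poisson random measure. -/
lemma exists_bigJumps_bound (hN : IsPoissonRandomMeasure 𝓕 P F N)
    (hδ : IsPredictableFunction 𝓕 δ) {β : ℝ} (hβ : β ∈ Set.Icc (0 : ℝ) 2)
    (hdom : IsDominated 𝓕 P F β δ) {ζ : ℝ≥0∞} (hζ : 0 < ζ) :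
    ∃ (G : Set Ω) (K : ℝ≥0) (A : Set ℝ), P Gᶜ ≤ ζ ∧ MeasurableSet A ∧ F A < ∞ ∧
      ∀ᵐ ω ∂P, ω ∈ G → ∀ s t, s ≤ t → t ≤ 1 →
        ‖bigJumps N δ t ω - bigJumps N δ s ω‖ₑ ≤ K * N ω (Set.Ioc s t ×ˢ A) := by
  obtain ⟨τ, ψ, hτ, hψ⟩ := hdom
  obtain ⟨k, hk⟩ := exists_measure_localizing_lt_one_le hτ (ENNReal.half_pos hζ.ne')
  obtain ⟨hψm, hψd, hψi⟩ := hψ k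
  have hA : MeasurableSet {x | 1 / 2 < ψ k x} := measurableSet_lt measurable_const hψm
  have hF : F {x | 1 / 2 < ψ k x} < ∞ :=
    measure_lt_dominating_lt_top hβ.1 hψm hψi (by norm_num)
  obtain ⟨G, K, hG, hGK⟩ := exists_jump_bound hN hδ hA hF (ENNReal.half_pos hζ.ne')
  refine ⟨_ ∩ G, K, _, measure_compl_inter_le hk hG, hA, hF, ?_⟩
  set A := {x | 1 / 2 < ψ k x} with hAdef
  have hS : MeasurableSet (Set.Ioc (0 : ℝ≥0) 1 ×ˢ A) := measurableSet_Ioc.prod hA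
  filter_upwards [hGK, hN.ae_lt_top hS (prod_Ioc_lt_top hF 0 1)] with ω h1 h2 hω s t hst ht
  have h3 := h1 hω.2
  have hsec : Measurable fun z : ℝ≥0 × ℝ => δ z.1 ω z.2 :=
    (measurable_jump_section hδ).comp (measurable_toPredSpace_section 𝓕 ω)
  have hU : MeasurableSet {z : ℝ≥0 × ℝ | 1 < |δ z.1 ω z.2|} :=
    measurableSet_lt measurable_const hsec.norm
  have hsub : ∀ r r' : ℝ≥0, r' ≤ 1 →
      {z : ℝ≥0 × ℝ | z.1 ∈ Set.Ioc r r' ∧ 1 < |δ z.1 ω z.2|} ⊆ Set.Ioc r r' ×ˢ A := by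
    rintro r r' hr' z ⟨hz1, hz2⟩
    refine ⟨hz1, ?_⟩
    have := hψd ω z.1 z.2 ((WithTop.coe_le_coe.2 (hz1.2.trans hr')).trans (le_of_lt hω.1))
    rw [min_eq_right hz2.le] at this
    change 1 / 2 < ψ k z.2
    linarith
  have hsubS : ∀ r r' : ℝ≥0, r' ≤ 1 → Set.Ioc r r' ×ˢ A ⊆ Set.Ioc (0 : ℝ≥0) 1 ×ˢ A :=
    fun r r' hr' z hz => ⟨⟨zero_le.trans_lt hz.1.1, hz.1.2.trans hr'⟩, hz.2⟩
  have hb : ∀ r r' : ℝ≥0, r' ≤ 1 →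
      ∀ᵐ z ∂((N ω).restrict {z : ℝ≥0 × ℝ | z.1 ∈ Set.Ioc r r' ∧ 1 < |δ z.1 ω z.2|}),
        ‖δ z.1 ω z.2‖ ≤ K := fun r r' hr' =>
    ae_restrict_of_ae_restrict_of_subset ((hsub r r' hr').trans (hsubS r r' hr')) h3
  have hint : IntegrableOn (fun z : ℝ≥0 × ℝ => δ z.1 ω z.2)
      {z : ℝ≥0 × ℝ | z.1 ∈ Set.Ioc 0 t ∧ 1 < |δ z.1 ω z.2|} (N ω) :=
    Measure.integrableOn_of_bounded
      ((measure_mono ((hsub 0 t ht).trans (hsubS 0 t ht))).trans_lt h2).ne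
      hsec.aestronglyMeasurable (hb 0 t ht)
  have heq : bigJumps N δ t ω - bigJumps N δ s ω =
      ∫ z in {z : ℝ≥0 × ℝ | z.1 ∈ Set.Ioc s t ∧ 1 < |δ z.1 ω z.2|}, δ z.1 ω z.2 ∂(N ω) :=
    setIntegral_Ioc_sub hU hst hint
  rw [heq]
  refine (enorm_integral_le_lintegral_enorm _).trans ?_
  calc _ ≤ ∫⁻ _z in {z : ℝ≥0 × ℝ | z.1 ∈ Set.Ioc s t ∧ 1 < |δ z.1 ω z.2|}, (K : ℝ≥0∞) ∂(N ω) := by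
        refine lintegral_mono_ae ?_
        filter_upwards [hb s t ht] with z hz
        rw [← ofReal_norm]
        exact (ENNReal.ofReal_le_ofReal hz).trans (by simp)
    _ ≤ _ := by
        rw [setLIntegral_const]
        gcongr
        exact hsub s t ht

/-- The second moment of the number of points in `(s, t] × A` is `O(t - s)`, as this number has a
Poisson law. -/
lemma bigJumps_locallyMeanSqLipschitz (hN : IsPoissonRandomMeasure 𝓕 P F N)
    (hδ : IsPredictableFunction 𝓕 δ) {β : ℝ} (hβ : β ∈ Set.Icc (0 : ℝ) 2)
    (hdom : IsDominated 𝓕 P F β δ) : LocallyMeanSqLipschitz P (bigJumps N δ) := by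
  intro ζ hζ
  obtain ⟨G, K, A, hG, hA, hF, hb⟩ := exists_bigJumps_bound hN hδ hβ hdom hζ
  refine ⟨G, hG, K ^ 2 * ((F A).toNNReal + (F A).toNNReal ^ 2), fun s t hst ht =>
    ⟨fun ω => (K * N ω (Set.Ioc s t ×ˢ A)) ^ 2, ?_, ?_, ?_⟩⟩
  · exact ((hN.measurable_apply (measurableSet_Ioc.prod hA)).const_mul _).pow_const 2
  · filter_upwards [hb] with ω h hω
    gcongr
    exact h hω s t hst ht
  · have mT : MeasurableSet (Set.Ioc s t ×ˢ A) := measurableSet_Ioc.prod hA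
    have fT := prod_Ioc_lt_top hF s t
    have hval : (timeMeasure.prod F) (Set.Ioc s t ×ˢ A) = ((t - s) * (F A).toNNReal : ℝ≥0) := by
      rw [Measure.prod_prod, timeMeasure_Ioc, ENNReal.coe_mul, ENNReal.coe_toNNReal hF.ne]
    have h1 : ∫⁻ ω, N ω (Set.Ioc s t ×ˢ A) ^ 2 ∂P ≤
        ((t - s) * (F A).toNNReal + ((t - s) * (F A).toNNReal) ^ 2 : ℝ≥0) := by
      have h2 := lintegral_enorm_sq_le (hN.memLp_toReal mT fT)
        (c := (t - s) * (F A).toNNReal + ((t - s) * (F A).toNNReal) ^ 2) (by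
          rw [hN.integral_toReal_sq mT fT, hval, ENNReal.coe_toReal]
          push_cast
          exact le_rfl)
      refine le_trans (le_of_eq (lintegral_congr_ae ?_)) h2
      filter_upwards [hN.ae_lt_top mT fT] with ω hω
      rw [← ofReal_norm, Real.norm_of_nonneg ENNReal.toReal_nonneg, ENNReal.ofReal_toReal hω.ne]
    simp_rw [mul_pow]
    rw [lintegral_const_mul _ ((hN.measurable_apply mT).pow_const 2)]
    calc _ ≤ (K : ℝ≥0∞) ^ 2 *
          ((t - s) * (F A).toNNReal + ((t - s) * (F A).toNNReal) ^ 2 : ℝ≥0) := by gcongr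
      _ ≤ _ := by
        rw [← ENNReal.coe_pow, ← ENNReal.coe_mul, ← ENNReal.coe_mul, ENNReal.coe_le_coe]
        have h3 : t - s ≤ 1 := tsub_le_self.trans ht
        have h4 : (t - s) ^ 2 ≤ t - s := by rw [sq]; exact mul_le_of_le_one_left zero_le h3
        calc K ^ 2 * ((t - s) * (F A).toNNReal + ((t - s) * (F A).toNNReal) ^ 2)
            = K ^ 2 * ((t - s) * (F A).toNNReal + (t - s) ^ 2 * (F A).toNNReal ^ 2) := by ring
          _ ≤ K ^ 2 * ((t - s) * (F A).toNNReal + (t - s) * (F A).toNNReal ^ 2) := by gcongr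
          _ = _ := by ring

end

/-! ### Regularity of the price and of the noise volatility -/

/-- A property that holds on events of probability arbitrarily close to one holds almost surely. -/
lemma ae_of_forall_exists_event {P : Measure Ω} {Q : Ω → Prop}
    (h : ∀ ζ : ℝ≥0∞, 0 < ζ → ∃ G : Set Ω, P Gᶜ ≤ ζ ∧ ∀ᵐ ω ∂P, ω ∈ G → Q ω) : ∀ᵐ ω ∂P, Q ω := by
  rw [ae_iff]
  refine le_antisymm (le_of_forall_pos_le_add fun ζ hζ => ?_) zero_le
  obtain ⟨G, hG, hQ⟩ := h ζ hζ
  rw [zero_add]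
  refine (measure_mono_ae ?_).trans hG
  filter_upwards [hQ] with ω hω hQω
  exact fun hg => hQω (hω hg)

/-- Boundedness on `[0, 1]` of the increments of a path from its starting point. -/
def HasBoundedIncrements (f : ℝ≥0 → ℝ) : Prop :=
  ∃ L : ℝ≥0, ∀ t ≤ 1, ‖f t - f 0‖ₑ ≤ L

lemma HasBoundedIncrements.add {f g : ℝ≥0 → ℝ} (hf : HasBoundedIncrements f)
    (hg : HasBoundedIncrements g) : HasBoundedIncrements fun t => f t + g t := by
  obtain ⟨L, hL⟩ := hf
  obtain ⟨M, hM⟩ := hg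
  refine ⟨L + M, fun t ht => ?_⟩
  rw [add_sub_add_comm]
  refine (enorm_add_le _ _).trans ?_
  push_cast
  exact add_le_add (hL t ht) (hM t ht)

lemma IsCadlag.hasBoundedIncrements {f : ℝ≥0 → ℝ} (hf : IsCadlag f) : HasBoundedIncrements f := by
  obtain ⟨K, hK⟩ := hf.exists_bound 1
  refine ⟨K + K, fun t ht => (enorm_sub_le).trans ?_⟩
  push_cast
  exact add_le_add (hK t ht) (hK 0 zero_le)

lemma isCadlag_of_continuous {f : ℝ≥0 → ℝ} (hf : Continuous f) : IsCadlag f := fun t =>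
  ⟨hf.continuousWithinAt, f t, hf.continuousWithinAt⟩

lemma HasBoundedIncrements.gridSup_lt_top {Ω : Type*} {X : ℝ≥0 → Ω → ℝ} {ω : Ω}
    (h : HasBoundedIncrements (X · ω)) : gridSup X ω < ∞ := by
  obtain ⟨L, hL⟩ := h
  refine NoisyPrice.gridSup_lt_top (K := L + ‖X 0 ω‖₊) fun t ht => ?_
  have : X t ω = (X t ω - X 0 ω) + X 0 ω := by ring
  rw [this]
  refine (enorm_add_le _ _).trans ?_
  push_cast
  exact add_le_add (hL t ht) le_rfl

/-- For a process of measurable random variables the localising event can be chosen measurable and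
such that the process is bounded at the rational times of `[0, 1]`. -/
lemma LocallyMeanSqLipschitz.exists_event {P : Measure Ω} [IsProbabilityMeasure P]
    {X : ℝ≥0 → Ω → ℝ} (hX : LocallyMeanSqLipschitz P X) (hm : ∀ t, Measurable (X t))
    (hb : ∀ᵐ ω ∂P, HasBoundedIncrements (X · ω)) {ζ : ℝ≥0∞} (hζ : 0 < ζ) :
    ∃ G : Set Ω, MeasurableSet G ∧ P Gᶜ ≤ ζ ∧ ∃ K C : ℝ≥0,
      (∀ ω ∈ G, ∀ i n : ℕ, i ≤ n → |X ((i : ℝ≥0) / n) ω| ≤ K) ∧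
      ∀ s t : ℝ≥0, s ≤ t → t ≤ 1 →
        ∫⁻ ω in G, ‖X t ω - X s ω‖ₑ ^ 2 ∂P ≤ C * (t - s : ℝ≥0) := by
  obtain ⟨G₀, hG₀, C, hC⟩ := hX (ζ / 2) (ENNReal.half_pos hζ.ne')
  obtain ⟨K, hK⟩ := exists_measure_not_le_le (measurable_gridSup hm) (P := P)
    (by filter_upwards [hb] with ω hω; exact hω.gridSup_lt_top) (ENNReal.half_pos hζ.ne')
  have hKm : MeasurableSet {ω | gridSup X ω ≤ K} :=
    measurableSet_le (measurable_gridSup hm) measurable_const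
  -- the localising event is shrunk to a measurable one of the same probability bound
  refine ⟨(toMeasurable P G₀ᶜ)ᶜ ∩ {ω | gridSup X ω ≤ K},
    (measurableSet_toMeasurable _ _).compl.inter hKm, measure_compl_inter_le ?_ hK, K, C, ?_, ?_⟩
  · rw [compl_compl, measure_toMeasurable]; exact hG₀
  · rintro ω ⟨-, hω⟩ i n hin
    have h2 := (le_gridSup X ω hin).trans hω
    rw [← ofReal_norm] at h2
    simpa [ENNReal.toReal_ofReal] using ENNReal.toReal_mono ENNReal.coe_ne_top h2
  · intro s t hst ht
    obtain ⟨f, hf, hf1, hf2⟩ := hC s t hst ht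
    refine le_trans ?_ hf2
    refine le_trans (lintegral_mono_ae ?_) (setLIntegral_le_lintegral
      ((toMeasurable P G₀ᶜ)ᶜ ∩ {ω | gridSup X ω ≤ K}) f)
    refine (ae_restrict_iff' ((measurableSet_toMeasurable _ _).compl.inter hKm)).2 ?_
    filter_upwards [hf1] with ω h hω
    refine h ?_
    by_contra hcon
    exact hω.1 (subset_toMeasurable P G₀ᶜ hcon)

lemma hasBoundedIncrements_of_lipschitz {f : ℝ≥0 → ℝ} {K : ℝ≥0}
    (h : ∀ s t, s ≤ t → t ≤ 1 → ‖f t - f s‖ₑ ≤ K * (t - s : ℝ≥0)) : HasBoundedIncrements f := by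
  refine ⟨K, fun t ht => (h 0 t zero_le ht).trans ?_⟩
  rw [← ENNReal.coe_mul, ENNReal.coe_le_coe]
  exact mul_le_of_le_one_right zero_le (by simpa using ht)

section

variable {𝓕 : Filtration ℝ≥0 mΩ} {P : Measure Ω} [IsProbabilityMeasure P] {W B : ℝ≥0 → Ω → ℝ}

/-- Continuity of the paths on `[0, 1]` is used for the noise volatility, whose squared path has to
be approximated by Riemann sums. -/
lemma HasItoForm.regularity (hW : IsBrownianWrt 𝓕 P W) (hB : IsBrownianWrt 𝓕 P B)
    {X : ℝ≥0 → Ω → ℝ} (hX : HasItoForm 𝓕 P W B X) :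
    LocallyMeanSqLipschitz P X ∧ ∀ᵐ ω ∂P, ContinuousOn (X · ω) (Set.Iic 1) := by
  obtain ⟨-, a, b, v, ha, hb, hv, I, J, hI, hJ, hdec⟩ := hX
  constructor
  · refine ((locallyMeanSqLipschitz_of_lipschitz
      fun ζ hζ => ha.exists_timeIntegral_lipschitz hζ).add
      ((hI.locallyMeanSqLipschitz hW hb).add (hJ.locallyMeanSqLipschitz hB hv))).congr ?_
    filter_upwards [hdec] with ω h s t
    rw [h s, h t]; ring
  · have hA : ∀ᵐ ω ∂P, ContinuousOn (fun t => timeIntegral a t ω) (Set.Iic 1) := by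
      refine ae_of_forall_exists_event fun ζ hζ => ?_
      obtain ⟨G, hG, K, hK⟩ := ha.exists_timeIntegral_lipschitz hζ
      refine ⟨G, hG, ?_⟩
      filter_upwards [hK] with ω h hω
      refine LipschitzOnWith.continuousOn (K := K) fun s hs t ht => ?_
      have key : ∀ s t : ℝ≥0, s ≤ t → t ≤ 1 →
          edist (timeIntegral a t ω) (timeIntegral a s ω) ≤ K * edist t s := by
        intro s t hst ht
        refine (edist_eq_enorm_sub _ _).trans_le ((h hω s t hst ht).trans ?_)
        gcongr
        rw [edist_nndist, ENNReal.coe_le_coe, ← NNReal.coe_le_coe, coe_nndist, NNReal.dist_eq,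
          NNReal.coe_sub hst]
        exact le_abs_self _
      rcases le_total s t with hst | hst
      · rw [edist_comm, edist_comm s]
        exact key s t hst ht
      · exact key t s hst hs
    filter_upwards [hdec, hA, hI.1, hJ.1] with ω h1 h2 h3 h4
    have : (X · ω) = fun t => X 0 ω + timeIntegral a t ω + I t ω + J t ω := funext h1
    rw [this]
    exact ((continuousOn_const.add h2).add h3.continuousOn).add h4.continuousOn

lemma hasBoundedIncrements_of_continuousOn {f : ℝ≥0 → ℝ} (hf : ContinuousOn f (Set.Iic 1)) :
    HasBoundedIncrements f := by
  have hc : IsCompact (Set.Iic (1 : ℝ≥0)) := by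
    rw [← Set.Icc_bot]; exact isCompact_Icc
  obtain ⟨K, hK⟩ := hc.exists_bound_of_continuousOn hf
  refine ⟨(K + K).toNNReal, fun t ht => ?_⟩
  rw [← ofReal_norm]
  refine ENNReal.ofReal_le_ofReal ((norm_sub_le _ _).trans ?_)
  exact add_le_add (hK t ht) (hK 0 (Set.mem_Iic.2 zero_le))

variable {F : Measure ℝ} [SigmaFinite F] {N : Ω → Measure (ℝ≥0 × ℝ)}

/-- Each of the four terms of the price is mean-square Lipschitz up to localisation, and has bounded
paths on `[0, 1]`. -/
lemma IsLogPrice.regularity (hW : IsBrownianWrt 𝓕 P W) (hN : IsPoissonRandomMeasure 𝓕 P F N)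
    {β : ℝ} (hβ : β ∈ Set.Icc (0 : ℝ) 2) {a σ : ℝ≥0 → Ω → ℝ} {δ : ℝ≥0 → Ω → ℝ → ℝ}
    {p : ℝ≥0 → Ω → ℝ} (hp : IsLogPrice 𝓕 P W F N β a σ δ p) :
    LocallyMeanSqLipschitz P p ∧ ∀ᵐ ω ∂P, HasBoundedIncrements (p · ω) := by
  obtain ⟨I, M, hI, hM, hdec⟩ := hp.decomposition
  have hA := fun (ζ : ℝ≥0∞) (hζ : 0 < ζ) =>
    hp.drift_locallyBounded.exists_timeIntegral_lipschitz hp.drift_predictable hζ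
  constructor
  · refine (((locallyMeanSqLipschitz_of_lipschitz hA).add
      (hI.locallyMeanSqLipschitz hW hp.vol)).add
      ((hM.locallyMeanSqLipschitz hN hp.jump_predictable hβ hp.jump_dominated).add
      (bigJumps_locallyMeanSqLipschitz hN hp.jump_predictable hβ hp.jump_dominated))).congr ?_
    filter_upwards [hdec] with ω h s t
    rw [h s, h t]; ring
  · have h1 : ∀ᵐ ω ∂P, HasBoundedIncrements fun t => timeIntegral a t ω := by
      refine ae_of_forall_exists_event fun ζ hζ => ?_
      obtain ⟨G, hG, K, hK⟩ := hA ζ hζ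
      refine ⟨G, hG, ?_⟩
      filter_upwards [hK] with ω h hω
      exact hasBoundedIncrements_of_lipschitz (h hω)
    have h2 : ∀ᵐ ω ∂P, HasBoundedIncrements fun t => bigJumps N δ t ω := by
      refine ae_of_forall_exists_event fun ζ hζ => ?_
      obtain ⟨G, K, A, hG, hAm, hF, hb⟩ := exists_bigJumps_bound hN hp.jump_predictable hβ
        hp.jump_dominated hζ
      refine ⟨G, hG, ?_⟩
      filter_upwards [hb, hN.ae_lt_top (measurableSet_Ioc.prod hAm) (prod_Ioc_lt_top hF 0 1)]
        with ω h hfin hω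
      refine ⟨K * (N ω (Set.Ioc 0 1 ×ˢ A)).toNNReal, fun t ht => (h hω 0 t zero_le ht).trans ?_⟩
      rw [ENNReal.coe_mul, ENNReal.coe_toNNReal hfin.ne]
      gcongr
    filter_upwards [hdec, h1, h2, hI.1, hM.1] with ω hd b1 b2 b3 b4
    obtain ⟨L, hL⟩ := (b1.add (isCadlag_of_continuous b3).hasBoundedIncrements).add
      (b4.hasBoundedIncrements.add b2)
    refine ⟨L, fun t ht => ?_⟩
    have := hL t ht
    rwa [show p t ω - p 0 ω = timeIntegral a t ω + I t ω + (M t ω + bigJumps N δ t ω)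
      - (timeIntegral a 0 ω + I 0 ω + (M 0 ω + bigJumps N δ 0 ω)) by linarith [hd t, hd 0]]

end

/-! ### The moving average as a stationary, finitely dependent sequence -/

/-- A centred, `q`-dependent sequence with covariances `ρ` that is bounded in `L⁴` by `M`. -/
structure IsFinitelyDependent (P : Measure Ω) (q : ℕ) (ρ : ℕ → ℝ) (M : ℝ≥0)
    (π : ℕ → Ω → ℝ) : Prop where
  measurable : ∀ i, Measurable (π i)
  eLpNorm_le : ∀ i, eLpNorm (π i) 4 P ≤ M
  mean : ∀ i, ∫ ω, π i ω ∂P = 0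
  cov : ∀ i m, ∫ ω, π i ω * π (i + m) ω ∂P = ρ m
  indep : ∀ a : ℕ, Indep (⨆ j ∈ Set.Iic a, MeasurableSpace.comap (π j) inferInstance)
    (⨆ j ∈ Set.Ioi (a + q), MeasurableSpace.comap (π j) inferInstance) P

section

variable {P : Measure Ω} {u : ℤ → Ω → ℝ}

/-- An i.i.d. sequence indexed by `ℤ` is stationary. -/
lemma identDistrib_shift (hm : ∀ i, Measurable (u i)) (hu : iIndepFun u P)
    (hid : ∀ i, IdentDistrib (u i) (u 0) P P) (i : ℤ) :
    IdentDistrib (fun ω k => u (k + i) ω) (fun ω k => u k ω) P P := by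
  have h1 : iIndepFun (fun k => u (k + i)) P := hu.precomp (add_left_injective i)
  refine ⟨(measurable_pi_iff.2 fun k => hm _).aemeasurable,
    (measurable_pi_iff.2 fun k => hm _).aemeasurable, ?_⟩
  rw [h1.map_fun_eq_infinitePi_map fun k => hm _, hu.map_fun_eq_infinitePi_map hm]
  congr 1
  funext k
  rw [(hid (k + i)).map_eq, (hid k).map_eq]

/-- The moving average at time `i` is a function of the innovations at the times `i - q, …, i`. -/
lemma measurable_movingAverage {Ω : Type*} {u : ℤ → Ω → ℝ} {m : MeasurableSpace Ω} {q : ℕ} {θ : ℕ → ℝ} {i : ℤ}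
    (h : ∀ k : ℤ, i - q ≤ k → k ≤ i → Measurable[m] (u k)) :
    Measurable[m] (movingAverage q θ u i) := by
  refine (h i (by omega) le_rfl).add (Finset.measurable_sum _ fun j hj => ?_)
  rw [Finset.mem_Icc] at hj
  exact (h _ (by omega) (by omega)).const_mul _

/-- Stationarity and finite dependence of the noise follow from those of the i.i.d. innovations. -/
lemma IsNoise.isFinitelyDependent {𝓕 : Filtration ℝ≥0 mΩ} {W B p w : ℝ≥0 → Ω → ℝ} {q : ℕ}
    {θ : ℕ → ℝ} (hn : IsNoise 𝓕 P W B p w q θ u) :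
    ∃ M, IsFinitelyDependent P q (autocov P q θ u) M fun i => movingAverage q θ u i := by
  have hm : ∀ i : ℤ, Measurable (movingAverage q θ u i) := fun i =>
    measurable_movingAverage fun k _ _ => hn.measurable k
  have hshift := identDistrib_shift hn.measurable hn.indep hn.ident
  have hg : ∀ m : ℤ, Measurable fun x : ℤ → ℝ => x m + ∑ j ∈ Finset.Icc 1 q, θ j * x (m - j) := by
    intro m; fun_prop
  have hid : ∀ i : ℤ, IdentDistrib (movingAverage q θ u i) (movingAverage q θ u 0) P P := by
    intro i
    convert (hshift i).comp (hg 0) using 1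
    · funext ω
      simp only [movingAverage, Function.comp_apply, zero_add]
      congr 1
      exact Finset.sum_congr rfl fun j _ => by congr 3; ring
    · rfl
  have hu0 : ∀ i, Integrable (u i) P ∧ ∫ ω, u i ω ∂P = 0 := fun i =>
    ⟨(hn.ident i).integrable_iff.2 hn.integrable, (hn.ident i).integral_eq.trans hn.mean_zero⟩
  have h4 : MemLp (movingAverage q θ u 0) 4 P := by simpa using hn.moments 4
  refine ⟨(eLpNorm (movingAverage q θ u 0) 4 P).toNNReal, fun i => hm i, fun i => ?_, fun i => ?_,
    fun i m => ?_, fun a => ?_⟩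
  · rw [ENNReal.coe_toNNReal h4.eLpNorm_ne_top, (hid i).eLpNorm_eq]
  · simp only [movingAverage]
    rw [integral_add (hu0 _).1 (integrable_finsetSum _ fun j _ => (hu0 _).1.const_mul _),
      integral_finsetSum _ fun j _ => (hu0 _).1.const_mul _, (hu0 _).2]
    simp [integral_const_mul, (hu0 _).2]
  · have := ((hshift i).comp ((hg 0).mul (hg m))).integral_eq
    refine Eq.trans (integral_congr_ae (.of_forall fun ω => ?_)) this
    simp only [movingAverage, Function.comp_apply, Pi.mul_apply, zero_add]
    congr 2
    · exact Finset.sum_congr rfl fun j _ => by congr 3; ring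
    · push_cast; congr 1; ring
    · exact Finset.sum_congr rfl fun j _ => by congr 3; push_cast; ring
  · have key := indep_iSup_of_disjoint (fun k => (hn.measurable k).comap_le)
      ((iIndepFun_iff_iIndep _ _ _).1 hn.indep) (S := Set.Iic (a : ℤ)) (T := Set.Ioi (a : ℤ))
      (Set.Iic_disjoint_Ioi le_rfl)
    refine indep_of_indep_of_le_left (indep_of_indep_of_le_right key ?_) ?_
    · refine iSup₂_le fun j hj => (measurable_movingAverage fun k hk _ => ?_).comap_le
      have hk' : k ∈ Set.Ioi (a : ℤ) := by
        rw [Set.mem_Ioi] at hj ⊢; omega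
      exact measurable_iff_comap_le.2 (le_iSup₂_of_le k hk' le_rfl)
    · refine iSup₂_le fun j hj => (measurable_movingAverage fun k _ hk => ?_).comap_le
      have hk' : k ∈ Set.Iic (a : ℤ) := by
        rw [Set.mem_Iic] at hj ⊢; omega
      exact measurable_iff_comap_le.2 (le_iSup₂_of_le k hk' le_rfl)

end

namespace IsFinitelyDependent

variable {P : Measure Ω} {q : ℕ} {ρ : ℕ → ℝ} {M : ℝ≥0} {π : ℕ → Ω → ℝ}

lemma memLp (hπ : IsFinitelyDependent P q ρ M π) (i : ℕ) : MemLp (π i) 4 P :=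
  ⟨(hπ.measurable i).aestronglyMeasurable, (hπ.eLpNorm_le i).trans_lt ENNReal.coe_lt_top⟩

lemma indepFun (hπ : IsFinitelyDependent P q ρ M π) {a : ℕ} {X Y : Ω → ℝ}
    (hX : Measurable[⨆ j ∈ Set.Iic a, MeasurableSpace.comap (π j) inferInstance] X)
    (hY : Measurable[⨆ j ∈ Set.Ioi (a + q), MeasurableSpace.comap (π j) inferInstance] Y) :
    IndepFun X Y P := by
  rw [IndepFun_iff_Indep]
  exact indep_of_indep_of_le_left (indep_of_indep_of_le_right (hπ.indep a) hY.comap_le)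
    hX.comap_le

lemma measurable_iSup_comap {Ω : Type*} {π : ℕ → Ω → ℝ} {S : Set ℕ} {j : ℕ} (hj : j ∈ S) :
    Measurable[⨆ j ∈ S, MeasurableSpace.comap (π j) inferInstance] (π j) :=
  measurable_iff_comap_le.2 (le_iSup₂_of_le j hj le_rfl)

lemma integral_mul_eq_zero (hπ : IsFinitelyDependent P q ρ M π) {i j : ℕ} (h : i + q < j) :
    ∫ ω, π i ω * π j ω ∂P = 0 := by
  have := (hπ.indepFun (a := i) (measurable_iSup_comap (Set.mem_Iic.2 le_rfl))
    (measurable_iSup_comap (Set.mem_Ioi.2 h))).integral_fun_mul_eq_mul_integral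
    (hπ.measurable i).aestronglyMeasurable (hπ.measurable j).aestronglyMeasurable
  rw [this, hπ.mean, zero_mul]

lemma cov_eq_zero (hπ : IsFinitelyDependent P q ρ M π) {m : ℕ} (h : q < m) : ρ m = 0 := by
  rw [← hπ.cov 0 m]
  exact hπ.integral_mul_eq_zero (by omega)

lemma integral_mul_noise_eq_zero (hπ : IsFinitelyDependent P q ρ M π) (b : ℕ → ℝ) {i j : ℕ}
    (h : i + q < j ∨ j + q < i) : ∫ ω, (b i * π i ω) * (b j * π j ω) ∂P = 0 := by
  have h1 : ∫ ω, π i ω * π j ω ∂P = 0 := by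
    rcases h with h | h
    · exact hπ.integral_mul_eq_zero h
    · simp_rw [mul_comm (π i _)]
      exact hπ.integral_mul_eq_zero h
  have h2 : ∀ ω, (b i * π i ω) * (b j * π j ω) = (b i * b j) * (π i ω * π j ω) := fun ω => by ring
  simp_rw [h2]
  rw [integral_const_mul, h1, mul_zero]

end IsFinitelyDependent

/-! ### The estimator as an average over blocks -/

/-- The weight of the `m`-th autocovariance in a long-run variance. -/
def lagWeight (m : ℕ) : ℝ := if m = 0 then 1 else 2

/-- The contribution to the estimator of the block of observations starting at `i`. -/
noncomputable def blockTerm (x : ℕ → ℝ) (h l i : ℕ) : ℝ :=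
  ∑ m ∈ Finset.range (l + 1), lagWeight m *
    ((x i - localMean x h (i + 2 * h)) * (x (i + m) - localMean x h (i + 4 * h)))

lemma sum_lagWeight_mul (f : ℕ → ℝ) (l : ℕ) :
    ∑ m ∈ Finset.range (l + 1), lagWeight m * f m = f 0 + 2 * ∑ m ∈ Finset.Icc 1 l, f m := by
  induction l with
  | zero => simp [lagWeight]
  | succ l ih =>
    rw [Finset.sum_range_succ, ih, Finset.sum_Icc_succ_top (by omega), lagWeight,
      if_neg l.succ_ne_zero]
    ring

/-- The estimator is an average over blocks of `5 h + 1` consecutive observations. -/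
lemma noiseVarEst_eq (x : ℕ → ℝ) (n h l : ℕ) :
    noiseVarEst x n h l = 1 / ((n : ℝ) - 5 * h + 1) *
      ∑ i ∈ Finset.range (n - 5 * h + 1), blockTerm x h l i := by
  rw [noiseVarEst, ← sum_lagWeight_mul (fun m => sampleAutocov x n h m)]
  simp only [sampleAutocov, blockTerm]
  rw [Finset.sum_comm, Finset.mul_sum]
  refine Finset.sum_congr rfl fun m _ => ?_
  rw [← Finset.mul_sum]
  ring

/-- Lags beyond the order of the moving average do not contribute to the long-run variance. -/
lemma longRunVar_eq_sum {P : Measure Ω} {q : ℕ} {θ : ℕ → ℝ} {u : ℤ → Ω → ℝ} {l : ℕ} (hl : q ≤ l)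
    (h0 : ∀ m, q < m → autocov P q θ u m = 0) :
    ∑ m ∈ Finset.range (l + 1), lagWeight m * autocov P q θ u m = longRunVar P q θ u := by
  rw [longRunVar, ← sum_lagWeight_mul (autocov P q θ u)]
  symm
  refine Finset.sum_subset (Finset.range_subset_range.2 (by omega)) fun m _ hm => ?_
  rw [h0 m (by rw [Finset.mem_range] at hm; omega), mul_zero]

lemma localMean_add (x y : ℕ → ℝ) (h i : ℕ) :
    localMean (fun j => x j + y j) h i = localMean x h i + localMean y h i := by
  simp only [localMean, Finset.sum_add_distrib]; ring

/-! ### Variance of sums of finitely dependent variables -/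

section Variance

variable {P : Measure Ω} [IsProbabilityMeasure P]

lemma covariance_le_of_variance_le {X Y : Ω → ℝ} (hX : MemLp X 2 P) (hY : MemLp Y 2 P) {V : ℝ}
    (hXV : Var[X; P] ≤ V) (hYV : Var[Y; P] ≤ V) : cov[X, Y; P] ≤ V := by
  have hX' := hX.sub (memLp_const (∫ ω, X ω ∂P))
  have hY' := hY.sub (memLp_const (∫ ω, Y ω ∂P))
  have h1 : cov[X, Y; P] ≤ (Var[X; P] + Var[Y; P]) / 2 := by
    rw [covariance, variance_eq_integral hX.aemeasurable, variance_eq_integral hY.aemeasurable,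
      ← integral_add (by exact hX'.integrable_sq) (by exact hY'.integrable_sq), ← integral_div]
    refine integral_mono (by exact hX'.integrable_mul hY')
      ((hX'.integrable_sq.add hY'.integrable_sq).div_const 2) fun ω => ?_
    have := sq_nonneg ((X ω - ∫ ω, X ω ∂P) - (Y ω - ∫ ω, Y ω ∂P))
    dsimp only [Pi.sub_apply, Pi.add_apply]
    linarith
  linarith

/-- The variance of a sum of `N` variables that are independent at distances larger than `L`
grows like `N L`. -/
lemma variance_sum_le_of_indepFun {Y : ℕ → Ω → ℝ} {N L : ℕ} {V : ℝ}
    (hY : ∀ i < N, MemLp (Y i) 2 P) (hV : ∀ i < N, Var[Y i; P] ≤ V)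
    (hind : ∀ i k, i < N → k < N → i + L < k → IndepFun (Y i) (Y k) P) :
    Var[fun ω => ∑ i ∈ Finset.range N, Y i ω; P] ≤ N * ((2 * L + 1) * V) := by
  rw [variance_fun_sum' fun i hi => hY i (Finset.mem_range.1 hi)]
  have key : ∀ i ∈ Finset.range N,
      ∑ k ∈ Finset.range N, cov[Y i, Y k; P] ≤ (2 * L + 1) * V := by
    intro i hi
    have hi' := Finset.mem_range.1 hi
    have hV0 : 0 ≤ V := (variance_nonneg _ _).trans (hV i hi')
    calc ∑ k ∈ Finset.range N, cov[Y i, Y k; P]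
        ≤ ∑ k ∈ Finset.range N, if k ∈ Finset.Icc (i - L) (i + L) then V else 0 := by
          refine Finset.sum_le_sum fun k hk => ?_
          have hk' := Finset.mem_range.1 hk
          split_ifs with hc
          · exact covariance_le_of_variance_le (hY i hi') (hY k hk') (hV i hi') (hV k hk')
          · rw [Finset.mem_Icc] at hc
            refine le_of_eq ?_
            rcases lt_or_ge (i + L) k with h | h
            · exact (hind i k hi' hk' h).covariance_eq_zero (hY i hi') (hY k hk')
            · exact (hind k i hk' hi' (by omega)).symm.covariance_eq_zero (hY i hi') (hY k hk')
      _ = ∑ k ∈ (Finset.range N).filter (· ∈ Finset.Icc (i - L) (i + L)), V :=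
          (Finset.sum_filter _ _).symm
      _ ≤ ∑ k ∈ Finset.Icc (i - L) (i + L), V :=
          Finset.sum_le_sum_of_subset_of_nonneg
            (fun k hk => (Finset.mem_filter.1 hk).2) fun _ _ _ => hV0
      _ ≤ (2 * L + 1) * V := by
          rw [Finset.sum_const, nsmul_eq_mul, Nat.card_Icc]
          gcongr
          exact_mod_cast (by omega : i + L + 1 - (i - L) ≤ 2 * L + 1)
  calc _ ≤ ∑ _i ∈ Finset.range N, (2 * L + 1) * V := Finset.sum_le_sum key
    _ = _ := by rw [Finset.sum_const, nsmul_eq_mul, Finset.card_range]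

lemma variance_le_of_eLpNorm_le {X : Ω → ℝ} (hX : MemLp X 2 P) {R : ℝ≥0} (h : eLpNorm X 2 P ≤ R) :
    Var[X; P] ≤ (R : ℝ) ^ 2 := by
  have h1 : evariance X P ≤ (R : ℝ≥0∞) ^ 2 := by
    rw [← hX.ofReal_variance_eq]
    refine (ENNReal.ofReal_le_ofReal (variance_le_expectation_sq hX.1)).trans ?_
    have h2 : ENNReal.ofReal (∫ ω, X ω ^ 2 ∂P) = eLpNorm X 2 P ^ 2 := by
      rw [ofReal_integral_eq_lintegral_ofReal hX.integrable_sq (.of_forall fun ω => sq_nonneg _),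
        eLpNorm_eq_lintegral_rpow_enorm_toReal two_ne_zero ENNReal.ofNat_ne_top,
        ← ENNReal.rpow_natCast, ← ENNReal.rpow_mul]
      norm_num
      refine lintegral_congr fun ω => ?_
      rw [← ofReal_norm, ← ENNReal.ofReal_pow (norm_nonneg _), Real.norm_eq_abs, sq_abs]
    calc _ = eLpNorm X 2 P ^ 2 := h2
      _ ≤ _ := by gcongr
  rw [← hX.ofReal_variance_eq] at h1
  have := ENNReal.toReal_mono (by simp) h1
  simpa [ENNReal.toReal_ofReal (variance_nonneg _ _)] using this

end Variance

/-! ### Conditional mean and variance of the estimator -/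

/-- The mean of the block term `blockTerm` for observations `a j + b j * π j` with deterministic
`a`, `b` and noise `π` with covariances `ρ`. -/
noncomputable def blockMean (ρ a b : ℕ → ℝ) (h l i : ℕ) : ℝ :=
  ∑ m ∈ Finset.range (l + 1), lagWeight m *
    ((a i - localMean a h (i + 2 * h)) * (a (i + m) - localMean a h (i + 4 * h)) +
      ρ m * (b i * b (i + m)))

/-- The term of the block starting at `i` depends on the observations `i, …, i + 5 h` only. -/
lemma measurable_blockTerm {Ω : Type*} {m : MeasurableSpace Ω} {x : ℕ → Ω → ℝ} {h l i : ℕ}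
    (hl : l ≤ 5 * h) (hx : ∀ j, i ≤ j → j ≤ i + 5 * h → Measurable[m] (x j)) :
    Measurable[m] fun ω => blockTerm (x · ω) h l i := by
  have h1 : ∀ k, i ≤ k → k + h ≤ i + 5 * h → Measurable[m] fun ω => localMean (x · ω) h k := by
    intro k hk hk'
    refine (Finset.measurable_sum _ fun j hj => hx _ (by omega) ?_).const_mul _
    rw [Finset.mem_range] at hj; omega
  refine Finset.measurable_sum _ fun k hk => Measurable.const_mul (Measurable.mul ?_ ?_) _
  · exact (hx i le_rfl (by omega)).sub (h1 _ (by omega) (by omega))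
  · rw [Finset.mem_range] at hk
    exact (hx (i + k) (by omega) (by omega)).sub (h1 _ (by omega) (by omega))

lemma holderTriple_four_four_two : ENNReal.HolderTriple 4 4 2 where
  inv_add_inv_eq_inv := by
    rw [← two_mul, show (4 : ℝ≥0∞) = 2 * 2 by norm_num,
      ENNReal.mul_inv (by simp) (by simp), ← mul_assoc, ENNReal.mul_inv_cancel (by simp) (by simp),
      one_mul]

lemma lagWeight_nonneg (m : ℕ) : 0 ≤ lagWeight m := by unfold lagWeight; split_ifs <;> norm_num

lemma lagWeight_le (m : ℕ) : lagWeight m ≤ 2 := by unfold lagWeight; split_ifs <;> norm_num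

section

variable {P : Measure Ω}

lemma memLp_localMean {e : ℕ → Ω → ℝ} {r : ℝ≥0∞} {h i : ℕ}
    (he : ∀ j < h, MemLp (e (i + j)) r P) : MemLp (fun ω => localMean (e · ω) h i) r P :=
  (memLp_finsetSum _ fun j hj => he j (Finset.mem_range.1 hj)).const_mul _

lemma eLpNorm_localMean_le {e : ℕ → Ω → ℝ} {r R : ℝ≥0∞} (hr : 1 ≤ r) {h i : ℕ}
    (he : ∀ j < h, AEStronglyMeasurable (e (i + j)) P) (hR : ∀ j < h, eLpNorm (e (i + j)) r P ≤ R) :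
    eLpNorm (fun ω => localMean (e · ω) h i) r P ≤ R := by
  rcases Nat.eq_zero_or_pos h with rfl | hh
  · simp [localMean]
  have h1 : eLpNorm (fun ω => ∑ j ∈ Finset.range h, e (i + j) ω) r P ≤ h * R := by
    have h2 := eLpNorm_sum_le (s := Finset.range h) (f := fun j => e (i + j)) (p := r)
      (fun j hj => he j (Finset.mem_range.1 hj)) hr
    rw [show (fun ω => ∑ j ∈ Finset.range h, e (i + j) ω) = ∑ j ∈ Finset.range h, e (i + j) by
      ext; simp]
    refine h2.trans ((Finset.sum_le_sum fun j hj => hR j (Finset.mem_range.1 hj)).trans ?_)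
    simp
  have h3 : (fun ω => localMean (e · ω) h i)
      = (1 / (h : ℝ)) • fun ω => ∑ j ∈ Finset.range h, e (i + j) ω := by
    ext; simp [localMean]
  rw [h3, eLpNorm_const_smul]
  calc _ ≤ ‖1 / (h : ℝ)‖ₑ * (h * R) := by gcongr
    _ = R := by
      have : (h : ℝ≥0∞) ≠ 0 := by exact_mod_cast hh.ne'
      rw [one_div, enorm_inv (by positivity), ← mul_assoc, Real.enorm_natCast,
        ENNReal.inv_mul_cancel this (by simp), one_mul]

lemma integral_localMean_mul {e : ℕ → Ω → ℝ} {X : Ω → ℝ} {h i : ℕ}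
    (he : ∀ j < h, Integrable (fun ω => e (i + j) ω * X ω) P)
    (h0 : ∀ j < h, ∫ ω, e (i + j) ω * X ω ∂P = 0) :
    ∫ ω, localMean (e · ω) h i * X ω ∂P = 0 := by
  simp only [localMean, mul_assoc, Finset.sum_mul]
  rw [integral_const_mul, integral_finsetSum _ fun j hj => he j (Finset.mem_range.1 hj),
    Finset.sum_eq_zero fun j hj => h0 j (Finset.mem_range.1 hj), mul_zero]

end

namespace IsFinitelyDependent

variable {P : Measure Ω} [IsProbabilityMeasure P] {q : ℕ} {ρ : ℕ → ℝ} {M : ℝ≥0} {π : ℕ → Ω → ℝ}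
  (a b : ℕ → ℝ) {n h l i : ℕ} {K : ℝ≥0}

lemma memLp_obs (hπ : IsFinitelyDependent P q ρ M π) (j : ℕ) :
    MemLp (fun ω => a j + b j * π j ω) 4 P :=
  MemLp.add (f := fun _ => a j) (memLp_const _) ((hπ.memLp j).const_mul _)

lemma eLpNorm_obs_le (hπ : IsFinitelyDependent P q ρ M π) {a b : ℕ → ℝ} {j : ℕ}
    (ha : |a j| ≤ K) (hb : |b j| ≤ K) :
    eLpNorm (fun ω => a j + b j * π j ω) 4 P ≤ K * (1 + M) := by
  have h1 : eLpNorm (fun _ : Ω => a j) 4 P ≤ K := by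
    rw [eLpNorm_const _ (by norm_num) (IsProbabilityMeasure.ne_zero P)]
    simp only [measure_univ, ENNReal.one_rpow, mul_one]
    rw [← ofReal_norm, Real.norm_eq_abs, ← ENNReal.ofReal_coe_nnreal]
    exact ENNReal.ofReal_le_ofReal ha
  have h2 : eLpNorm (fun ω => b j * π j ω) 4 P ≤ K * M := by
    rw [show (fun ω => b j * π j ω) = b j • π j from rfl, eLpNorm_const_smul]
    refine mul_le_mul' ?_ (hπ.eLpNorm_le j)
    rw [← ofReal_norm, Real.norm_eq_abs, ← ENNReal.ofReal_coe_nnreal]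
    exact ENNReal.ofReal_le_ofReal hb
  calc _ ≤ eLpNorm (fun _ : Ω => a j) 4 P + eLpNorm (fun ω => b j * π j ω) 4 P :=
        eLpNorm_add_le aestronglyMeasurable_const ((hπ.memLp j).const_mul _).1 (by norm_num)
    _ ≤ K + K * M := add_le_add h1 h2
    _ = K * (1 + M) := by ring

lemma memLp_centred (hπ : IsFinitelyDependent P q ρ M π) (i k : ℕ) :
    MemLp (fun ω => (a i + b i * π i ω) - localMean (fun j => a j + b j * π j ω) h k) 4 P :=
  (hπ.memLp_obs a b i).sub (memLp_localMean fun j _ => hπ.memLp_obs a b (k + j))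

lemma eLpNorm_centred_le (hπ : IsFinitelyDependent P q ρ M π) {a b : ℕ → ℝ} {i k : ℕ}
    (ha : ∀ j ≤ n, |a j| ≤ K) (hb : ∀ j ≤ n, |b j| ≤ K) (hi : i ≤ n) (hk : k + h ≤ n) :
    eLpNorm (fun ω => (a i + b i * π i ω) - localMean (fun j => a j + b j * π j ω) h k) 4 P
      ≤ 2 * (K * (1 + M)) := by
  have h2 := eLpNorm_localMean_le (P := P) (e := fun j ω => a j + b j * π j ω) (r := 4)
    (R := K * (1 + M)) (by norm_num) (h := h) (i := k) (fun j _ => (hπ.memLp_obs a b (k + j)).1)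
    fun j hj => hπ.eLpNorm_obs_le (ha _ (by omega)) (hb _ (by omega))
  rw [two_mul]
  exact (eLpNorm_sub_le (hπ.memLp_obs a b i).1
    (memLp_localMean fun j _ => hπ.memLp_obs a b (k + j)).1 (by norm_num)).trans
    (add_le_add (hπ.eLpNorm_obs_le (ha _ hi) (hb _ hi)) h2)

lemma memLp_blockTerm (hπ : IsFinitelyDependent P q ρ M π) :
    MemLp (fun ω => blockTerm (fun j => a j + b j * π j ω) h l i) 2 P := by
  have := holderTriple_four_four_two
  exact memLp_finsetSum _ fun m _ => (((hπ.memLp_centred a b (i + m) (i + 4 * h))).mul'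
    (hπ.memLp_centred a b i (i + 2 * h))).const_mul _

/-- The products are bounded in `L²` by the `L⁴` norms of their factors. -/
lemma eLpNorm_blockTerm_le (hπ : IsFinitelyDependent P q ρ M π) {a b : ℕ → ℝ}
    (ha : ∀ j ≤ n, |a j| ≤ K) (hb : ∀ j ≤ n, |b j| ≤ K) (hi : i + 5 * h ≤ n) (hl : l ≤ 5 * h) :
    eLpNorm (fun ω => blockTerm (fun j => a j + b j * π j ω) h l i) 2 P
      ≤ (8 * (l + 1) * (K * (1 + M)) ^ 2 : ℝ≥0) := by
  have := holderTriple_four_four_two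
  have key : ∀ m ∈ Finset.range (l + 1), eLpNorm (fun ω => lagWeight m *
      (((a i + b i * π i ω) - localMean (fun j => a j + b j * π j ω) h (i + 2 * h)) *
        ((a (i + m) + b (i + m) * π (i + m) ω)
          - localMean (fun j => a j + b j * π j ω) h (i + 4 * h)))) 2 P
      ≤ 2 * (2 * (K * (1 + M)) * (2 * (K * (1 + M)))) := by
    intro m hm
    rw [Finset.mem_range] at hm
    have h1 := eLpNorm_smul_le_mul_eLpNorm (μ := P) (p := 4) (q := 4) (r := 2)
      (hπ.memLp_centred a b (h := h) (i + m) (i + 4 * h)).1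
      (hπ.memLp_centred a b (h := h) i (i + 2 * h)).1
    have h2 := h1.trans (mul_le_mul' (hπ.eLpNorm_centred_le ha hb (by omega) (by omega))
      (hπ.eLpNorm_centred_le ha hb (by omega) (by omega)))
    have h3 := eLpNorm_const_smul (lagWeight m) (fun ω =>
      ((a i + b i * π i ω) - localMean (fun j => a j + b j * π j ω) h (i + 2 * h)) *
        ((a (i + m) + b (i + m) * π (i + m) ω)
          - localMean (fun j => a j + b j * π j ω) h (i + 4 * h))) 2 P
    refine h3.le.trans (mul_le_mul' ?_ h2)
    rw [← ofReal_norm, Real.norm_of_nonneg (lagWeight_nonneg m)]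
    exact (ENNReal.ofReal_le_ofReal (lagWeight_le m)).trans (by simp)
  have h4 : (fun ω => blockTerm (fun j => a j + b j * π j ω) h l i)
      = ∑ m ∈ Finset.range (l + 1), fun ω => lagWeight m *
      (((a i + b i * π i ω) - localMean (fun j => a j + b j * π j ω) h (i + 2 * h)) *
        ((a (i + m) + b (i + m) * π (i + m) ω)
          - localMean (fun j => a j + b j * π j ω) h (i + 4 * h))) := by
    ext ω; simp [blockTerm]
  rw [h4]
  refine (eLpNorm_sum_le (fun m _ => ?_) (by norm_num)).trans ((Finset.sum_le_sum key).trans ?_)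
  · exact ((((hπ.memLp_centred a b (i + m) (i + 4 * h))).mul' (r := 2)
      (hπ.memLp_centred a b i (i + 2 * h))).const_mul _).1
  · rw [Finset.sum_const, Finset.card_range, nsmul_eq_mul]
    push_cast
    apply le_of_eq; ring

/-- The pairwise distances of `{i, i + m}`, `[i + 2 h, i + 3 h)` and `[i + 4 h, i + 5 h)` are larger
than `q`, so the product of the undisturbed noise terms is the only one with non-zero mean. -/
lemma integral_centred_noise_mul (hπ : IsFinitelyDependent P q ρ M π) {m : ℕ} (hm : m + q < h) :
    ∫ ω, (b i * π i ω - localMean (fun j => b j * π j ω) h (i + 2 * h)) *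
      (b (i + m) * π (i + m) ω - localMean (fun j => b j * π j ω) h (i + 4 * h)) ∂P
      = ρ m * (b i * b (i + m)) := by
  have he : ∀ j, MemLp (fun ω => b j * π j ω) 2 P := fun j =>
    ((hπ.memLp j).mono_exponent (by norm_num)).const_mul _
  have hL : ∀ k, MemLp (fun ω => localMean (fun j => b j * π j ω) h k) 2 P := fun k =>
    memLp_localMean (e := fun j ω => b j * π j ω) fun j _ => he _
  have h1 : ∀ j k, (j + q < k ∨ k + h + q ≤ j) →
      ∫ ω, localMean (fun j => b j * π j ω) h k * (b j * π j ω) ∂P = 0 := fun j k hjk =>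
    integral_localMean_mul (e := fun j ω => b j * π j ω) (fun _ _ => (he _).integrable_mul (he j))
      fun j' hj' => hπ.integral_mul_noise_eq_zero b (by omega)
  have h2 : ∫ ω, localMean (fun j => b j * π j ω) h (i + 4 * h) *
      localMean (fun j => b j * π j ω) h (i + 2 * h) ∂P = 0 :=
    integral_localMean_mul (e := fun j ω => b j * π j ω)
      (fun _ _ => (he _).integrable_mul (hL _)) fun j' hj' => by
        simp_rw [mul_comm (b (i + 4 * h + j') * _)]
        exact h1 _ _ (by omega)
  have h3 : ∫ ω, (b i * π i ω) * (b (i + m) * π (i + m) ω) ∂P = ρ m * (b i * b (i + m)) := by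
    have h4 : ∀ ω, (b i * π i ω) * (b (i + m) * π (i + m) ω)
        = (b i * b (i + m)) * (π i ω * π (i + m) ω) := fun ω => by ring
    simp_rw [h4]
    rw [integral_const_mul, hπ.cov, mul_comm]
  have h4 : ∀ ω, (b i * π i ω - localMean (fun j => b j * π j ω) h (i + 2 * h)) *
      (b (i + m) * π (i + m) ω - localMean (fun j => b j * π j ω) h (i + 4 * h))
      = (b i * π i ω) * (b (i + m) * π (i + m) ω)
        - localMean (fun j => b j * π j ω) h (i + 2 * h) * (b (i + m) * π (i + m) ω)
        - (localMean (fun j => b j * π j ω) h (i + 4 * h) * (b i * π i ω)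
          - localMean (fun j => b j * π j ω) h (i + 4 * h) *
            localMean (fun j => b j * π j ω) h (i + 2 * h)) := fun ω => by ring
  have i1 := (he i).integrable_mul (he (i + m))
  have i2 := (hL (i + 2 * h)).integrable_mul (he (i + m))
  have i3 := (hL (i + 4 * h)).integrable_mul (he i)
  have i4 := (hL (i + 4 * h)).integrable_mul (hL (i + 2 * h))
  simp_rw [h4]
  rw [integral_sub (by exact i1.sub i2) (by exact i3.sub i4), integral_sub (by exact i1) (by exact i2),
    integral_sub (by exact i3) (by exact i4), h2, h3, h1 _ _ (by omega), h1 _ _ (by omega)]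
  ring

lemma integral_centred_noise (hπ : IsFinitelyDependent P q ρ M π) (i k : ℕ) :
    Integrable (fun ω => b i * π i ω - localMean (fun j => b j * π j ω) h k) P ∧
      ∫ ω, (b i * π i ω - localMean (fun j => b j * π j ω) h k) ∂P = 0 := by
  have he : ∀ j, Integrable (fun ω => b j * π j ω) P := fun j =>
    ((hπ.memLp j).integrable (by norm_num)).const_mul _
  have h0 : ∀ j, ∫ ω, b j * π j ω ∂P = 0 := fun j => by
    rw [integral_const_mul, hπ.mean, mul_zero]
  have hL := integral_localMean_mul (P := P) (e := fun j ω => b j * π j ω) (X := fun _ => 1)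
    (h := h) (i := k) (fun j _ => by simpa using he _) fun j _ => by simpa using h0 _
  have hLi : Integrable (fun ω => localMean (fun j => b j * π j ω) h k) P :=
    (integrable_finsetSum _ fun j _ => he _).const_mul _
  refine ⟨(he i).sub hLi, ?_⟩
  rw [integral_sub (he i) hLi, h0]
  simpa using hL

/-- The terms linear in the noise are centred, which separates the price from the noise. -/
lemma integral_blockTerm (hπ : IsFinitelyDependent P q ρ M π) (hl : l + q < h) :
    ∫ ω, blockTerm (fun j => a j + b j * π j ω) h l i ∂P = blockMean ρ a b h l i := by
  have := holderTriple_four_four_two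
  simp only [blockTerm, blockMean]
  rw [integral_finsetSum _ fun m _ => (((hπ.memLp_centred a b (i + m) (i + 4 * h)).mul' (r := 2)
    (hπ.memLp_centred a b i (i + 2 * h))).integrable (by norm_num)).const_mul _]
  refine Finset.sum_congr rfl fun m hm => ?_
  rw [Finset.mem_range] at hm
  rw [integral_const_mul]
  congr 1
  simp_rw [localMean_add]
  obtain ⟨i1, e1⟩ := hπ.integral_centred_noise b (h := h) i (i + 2 * h)
  obtain ⟨i2, e2⟩ := hπ.integral_centred_noise b (h := h) (i + m) (i + 4 * h)
  have e3 := hπ.integral_centred_noise_mul b (h := h) (i := i) (m := m) (by omega)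
  have i3 : Integrable (fun ω =>
      (b i * π i ω - localMean (fun j => b j * π j ω) h (i + 2 * h)) *
      (b (i + m) * π (i + m) ω - localMean (fun j => b j * π j ω) h (i + 4 * h))) P := by
    have := ((hπ.memLp_centred 0 b (h := h) (i + m) (i + 4 * h)).mul' (r := 2)
      (hπ.memLp_centred 0 b (h := h) i (i + 2 * h))).integrable (by norm_num)
    simpa using this
  generalize localMean a h (i + 2 * h) = A at *
  generalize localMean a h (i + 4 * h) = A' at *
  have h4 : ∀ ω, (a i + b i * π i ω - (A + localMean (fun j => b j * π j ω) h (i + 2 * h))) *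
      (a (i + m) + b (i + m) * π (i + m) ω
        - (A' + localMean (fun j => b j * π j ω) h (i + 4 * h)))
      = (a i - A) * (a (i + m) - A')
        + (a i - A) * (b (i + m) * π (i + m) ω - localMean (fun j => b j * π j ω) h (i + 4 * h))
        + ((a (i + m) - A') * (b i * π i ω - localMean (fun j => b j * π j ω) h (i + 2 * h))
        + (b i * π i ω - localMean (fun j => b j * π j ω) h (i + 2 * h)) *
      (b (i + m) * π (i + m) ω - localMean (fun j => b j * π j ω) h (i + 4 * h))) := fun ω => by
    ring
  simp_rw [h4]
  have ic : Integrable (fun _ : Ω => (a i - A) * (a (i + m) - A')) P := integrable_const _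
  rw [integral_add (by exact ic.add (i2.const_mul _)) (by exact (i1.const_mul _).add i3),
    integral_add ic (i2.const_mul _), integral_add (i1.const_mul _) i3, integral_const,
    integral_const_mul, integral_const_mul, e1, e2, e3]
  simp

/-- Given the price and the noise volatility, the mean squared deviation of the estimator from
its mean is of order `l ^ 2 * h / n`: blocks at distance larger than `5 h + q` are independent. -/
lemma lintegral_sq_noiseVarEst_sub_le (hπ : IsFinitelyDependent P q ρ M π) {a b : ℕ → ℝ}
    (ha : ∀ j ≤ n, |a j| ≤ K) (hb : ∀ j ≤ n, |b j| ≤ K) (hl : l + q < h) (hn : 5 * h ≤ n) :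
    ∫⁻ ω, ‖noiseVarEst (fun j => a j + b j * π j ω) n h l - 1 / ((n : ℝ) - 5 * h + 1) *
      ∑ i ∈ Finset.range (n - 5 * h + 1), blockMean ρ a b h l i‖ₑ ^ 2 ∂P
      ≤ ENNReal.ofReal ((2 * (5 * h + q : ℕ) + 1) * (8 * (l + 1) * (K * (1 + M)) ^ 2) ^ 2 /
        ((n : ℝ) - 5 * h + 1)) := by
  have hN : (0 : ℝ) < (n : ℝ) - 5 * h + 1 := by
    have : ((5 * h : ℕ) : ℝ) ≤ n := by exact_mod_cast hn
    push_cast at this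
    linarith
  have hN' : ((n - 5 * h + 1 : ℕ) : ℝ) = (n : ℝ) - 5 * h + 1 := by
    push_cast [Nat.cast_sub hn]; ring
  have hmem : ∀ i, MemLp (fun ω => blockTerm (fun j => a j + b j * π j ω) h l i) 2 P := fun i =>
    hπ.memLp_blockTerm a b
  have hvar : ∀ i < n - 5 * h + 1,
      Var[fun ω => blockTerm (fun j => a j + b j * π j ω) h l i; P] ≤
        (8 * (l + 1) * (K * (1 + M)) ^ 2 : ℝ≥0) ^ 2 := fun i hi =>
    variance_le_of_eLpNorm_le (hmem i) (hπ.eLpNorm_blockTerm_le ha hb (by omega) (by omega))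
  have hind : ∀ i k, i + (5 * h + q) < k →
      IndepFun (fun ω => blockTerm (fun j => a j + b j * π j ω) h l i)
        (fun ω => blockTerm (fun j => a j + b j * π j ω) h l k) P := by
    intro i k hik
    refine hπ.indepFun (a := i + 5 * h)
      (measurable_blockTerm (by omega) fun j _ hj => ((measurable_iSup_comap ?_).const_mul _).const_add _)
      (measurable_blockTerm (by omega) fun j hj _ => ((measurable_iSup_comap ?_).const_mul _).const_add _)
    · exact hj
    · rw [Set.mem_Ioi]; omega
  have hsum := variance_sum_le_of_indepFun (N := n - 5 * h + 1) (L := 5 * h + q)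
    (fun i _ => hmem i) hvar fun i k _ _ => hind i k
  have hmem' : MemLp (fun ω => noiseVarEst (fun j => a j + b j * π j ω) n h l) 2 P := by
    simp_rw [noiseVarEst_eq]
    exact (memLp_finsetSum _ fun i _ => hmem i).const_mul _
  have hmean : ∫ ω, noiseVarEst (fun j => a j + b j * π j ω) n h l ∂P
      = 1 / ((n : ℝ) - 5 * h + 1) *
        ∑ i ∈ Finset.range (n - 5 * h + 1), blockMean ρ a b h l i := by
    simp_rw [noiseVarEst_eq]
    rw [integral_const_mul, integral_finsetSum _ fun i _ => (hmem i).integrable (by norm_num)]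
    simp_rw [hπ.integral_blockTerm a b hl]
  rw [← hmean]
  refine (hmem'.ofReal_variance_eq.symm.le : evariance _ P ≤ _).trans (ENNReal.ofReal_le_ofReal ?_)
  simp_rw [noiseVarEst_eq]
  rw [variance_const_mul]
  refine (mul_le_mul_of_nonneg_left hsum (sq_nonneg _)).trans (le_of_eq ?_)
  rw [hN']
  push_cast
  field_simp

end IsFinitelyDependent

/-! ### Riemann sums -/

lemma abs_mul_sub_integral_le {f : ℝ → ℝ} {a d ε : ℝ} (hd : 0 ≤ d)
    (hf : ContinuousOn f (Set.Icc a (a + d)))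
    (hε : ∀ s ∈ Set.Icc a (a + d), |f a - f s| ≤ ε) :
    |d * f a - ∫ s in a..a + d, f s| ≤ ε * d := by
  have hi : IntervalIntegrable f volume a (a + d) :=
    hf.intervalIntegrable_of_Icc (by linarith)
  have h1 : d * f a - ∫ s in a..a + d, f s = ∫ s in a..a + d, (f a - f s) := by
    rw [intervalIntegral.integral_sub intervalIntegrable_const hi]
    simp
  rw [h1, ← Real.norm_eq_abs]
  refine (intervalIntegral.norm_integral_le_of_norm_le_const fun s hs => ?_).trans_eq
    (by rw [add_sub_cancel_left, abs_of_nonneg hd])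
  rw [Set.uIoc_of_le (by linarith)] at hs
  exact hε s ⟨hs.1.le, hs.2⟩

lemma tendsto_riemannSum {f : ℝ → ℝ} {a d : ℝ} (hd : 0 ≤ d)
    (hf : ContinuousOn f (Set.Icc a (a + d))) :
    Tendsto (fun N : ℕ => d / N * ∑ k ∈ Finset.range N, f (a + k * (d / N))) atTop
      (𝓝 (∫ s in a..a + d, f s)) := by
  rw [Metric.tendsto_atTop]
  intro ε hε
  have hε' : 0 < ε / (d + 1) := by positivity
  obtain ⟨η, hη, hu⟩ := Metric.uniformContinuousOn_iff.1
    (isCompact_Icc.uniformContinuousOn_of_continuous hf) _ hε'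
  obtain ⟨N₀, hN₀⟩ := exists_nat_gt (d / η)
  refine ⟨N₀ + 1, fun N hN => ?_⟩
  have hNpos : (0 : ℝ) < N := by exact_mod_cast (by omega : 0 < N)
  have hstep : d / N < η := by
    rw [div_lt_iff₀ hNpos]
    rw [div_lt_iff₀ hη] at hN₀
    have : (N₀ : ℝ) ≤ N := by exact_mod_cast (by omega : N₀ ≤ N)
    nlinarith
  have hdN : 0 ≤ d / N := by positivity
  have hle : ∀ k < N, a + k * (d / N) + d / N ≤ a + d := by
    intro k hk
    have : (k : ℝ) + 1 ≤ N := by exact_mod_cast hk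
    calc a + k * (d / N) + d / N = a + (k + 1) * (d / N) := by ring
      _ ≤ a + N * (d / N) := by gcongr
      _ = a + d := by field_simp
  have hsub : ∀ k < N, Set.Icc (a + k * (d / N)) (a + k * (d / N) + d / N) ⊆
      Set.Icc a (a + d) := fun k hk =>
    Set.Icc_subset_Icc (by have : 0 ≤ k * (d / N) := by positivity
                           linarith) (hle k hk)
  have hsplit : ∫ s in a..a + d, f s
      = ∑ k ∈ Finset.range N, ∫ s in a + k * (d / N)..a + k * (d / N) + d / N, f s := by
    have h := intervalIntegral.sum_integral_adjacent_intervals (f := f) (μ := volume)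
      (a := fun k : ℕ => a + k * (d / N)) (n := N) fun k hk => by
        have h1 : a + ((k + 1 : ℕ) : ℝ) * (d / N) = a + k * (d / N) + d / N := by push_cast; ring
        rw [h1]
        exact (hf.mono (hsub k hk)).intervalIntegrable_of_Icc (by linarith)
    rw [show a + ((0 : ℕ) : ℝ) * (d / N) = a by simp,
      show a + (N : ℝ) * (d / N) = a + d by field_simp] at h
    rw [← h]
    refine Finset.sum_congr rfl fun k _ => ?_
    congr 1; push_cast; ring
  rw [Real.dist_eq, hsplit, Finset.mul_sum, ← Finset.sum_sub_distrib]
  calc _ ≤ ∑ k ∈ Finset.range N, |d / N * f (a + k * (d / N))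
        - ∫ s in a + k * (d / N)..a + k * (d / N) + d / N, f s| := Finset.abs_sum_le_sum_abs _ _
    _ ≤ ∑ k ∈ Finset.range N, ε / (d + 1) * (d / N) := by
        refine Finset.sum_le_sum fun k hk => ?_
        have hk' := Finset.mem_range.1 hk
        refine abs_mul_sub_integral_le hdN (hf.mono (hsub k hk')) fun s hs => ?_
        rw [← Real.dist_eq]
        refine (hu _ (hsub k hk' ⟨le_rfl, by linarith⟩) _ (hsub k hk' hs) ?_).le
        rw [dist_comm, Real.dist_eq, abs_of_nonneg (by linarith [hs.1])]
        linarith [hs.2]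
    _ = ε * (d / (d + 1)) := by
        rw [Finset.sum_const, Finset.card_range, nsmul_eq_mul]; field_simp
    _ < ε := by
        refine mul_lt_of_lt_one_right hε ?_
        rw [div_lt_one (by linarith)]; linarith

/-! ### Bounds in `L¹` and `L²` on a localising event -/

section

variable {ν : Measure Ω}

lemma eLpNorm_two_le_of_lintegral_sq_le {f : Ω → ℝ} {r : ℝ}
    (h : ∫⁻ ω, ‖f ω‖ₑ ^ 2 ∂ν ≤ ENNReal.ofReal r) : eLpNorm f 2 ν ≤ ENNReal.ofReal (√r) := by
  rw [eLpNorm_eq_lintegral_rpow_enorm_toReal two_ne_zero ENNReal.ofNat_ne_top]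
  rcases le_or_gt r 0 with hr | hr
  · rw [ENNReal.ofReal_of_nonpos hr] at h
    have : ∫⁻ ω, ‖f ω‖ₑ ^ (2 : ℝ≥0∞).toReal ∂ν = 0 := by
      refine le_antisymm ?_ zero_le
      simpa using h
    rw [this]; simp
  calc _ ≤ ENNReal.ofReal r ^ (1 / (2 : ℝ≥0∞).toReal) := by
        gcongr
        simpa using h
    _ = ENNReal.ofReal (√r) := by
        rw [ENNReal.ofReal_rpow_of_pos hr, Real.sqrt_eq_rpow]; simp

lemma eLpNorm_one_le_eLpNorm_two {f : Ω → ℝ} (hν : ν Set.univ ≤ 1)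
    (hf : AEStronglyMeasurable f ν) : eLpNorm f 1 ν ≤ eLpNorm f 2 ν := by
  refine (eLpNorm_le_eLpNorm_mul_rpow_measure_univ one_le_two hf).trans ?_
  refine mul_le_of_le_one_right' (ENNReal.rpow_le_one hν ?_)
  norm_num

lemma eLpNorm_one_mul_le {f g : Ω → ℝ} (hf : AEStronglyMeasurable f ν)
    (hg : AEStronglyMeasurable g ν) {r s : ℝ≥0∞} (hfr : eLpNorm f 2 ν ≤ r)
    (hgs : eLpNorm g 2 ν ≤ s) : eLpNorm (fun ω => f ω * g ω) 1 ν ≤ r * s :=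
  (eLpNorm_smul_le_mul_eLpNorm (p := 2) (q := 2) (r := 1) hg hf).trans (mul_le_mul' hfr hgs)

lemma eLpNorm_one_mul_le_of_bound {f g : Ω → ℝ} {K r : ℝ} (hν : ν Set.univ ≤ 1)
    (hK : ∀ᵐ ω ∂ν, |f ω| ≤ K) (hg : AEStronglyMeasurable g ν) (hK0 : 0 ≤ K)
    (hgr : eLpNorm g 2 ν ≤ ENNReal.ofReal r) :
    eLpNorm (fun ω => f ω * g ω) 1 ν ≤ ENNReal.ofReal (K * r) := by
  have h1 : eLpNorm (fun ω => f ω * g ω) 1 ν ≤ ENNReal.ofReal K * eLpNorm g 1 ν := by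
    refine eLpNorm_le_mul_eLpNorm_of_ae_le_mul ?_ 1
    filter_upwards [hK] with ω h
    rw [norm_mul]
    gcongr
    exact h
  rw [ENNReal.ofReal_mul hK0]
  exact h1.trans (mul_le_mul' le_rfl ((eLpNorm_one_le_eLpNorm_two hν hg).trans hgr))

lemma eLpNorm_sum_const_mul_le {ι : Type*} {f : ι → Ω → ℝ} {s : Finset ι} {c : ι → ℝ}
    (hf : ∀ i ∈ s, AEStronglyMeasurable (f i) ν) {r : ℝ}
    (h : ∀ i ∈ s, eLpNorm (f i) 1 ν ≤ ENNReal.ofReal r) :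
    eLpNorm (fun ω => ∑ i ∈ s, c i * f i ω) 1 ν ≤ ENNReal.ofReal ((∑ i ∈ s, |c i|) * r) := by
  have h1 : (fun ω => ∑ i ∈ s, c i * f i ω) = ∑ i ∈ s, c i • f i := by ext; simp
  rw [h1, Finset.sum_mul]
  refine (eLpNorm_sum_le (fun i hi => (hf i hi).const_smul _) le_rfl).trans ?_
  rcases s.eq_empty_or_nonempty with rfl | ⟨i₀, hi₀⟩
  · simp
  rcases le_or_gt 0 r with hr | hr
  · rw [ENNReal.ofReal_sum_of_nonneg fun i _ => by positivity]
    refine Finset.sum_le_sum fun i hi => ?_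
    rw [eLpNorm_const_smul, ENNReal.ofReal_mul (abs_nonneg _), ← ofReal_norm, Real.norm_eq_abs]
    gcongr
    exact h i hi
  · refine (Finset.sum_eq_zero fun i hi => ?_).le.trans zero_le
    have := h i hi
    rw [ENNReal.ofReal_of_nonpos hr.le] at this
    rw [eLpNorm_const_smul, le_antisymm this zero_le, mul_zero]

lemma eLpNorm_sub_localMean_le {e : ℕ → Ω → ℝ} {h i k : ℕ} (hh : 0 < h)
    (he : ∀ j, AEStronglyMeasurable (e j) ν) {R : ℝ≥0∞}
    (hR : ∀ j < h, eLpNorm (fun ω => e i ω - e (k + j) ω) 2 ν ≤ R) :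
    eLpNorm (fun ω => e i ω - localMean (e · ω) h k) 2 ν ≤ R := by
  refine le_trans (le_of_eq ?_) (eLpNorm_localMean_le (P := ν) (e := fun j ω => e i ω - e j ω)
    one_le_two (fun j _ => (he i).sub (he (k + j))) hR)
  congr 1
  funext ω
  simp only [localMean, Finset.sum_sub_distrib, Finset.sum_const, Finset.card_range, nsmul_eq_mul]
  have : (h : ℝ) ≠ 0 := by exact_mod_cast hh.ne'
  field_simp

/-- The price increments contribute `O(l h / n)` to the conditional mean of the estimator. -/
lemma eLpNorm_price_part_le {a : ℕ → Ω → ℝ} {n h l : ℕ} {R : ℝ} (hR0 : 0 ≤ R)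
    (ha : ∀ j, AEStronglyMeasurable (a j) ν) (hl : l < h) (hn : 5 * h ≤ n)
    (hR : ∀ i j, i ≤ n → j ≤ n → i ≤ j → j ≤ i + 5 * h →
      eLpNorm (fun ω => a i ω - a j ω) 2 ν ≤ ENNReal.ofReal R) :
    eLpNorm (fun ω => localMean (fun i => ∑ m ∈ Finset.range (l + 1), lagWeight m *
      ((a i ω - localMean (a · ω) h (i + 2 * h)) *
        (a (i + m) ω - localMean (a · ω) h (i + 4 * h)))) (n - 5 * h + 1) 0) 1 ν
      ≤ ENNReal.ofReal (2 * (l + 1) * (R * R)) := by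
  have hm : ∀ i k, AEStronglyMeasurable (fun ω => a i ω - localMean (a · ω) h k) ν := fun i k =>
    (ha i).sub ((Finset.aestronglyMeasurable_fun_sum _ fun j _ => ha (k + j)).const_mul _)
  refine eLpNorm_localMean_le (e := fun i ω => ∑ m ∈ Finset.range (l + 1), lagWeight m *
      ((a i ω - localMean (a · ω) h (i + 2 * h)) *
        (a (i + m) ω - localMean (a · ω) h (i + 4 * h)))) le_rfl (fun j _ => ?_) fun j hj => ?_
  · exact Finset.aestronglyMeasurable_fun_sum _ fun m _ => ((hm _ _).mul (hm _ _)).const_mul _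
  refine (eLpNorm_sum_const_mul_le (r := R * R) (fun m _ => (hm _ _).mul (hm _ _))
    fun m hmr => ?_).trans (ENNReal.ofReal_le_ofReal ?_)
  · rw [Finset.mem_range] at hmr
    rw [ENNReal.ofReal_mul hR0]
    exact eLpNorm_one_mul_le (hm _ _) (hm _ _)
      (eLpNorm_sub_localMean_le (by omega) ha fun k hk => hR _ _ (by omega) (by omega) (by omega) (by omega))
      (eLpNorm_sub_localMean_le (by omega) ha fun k hk => hR _ _ (by omega) (by omega) (by omega) (by omega))
  · gcongr
    calc ∑ m ∈ Finset.range (l + 1), |lagWeight m| ≤ ∑ _m ∈ Finset.range (l + 1), (2 : ℝ) :=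
          Finset.sum_le_sum fun m _ => by
            rw [abs_of_nonneg (lagWeight_nonneg m)]; exact lagWeight_le m
      _ = 2 * (l + 1) := by simp; ring

/-- Shifting one factor of `b i * b (i + m)` costs `O(n ^ (-1/2))`. -/
lemma eLpNorm_shift_part_le {b : ℕ → Ω → ℝ} {ρ : ℕ → ℝ} {n N q : ℕ} {K R : ℝ} (hK0 : 0 ≤ K)
    (hν : ν Set.univ ≤ 1)
    (hb : ∀ j, AEStronglyMeasurable (b j) ν) (hn : N + q ≤ n + 1)
    (hK : ∀ j ≤ n, ∀ᵐ ω ∂ν, |b j ω| ≤ K)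
    (hR : ∀ i j, i ≤ n → j ≤ n → i ≤ j → j ≤ i + q →
      eLpNorm (fun ω => b j ω - b i ω) 2 ν ≤ ENNReal.ofReal R) :
    eLpNorm (fun ω => localMean (fun i => ∑ m ∈ Finset.range (q + 1), lagWeight m * ρ m *
      (b i ω * (b (i + m) ω - b i ω))) N 0) 1 ν
      ≤ ENNReal.ofReal ((∑ m ∈ Finset.range (q + 1), |lagWeight m * ρ m|) * (K * R)) := by
  have hm : ∀ i k, AEStronglyMeasurable (fun ω => b i ω * (b k ω - b i ω)) ν := fun i k =>
    (hb i).mul ((hb k).sub (hb i))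
  refine eLpNorm_localMean_le (e := fun i ω => ∑ m ∈ Finset.range (q + 1), lagWeight m * ρ m *
      (b i ω * (b (i + m) ω - b i ω))) le_rfl (fun j _ => ?_) fun j hj => ?_
  · exact Finset.aestronglyMeasurable_fun_sum _ fun m _ => (hm _ _).const_mul _
  refine eLpNorm_sum_const_mul_le (fun m _ => hm _ _) fun m hmr => ?_
  rw [Finset.mem_range] at hmr
  exact eLpNorm_one_mul_le_of_bound hν (hK _ (by omega)) ((hb _).sub (hb _)) hK0
    (hR _ _ (by omega) (by omega) (by omega) (by omega))

end

section

variable {ν : Measure Ω}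

lemma eLpNorm_increment_le {X : ℝ≥0 → Ω → ℝ} {C : ℝ≥0}
    (hC : ∀ s t : ℝ≥0, s ≤ t → t ≤ 1 → ∫⁻ ω, ‖X t ω - X s ω‖ₑ ^ 2 ∂ν ≤ C * (t - s : ℝ≥0))
    {s t : ℝ≥0} (hst : s ≤ t) (ht : t ≤ 1) {d : ℝ} (hd : (t : ℝ) - s ≤ d) :
    eLpNorm (fun ω => X t ω - X s ω) 2 ν ≤ ENNReal.ofReal (√(C * d)) := by
  refine eLpNorm_two_le_of_lintegral_sq_le ((hC s t hst ht).trans ?_)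
  rw [← ENNReal.coe_mul, ← ENNReal.ofReal_coe_nnreal]
  refine ENNReal.ofReal_le_ofReal ?_
  rw [NNReal.coe_mul, NNReal.coe_sub hst]
  gcongr

lemma eLpNorm_grid_increment_le {X : ℝ≥0 → Ω → ℝ} {C : ℝ≥0}
    (hC : ∀ s t : ℝ≥0, s ≤ t → t ≤ 1 → ∫⁻ ω, ‖X t ω - X s ω‖ₑ ^ 2 ∂ν ≤ C * (t - s : ℝ≥0))
    {n i j r : ℕ} (hn : 0 < n) (hij : i ≤ j) (hjn : j ≤ n) (hr : j ≤ i + r) :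
    eLpNorm (fun ω => X ((j : ℝ≥0) / n) ω - X ((i : ℝ≥0) / n) ω) 2 ν
      ≤ ENNReal.ofReal (√(C * (r / n))) := by
  have hn' : (0 : ℝ≥0) < n := by exact_mod_cast hn
  refine eLpNorm_increment_le hC (by gcongr) ?_ ?_
  · rw [div_le_one hn']; exact_mod_cast hjn
  · push_cast
    rw [← sub_div]
    gcongr
    have : (j : ℝ) ≤ i + r := by exact_mod_cast hr
    linarith

lemma localMean_sub (x y : ℕ → ℝ) (h i : ℕ) :
    localMean (fun j => x j - y j) h i = localMean x h i - localMean y h i := by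
  simp only [localMean, Finset.sum_sub_distrib]; ring

lemma localMean_const {h : ℕ} (hh : 0 < h) (c : ℝ) (i : ℕ) : localMean (fun _ => c) h i = c := by
  have : (h : ℝ) ≠ 0 := by exact_mod_cast hh.ne'
  simp only [localMean, Finset.sum_const, Finset.card_range, nsmul_eq_mul]
  field_simp

/-- Averages over slightly different ranges are close. -/
lemma abs_localMean_sub_localMean_le {y : ℕ → ℝ} {Y : ℝ} {N n : ℕ} (hN : 0 < N) (hNn : N ≤ n)
    (hy : ∀ i < n, |y i| ≤ Y) :
    |localMean y N 0 - localMean y n 0| ≤ 2 * Y * (((n : ℝ) - N) / n) := by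
  have hN' : (0 : ℝ) < N := by exact_mod_cast hN
  have hn' : (0 : ℝ) < n := by exact_mod_cast hN.trans_le hNn
  have hNn' : (N : ℝ) ≤ n := by exact_mod_cast hNn
  simp only [localMean, zero_add]
  rw [← Finset.sum_range_add_sum_Ico y hNn]
  have h1 : |∑ i ∈ Finset.range N, y i| ≤ N * Y := by
    refine (Finset.abs_sum_le_sum_abs _ _).trans ((Finset.sum_le_sum fun i hi =>
      hy i ((Finset.mem_range.1 hi).trans_le hNn)).trans_eq ?_)
    simp
  have h2 : |∑ i ∈ Finset.Ico N n, y i| ≤ (n - N) * Y := by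
    refine (Finset.abs_sum_le_sum_abs _ _).trans ((Finset.sum_le_sum fun i hi =>
      hy i (Finset.mem_Ico.1 hi).2).trans_eq ?_)
    simp [Nat.cast_sub hNn]
  have h3 : 1 / (N : ℝ) * ∑ i ∈ Finset.range N, y i
      - 1 / (n : ℝ) * (∑ i ∈ Finset.range N, y i + ∑ i ∈ Finset.Ico N n, y i)
      = (1 / (N : ℝ) - 1 / n) * ∑ i ∈ Finset.range N, y i
        - 1 / n * ∑ i ∈ Finset.Ico N n, y i := by ring
  have h4 : 0 ≤ 1 / (N : ℝ) - 1 / n := sub_nonneg.2 (by gcongr)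
  rw [h3]
  refine (abs_sub _ _).trans ?_
  rw [abs_mul, abs_mul, abs_of_nonneg h4, abs_of_nonneg (by positivity : 0 ≤ 1 / (n : ℝ))]
  calc _ ≤ (1 / (N : ℝ) - 1 / n) * (N * Y) + 1 / n * ((n - N) * Y) := by gcongr
    _ = _ := by field_simp; ring

/-- The integral over `[0, 1]` is the limit of averages over grids refining the grid of mesh `1 / n`. -/
lemma tendsto_nested_localMean {f : ℝ≥0 → ℝ} (hf : ContinuousOn f (Set.Iic 1)) {n : ℕ}
    (hn : 0 < n) :
    Tendsto (fun N : ℕ => localMean (fun i => localMean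
      (fun k => f ((i : ℝ≥0) / n + k * (1 / n / N))) N 0) n 0) atTop
      (𝓝 (∫ s in (0 : ℝ)..1, f s.toNNReal)) := by
  have hn' : (0 : ℝ) < n := by exact_mod_cast hn
  have hc : ContinuousOn (fun s : ℝ => f s.toNNReal) (Set.Icc 0 1) :=
    hf.comp continuous_real_toNNReal.continuousOn fun s hs => by
      rw [Set.mem_Iic, Real.toNNReal_le_one]; exact hs.2
  have hsub : ∀ i < n, Set.Icc ((i : ℝ) / n) (i / n + 1 / n) ⊆ Set.Icc 0 1 := by
    intro i hi
    refine Set.Icc_subset_Icc (by positivity) ?_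
    rw [← add_div, div_le_one hn']
    exact_mod_cast hi
  have hsplit : ∫ s in (0 : ℝ)..1, f s.toNNReal
      = ∑ i ∈ Finset.range n, ∫ s in (i : ℝ) / n..i / n + 1 / n, f s.toNNReal := by
    have h := intervalIntegral.sum_integral_adjacent_intervals
      (f := fun s : ℝ => f s.toNNReal) (μ := volume)
      (a := fun k : ℕ => (k : ℝ) / n) (n := n) fun k hk => by
        have h1 : ((k + 1 : ℕ) : ℝ) / n = k / n + 1 / n := by push_cast; ring
        rw [h1]
        exact (hc.mono (hsub k hk)).intervalIntegrable_of_Icc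
          (by have : 0 ≤ 1 / (n : ℝ) := by positivity
              linarith)
    rw [show ((0 : ℕ) : ℝ) / n = 0 by simp, div_self hn'.ne'] at h
    rw [← h]
    refine Finset.sum_congr rfl fun k _ => ?_
    congr 1; push_cast; ring
  rw [hsplit]
  have key := tendsto_finsetSum (Finset.range n) fun i hi =>
    tendsto_riemannSum (d := 1 / (n : ℝ)) (by positivity)
      (hc.mono (hsub i (Finset.mem_range.1 hi)))
  refine key.congr fun N => ?_
  rw [localMean, Finset.mul_sum]
  refine Finset.sum_congr rfl fun i _ => ?_
  simp only [localMean, zero_add]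
  rw [← mul_assoc]
  congr 1
  · ring
  · refine Finset.sum_congr rfl fun k _ => ?_
    congr 1
    rw [← Real.toNNReal_coe (r := (i : ℝ≥0) / n + k * (1 / n / N))]
    congr 1

/-- The Riemann sum of `w ^ 2` is within `O(n ^ (-1/2))` of the integral. The integral is the limit
of averages over refined grids, along which the bound is uniform. -/
lemma eLpNorm_riemann_part_le {w : ℝ≥0 → Ω → ℝ} {K C : ℝ≥0} (hν : ν Set.univ ≤ 1)
    (hw : ∀ t, Measurable (w t))
    (hK : ∀ᵐ ω ∂ν, ∀ i n : ℕ, i ≤ n → |w ((i : ℝ≥0) / n) ω| ≤ K)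
    (hC : ∀ s t : ℝ≥0, s ≤ t → t ≤ 1 → ∫⁻ ω, ‖w t ω - w s ω‖ₑ ^ 2 ∂ν ≤ C * (t - s : ℝ≥0))
    (hcont : ∀ᵐ ω ∂ν, ContinuousOn (w · ω) (Set.Iic 1)) {n : ℕ} (hn : 0 < n) :
    eLpNorm (fun ω => localMean (fun i => w ((i : ℝ≥0) / n) ω ^ 2) n 0
      - ∫ s in (0 : ℝ)..1, w s.toNNReal ω ^ 2) 1 ν
      ≤ ENNReal.ofReal (2 * K * √(C * (1 / n))) := by
  have hn' : (0 : ℝ≥0) < n := by exact_mod_cast hn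
  have hmeas : ∀ s t, AEStronglyMeasurable (fun ω => w s ω ^ 2 - w t ω ^ 2) ν := fun s t =>
    (((hw s).pow_const 2).sub ((hw t).pow_const 2)).aestronglyMeasurable
  have hmeas' : ∀ N i : ℕ, AEStronglyMeasurable (fun ω => localMean (fun k =>
      w ((i : ℝ≥0) / n) ω ^ 2 - w ((i : ℝ≥0) / n + k * (1 / n / N)) ω ^ 2) N 0) ν := fun N i =>
    (Finset.aestronglyMeasurable_fun_sum _ fun _ _ => hmeas _ _).const_mul _
  refine (Lp.eLpNorm_lim_le_liminf_eLpNorm (f := fun (N : ℕ) ω => localMean (fun i =>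
    localMean (fun k => w ((i : ℝ≥0) / n) ω ^ 2
      - w ((i : ℝ≥0) / n + k * (1 / n / N)) ω ^ 2) N 0) n 0) (fun N => ?_) _ ?_).trans ?_
  · exact (Finset.aestronglyMeasurable_fun_sum _ fun _ _ => hmeas' _ _).const_mul _
  · filter_upwards [hcont] with ω hω
    refine (tendsto_const_nhds.sub (tendsto_nested_localMean (hω.pow 2) hn)).congr' ?_
    filter_upwards [eventually_gt_atTop 0] with N hN
    rw [← localMean_sub]
    congr 1
    funext i
    rw [localMean_sub, localMean_const hN]
    rfl
  · refine liminf_le_of_le (by isBoundedDefault) fun b hb => ?_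
    obtain ⟨N, hbN, hN⟩ := (hb.and (eventually_gt_atTop 0)).exists
    refine hbN.trans ?_
    have hN' : (0 : ℝ≥0) < N := by exact_mod_cast hN
    refine eLpNorm_localMean_le (e := fun i ω => localMean (fun k => w ((i : ℝ≥0) / n) ω ^ 2
      - w ((i : ℝ≥0) / n + k * (1 / n / N)) ω ^ 2) N 0) le_rfl (fun i _ => hmeas' _ _)
      fun i hi => ?_
    refine eLpNorm_localMean_le (e := fun k ω => w (((0 + i : ℕ) : ℝ≥0) / n) ω ^ 2
      - w (((0 + i : ℕ) : ℝ≥0) / n + k * (1 / n / N)) ω ^ 2) le_rfl (fun i _ => hmeas _ _)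
      fun k hk => ?_
    simp only [zero_add]
    -- the points of the refined grid are rational, so that the bound `K` applies to them
    have hpt : (i : ℝ≥0) / n + k * (1 / n / N) = ((i * N + k : ℕ) : ℝ≥0) / (n * N : ℕ) := by
      push_cast; field_simp
    have hle : i * N + k ≤ n * N := by nlinarith
    have h1 : ((i * N + k : ℕ) : ℝ≥0) / (n * N : ℕ) ≤ 1 :=
      div_le_one_of_le₀ (by exact_mod_cast hle) zero_le
    have h2 := eLpNorm_increment_le hC (s := (i : ℝ≥0) / n)
      (t := (i : ℝ≥0) / n + k * (1 / n / N)) (le_add_of_nonneg_right zero_le)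
      (hpt.trans_le h1) (d := 1 / n) (by
        have h3 : (k : ℝ) * (1 / n / N) ≤ N * (1 / n / N) := by
          gcongr
        have h4 : (N : ℝ) * (1 / n / N) = 1 / n := by
          have : (N : ℝ) ≠ 0 := by exact_mod_cast hN.ne'
          field_simp
        push_cast
        linarith)
    have h5 : (fun ω => w ((i : ℝ≥0) / n) ω ^ 2 - w ((i : ℝ≥0) / n + k * (1 / n / N)) ω ^ 2)
        = fun ω => -(w ((i : ℝ≥0) / n) ω + w ((i : ℝ≥0) / n + k * (1 / n / N)) ω) *
          (w ((i : ℝ≥0) / n + k * (1 / n / N)) ω - w ((i : ℝ≥0) / n) ω) := by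
      funext ω; ring
    rw [h5]
    refine eLpNorm_one_mul_le_of_bound hν ?_
      ((hw _).sub (hw _)).aestronglyMeasurable (by positivity) h2
    filter_upwards [hK] with ω hω
    rw [abs_neg, two_mul, hpt]
    exact (abs_add_le _ _).trans (add_le_add (hω i n hi.le) (hω _ _ hle))

end

/-! ### Conditioning on the price and the noise volatility -/

/-- A bound that holds for each fixed value `v ∈ S` of an independent variable `V` may be integrated
over `{V ∈ S}`. This replaces conditioning on `V`. -/
lemma setLIntegral_le_of_indepFun {α β : Type*} [MeasurableSpace α] [MeasurableSpace β]
    {P : Measure Ω} [IsProbabilityMeasure P] {X : Ω → α} {V : Ω → β} (hX : Measurable X)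
    (hV : Measurable V) (h : IndepFun X V P) {f : α → β → ℝ≥0∞}
    (hf : Measurable (Function.uncurry f)) {S : Set β} (hS : MeasurableSet S) {r : ℝ≥0∞}
    (hr : ∀ v ∈ S, ∫⁻ ω, f (X ω) v ∂P ≤ r) : ∫⁻ ω in V ⁻¹' S, f (X ω) (V ω) ∂P ≤ r := by
  have hg : Measurable fun z : α × β => (Prod.snd ⁻¹' S).indicator (Function.uncurry f) z :=
    hf.indicator (measurable_snd hS)
  have := Measure.isProbabilityMeasure_map (μ := P) hX.aemeasurable
  have := Measure.isProbabilityMeasure_map (μ := P) hV.aemeasurable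
  calc ∫⁻ ω in V ⁻¹' S, f (X ω) (V ω) ∂P
      = ∫⁻ ω, (Prod.snd ⁻¹' S).indicator (Function.uncurry f) (X ω, V ω) ∂P := by
        rw [← lintegral_indicator (hV hS)]; rfl
    _ = ∫⁻ z, (Prod.snd ⁻¹' S).indicator (Function.uncurry f) z ∂((P.map X).prod (P.map V)) := by
        rw [← (indepFun_iff_map_prod_eq_prod_map_map hX.aemeasurable hV.aemeasurable).1 h,
          lintegral_map hg (hX.prodMk hV)]
    _ = ∫⁻ v, ∫⁻ x, (Prod.snd ⁻¹' S).indicator (Function.uncurry f) (x, v) ∂(P.map X)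
          ∂(P.map V) := lintegral_prod_symm _ hg.aemeasurable
    _ ≤ ∫⁻ _v, r ∂(P.map V) := by
        refine lintegral_mono fun v => ?_
        by_cases hv : v ∈ S
        · rw [lintegral_map (by fun_prop) hX]
          refine le_trans (le_of_eq (lintegral_congr fun ω => ?_)) (hr v hv)
          exact Set.indicator_of_mem (s := Prod.snd ⁻¹' S) hv _
        · refine (lintegral_mono fun x => ?_).trans (lintegral_zero.le.trans zero_le)
          exact (Set.indicator_of_notMem (s := Prod.snd ⁻¹' S) hv _).le
    _ = r := by simp

/-! ### The error of the estimator on a localising event -/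

lemma localMean_block_eq {n h : ℕ} (hn : 5 * h ≤ n) (f : ℕ → ℝ) :
    1 / ((n : ℝ) - 5 * h + 1) * ∑ i ∈ Finset.range (n - 5 * h + 1), f i
      = localMean f (n - 5 * h + 1) 0 := by
  simp only [localMean, zero_add]
  push_cast [Nat.cast_sub hn]
  rfl

section

variable {P : Measure Ω} [IsProbabilityMeasure P] {𝓕 : Filtration ℝ≥0 mΩ}
  {W B p w : ℝ≥0 → Ω → ℝ} {q : ℕ} {θ : ℕ → ℝ} {u : ℤ → Ω → ℝ}

lemma measurable_noiseVarEst {α : Type*} [MeasurableSpace α] {x : ℕ → α → ℝ}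
    (hx : ∀ j, Measurable (x j)) (n h l : ℕ) :
    Measurable fun v => noiseVarEst (x · v) n h l := by
  have h1 : ∀ k, Measurable fun v => localMean (x · v) h k := fun k =>
    (Finset.measurable_sum _ fun j _ => hx (k + j)).const_mul _
  have h2 : ∀ m, Measurable fun v => sampleAutocov (x · v) n h m := fun m =>
    (Finset.measurable_sum _ fun i _ =>
      ((hx i).sub (h1 _)).mul ((hx (i + m)).sub (h1 _))).const_mul _
  exact (h2 0).add ((Finset.measurable_sum _ fun m _ => h2 m).const_mul _)

lemma measurable_blockMean {α : Type*} [MeasurableSpace α] {ρ : ℕ → ℝ} {a b : ℕ → α → ℝ}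
    (ha : ∀ j, Measurable (a j)) (hb : ∀ j, Measurable (b j)) (h l i : ℕ) :
    Measurable fun v => blockMean ρ (a · v) (b · v) h l i := by
  have h1 : ∀ k, Measurable fun v => localMean (a · v) h k := fun k =>
    (Finset.measurable_sum _ fun j _ => ha (k + j)).const_mul _
  exact Finset.measurable_sum _ fun m _ => ((((ha i).sub (h1 _)).mul
    ((ha (i + m)).sub (h1 _))).add (((hb i).mul (hb (i + m))).const_mul _)).const_mul _

/-- The bound on the conditional variance, integrated over the price and the noise volatility. -/
lemma IsNoise.eLpNorm_noiseVarEst_sub_condMean_le (hnoise : IsNoise 𝓕 P W B p w q θ u) {M : ℝ≥0}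
    (hπ : IsFinitelyDependent P q (autocov P q θ u) M fun i => movingAverage q θ u i)
    (hpm : ∀ t, Measurable (p t)) (hwm : ∀ t, Measurable (w t)) {G : Set Ω} {K : ℝ≥0} {n h l : ℕ}
    (hK : ∀ ω ∈ G, ∀ i ≤ n, |p ((i : ℝ≥0) / n) ω| ≤ K ∧ |w ((i : ℝ≥0) / n) ω| ≤ K)
    (hl : l + q < h) (hn : 5 * h ≤ n) :
    eLpNorm (fun ω => noiseVarEst (fun i => obsPrice p w q θ u n i ω) n h l
      - localMean (fun i => blockMean (autocov P q θ u) (fun j => p ((j : ℝ≥0) / n) ω)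
        (fun j => w ((j : ℝ≥0) / n) ω) h l i) (n - 5 * h + 1) 0) 2 (P.restrict G)
      ≤ ENNReal.ofReal (√((2 * (5 * h + q : ℕ) + 1) * (8 * (l + 1) * (K * (1 + M)) ^ 2) ^ 2 /
        ((n : ℝ) - 5 * h + 1))) := by
  refine eLpNorm_two_le_of_lintegral_sq_le ?_
  -- `V` collects the values of `p` and `w` at the observation times
  let V : Ω → ℕ → ℝ × ℝ := fun ω j => (p ((j : ℝ≥0) / n) ω, w ((j : ℝ≥0) / n) ω)
  let S : Set (ℕ → ℝ × ℝ) := {v | ∀ j ≤ n, |(v j).1| ≤ K ∧ |(v j).2| ≤ K}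
  let f : (ℕ → ℝ) → (ℕ → ℝ × ℝ) → ℝ≥0∞ := fun x v =>
    ‖noiseVarEst (fun j => (v j).1 + (v j).2 * x j) n h l - 1 / ((n : ℝ) - 5 * h + 1) *
      ∑ i ∈ Finset.range (n - 5 * h + 1), blockMean (autocov P q θ u) (fun j => (v j).1)
        (fun j => (v j).2) h l i‖ₑ ^ 2
  have hV : Measurable V := measurable_pi_iff.2 fun j => (hpm _).prodMk (hwm _)
  have hS : MeasurableSet S := by
    simp only [S, Set.ofPred_forall]
    refine MeasurableSet.iInter fun j => MeasurableSet.iInter fun _ => ?_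
    have h1 : Measurable fun v : ℕ → ℝ × ℝ => |(v j).1| := by fun_prop
    have h2 : Measurable fun v : ℕ → ℝ × ℝ => |(v j).2| := by fun_prop
    exact (measurableSet_le h1 measurable_const).inter (measurableSet_le h2 measurable_const)
  have hind : IndepFun (fun ω (i : ℕ) => movingAverage q θ u i ω) V P :=
    hnoise.indep_price.comp (φ := id) (ψ := fun (g : ℝ≥0 → ℝ × ℝ) (j : ℕ) => g ((j : ℝ≥0) / n)) measurable_id
      (measurable_pi_iff.2 fun j => measurable_pi_apply _)
  have hf : Measurable (Function.uncurry f) := by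
    refine (Measurable.sub ?_ ?_).enorm.pow_const 2
    · exact measurable_noiseVarEst
        (x := fun j (z : (ℕ → ℝ) × (ℕ → ℝ × ℝ)) => (z.2 j).1 + (z.2 j).2 * z.1 j)
        (fun j => by fun_prop) n h l
    · exact (Finset.measurable_sum _ fun i _ => measurable_blockMean
        (a := fun j (z : (ℕ → ℝ) × (ℕ → ℝ × ℝ)) => (z.2 j).1) (b := fun j z => (z.2 j).2)
        (fun j => by fun_prop) (fun j => by fun_prop) h l i).const_mul _
  have key := setLIntegral_le_of_indepFun (f := f)
    (measurable_pi_iff.2 fun i : ℕ => hπ.measurable i) hV hind hf hS fun v hv =>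
      hπ.lintegral_sq_noiseVarEst_sub_le (a := fun j => (v j).1) (b := fun j => (v j).2)
        (fun j hj => (hv j hj).1) (fun j hj => (hv j hj).2) hl hn
  have hGS : G ⊆ V ⁻¹' S := fun ω hω => hK ω hω
  refine le_trans (le_of_eq ?_) ((lintegral_mono_set hGS).trans key)
  refine lintegral_congr fun ω => ?_
  simp only [f]
  rw [localMean_block_eq hn]
  rfl

/-- Decomposition of the error of the conditional mean: price increments, the shift of `b (i + m)` to
`b i`, the missing indices at the boundary, and the Riemann sum. -/
lemma localMean_blockMean_sub_eq {ρ a b : ℕ → ℝ} {n N h l : ℕ} {I : ℝ} (hq : q ≤ l)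
    (hρ : ∀ m, q < m → ρ m = 0) :
    localMean (fun i => blockMean ρ a b h l i) N 0
        - (∑ m ∈ Finset.range (q + 1), lagWeight m * ρ m) * I
      = localMean (fun i => ∑ m ∈ Finset.range (l + 1), lagWeight m *
          ((a i - localMean a h (i + 2 * h)) * (a (i + m) - localMean a h (i + 4 * h)))) N 0
        + localMean (fun i => ∑ m ∈ Finset.range (q + 1), lagWeight m * ρ m *
          (b i * (b (i + m) - b i))) N 0
        + (∑ m ∈ Finset.range (q + 1), lagWeight m * ρ m) *
          (localMean (fun i => b i ^ 2) N 0 - localMean (fun i => b i ^ 2) n 0)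
        + (∑ m ∈ Finset.range (q + 1), lagWeight m * ρ m) *
          (localMean (fun i => b i ^ 2) n 0 - I) := by
  have h1 : ∀ i, blockMean ρ a b h l i
      = (∑ m ∈ Finset.range (l + 1), lagWeight m *
          ((a i - localMean a h (i + 2 * h)) * (a (i + m) - localMean a h (i + 4 * h))) +
        ∑ m ∈ Finset.range (q + 1), lagWeight m * ρ m * (b i * (b (i + m) - b i)))
        + (∑ m ∈ Finset.range (q + 1), lagWeight m * ρ m) * b i ^ 2 := by
    intro i
    have h2 : ∑ m ∈ Finset.range (l + 1), lagWeight m * (ρ m * (b i * b (i + m)))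
        = ∑ m ∈ Finset.range (q + 1), lagWeight m * (ρ m * (b i * b (i + m))) := by
      symm
      refine Finset.sum_subset (Finset.range_subset_range.2 (by omega)) fun m _ hm => ?_
      rw [hρ m (by rw [Finset.mem_range] at hm; omega)]
      ring
    rw [blockMean, Finset.sum_congr rfl fun m _ => mul_add _ _ _, Finset.sum_add_distrib, h2,
      add_assoc, Finset.sum_mul, ← Finset.sum_add_distrib]
    congr 1
    exact Finset.sum_congr rfl fun m _ => by ring
  have h3 : ∀ (c : ℝ) (x : ℕ → ℝ), localMean (fun i => c * x i) N 0 = c * localMean x N 0 := by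
    intro c x
    simp only [localMean, ← Finset.mul_sum]; ring
  simp_rw [h1]
  rw [localMean_add, localMean_add, h3]
  ring

/-- The `L¹` error on the localising event `G`, as the sum of the conditional standard deviation and
the four parts of the error of the conditional mean. -/
lemma IsNoise.eLpNorm_noiseVarEst_sub_le (hnoise : IsNoise 𝓕 P W B p w q θ u) {M : ℝ≥0}
    (hπ : IsFinitelyDependent P q (autocov P q θ u) M fun i => movingAverage q θ u i)
    (hpm : ∀ t, Measurable (p t)) (hwm : ∀ t, Measurable (w t))
    {G : Set Ω} (hGm : MeasurableSet G) {K C : ℝ≥0}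
    (hK : ∀ ω ∈ G, ∀ i n : ℕ, i ≤ n →
      |p ((i : ℝ≥0) / n) ω| ≤ K ∧ |w ((i : ℝ≥0) / n) ω| ≤ K)
    (hCp : ∀ s t : ℝ≥0, s ≤ t → t ≤ 1 →
      ∫⁻ ω in G, ‖p t ω - p s ω‖ₑ ^ 2 ∂P ≤ C * (t - s : ℝ≥0))
    (hCw : ∀ s t : ℝ≥0, s ≤ t → t ≤ 1 →
      ∫⁻ ω in G, ‖w t ω - w s ω‖ₑ ^ 2 ∂P ≤ C * (t - s : ℝ≥0))
    (hcont : ∀ᵐ ω ∂P, ContinuousOn (w · ω) (Set.Iic 1))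
    (hI : AEStronglyMeasurable (fun ω => ∫ s in (0 : ℝ)..1, w s.toNNReal ω ^ 2) P)
    {n h l : ℕ} (hl : l + q < h) (hq : q ≤ l) (hn : 5 * h ≤ n) :
    eLpNorm (fun ω => noiseVarEst (fun i => obsPrice p w q θ u n i ω) n h l
      - ∫ s in (0 : ℝ)..1, longRunVar P q θ u * w s.toNNReal ω ^ 2) 1 (P.restrict G)
      ≤ ENNReal.ofReal (√((2 * (5 * h + q : ℕ) + 1) * (8 * (l + 1) * (K * (1 + M)) ^ 2) ^ 2 /
          ((n : ℝ) - 5 * h + 1))) +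
        ENNReal.ofReal (2 * (l + 1) * (√(C * ((5 * h : ℕ) / n)) * √(C * ((5 * h : ℕ) / n)))) +
        ENNReal.ofReal ((∑ m ∈ Finset.range (q + 1), |lagWeight m * autocov P q θ u m|) *
          (K * √(C * (q / n)))) +
        ENNReal.ofReal (|longRunVar P q θ u| * (2 * K ^ 2 * ((5 * h : ℕ) / n))) +
        ENNReal.ofReal (|longRunVar P q θ u| * (2 * K * √(C * (1 / n)))) := by
  have hn0 : 0 < n := by omega
  have hν : (P.restrict G) Set.univ ≤ 1 := by
    rw [Measure.restrict_apply_univ]; exact prob_le_one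
  have hρ := fun m (hm : q < m) => hπ.cov_eq_zero hm
  have hLdef := longRunVar_eq_sum (P := P) (θ := θ) (u := u) le_rfl hρ
  have hG : ∀ {Q : Ω → Prop}, (∀ ω ∈ G, Q ω) → ∀ᵐ ω ∂(P.restrict G), Q ω := fun hQ =>
    (ae_restrict_iff' hGm).2 (.of_forall hQ)
  -- measurability of the five parts of the error
  have hxm : ∀ j, Measurable fun ω => obsPrice p w q θ u n j ω := fun j =>
    (hpm _).add ((hwm _).mul (hπ.measurable j))
  have mM : ∀ {f : ℕ → Ω → ℝ} (N k : ℕ), (∀ j, Measurable (f j)) →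
      Measurable fun ω => localMean (f · ω) N k := fun N k hf =>
    (Finset.measurable_sum _ fun j _ => hf (k + j)).const_mul _
  have mA : Measurable fun ω => noiseVarEst (fun i => obsPrice p w q θ u n i ω) n h l
      - localMean (fun i => blockMean (autocov P q θ u) (fun j => p ((j : ℝ≥0) / n) ω)
        (fun j => w ((j : ℝ≥0) / n) ω) h l i) (n - 5 * h + 1) 0 :=
    (measurable_noiseVarEst hxm n h l).sub (mM _ _ fun j => measurable_blockMean
      (fun j => hpm _) (fun j => hwm _) h l j)
  have mB : Measurable fun ω => localMean (fun i => ∑ m ∈ Finset.range (l + 1), lagWeight m *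
      ((p ((i : ℝ≥0) / n) ω - localMean (fun j => p ((j : ℝ≥0) / n) ω) h (i + 2 * h)) *
        (p (((i + m : ℕ) : ℝ≥0) / n) ω
          - localMean (fun j => p ((j : ℝ≥0) / n) ω) h (i + 4 * h)))) (n - 5 * h + 1) 0 :=
    mM _ _ fun j => Finset.measurable_sum _ fun m _ =>
      (((hpm _).sub (mM _ _ fun j => hpm _)).mul
        ((hpm _).sub (mM _ _ fun j => hpm _))).const_mul _
  have mC : Measurable fun ω => localMean (fun i => ∑ m ∈ Finset.range (q + 1), lagWeight m *
      autocov P q θ u m * (w ((i : ℝ≥0) / n) ω * (w (((i + m : ℕ) : ℝ≥0) / n) ω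
        - w ((i : ℝ≥0) / n) ω))) (n - 5 * h + 1) 0 :=
    mM _ _ fun j => Finset.measurable_sum _ fun m _ =>
      ((hwm _).mul ((hwm _).sub (hwm _))).const_mul _
  have mD : ∀ N, Measurable fun ω => localMean (fun i => w ((i : ℝ≥0) / n) ω ^ 2) N 0 :=
    fun N => mM _ _ fun j => (hwm _).pow_const 2
  have mE : AEStronglyMeasurable (fun ω => localMean (fun i => w ((i : ℝ≥0) / n) ω ^ 2) n 0
      - ∫ s in (0 : ℝ)..1, w s.toNNReal ω ^ 2) (P.restrict G) :=
    ((mD n).aestronglyMeasurable.sub hI).restrict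
  -- the five bounds
  have bA := (eLpNorm_one_le_eLpNorm_two hν mA.aestronglyMeasurable).trans
    (hnoise.eLpNorm_noiseVarEst_sub_condMean_le hπ hpm hwm (K := K) (n := n)
      (fun ω hω i hi => hK ω hω i n hi) hl hn)
  have bB := eLpNorm_price_part_le (ν := P.restrict G) (a := fun j => p ((j : ℝ≥0) / n))
    (n := n) (h := h) (l := l) (R := √(C * ((5 * h : ℕ) / n))) (Real.sqrt_nonneg _)
    (fun j => (hpm _).aestronglyMeasurable) (by omega) hn fun i j hi hj hij hr => by
      refine (eLpNorm_sub_comm (p _) (p _) 2 _).le.trans ?_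
      exact eLpNorm_grid_increment_le hCp hn0 hij hj hr
  have bC := eLpNorm_shift_part_le (ν := P.restrict G) (b := fun j => w ((j : ℝ≥0) / n))
    (ρ := autocov P q θ u) (n := n) (N := n - 5 * h + 1) (q := q) (K := K)
    (R := √(C * (q / n))) K.2 hν
    (fun j => (hwm _).aestronglyMeasurable) (by omega)
    (fun j hj => hG fun ω hω => (hK ω hω j n hj).2)
    fun i j hi hj hij hr => eLpNorm_grid_increment_le hCw hn0 hij hj hr
  have bD : eLpNorm (fun ω => longRunVar P q θ u *
      (localMean (fun i => w ((i : ℝ≥0) / n) ω ^ 2) (n - 5 * h + 1) 0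
        - localMean (fun i => w ((i : ℝ≥0) / n) ω ^ 2) n 0)) 1 (P.restrict G)
      ≤ ENNReal.ofReal (|longRunVar P q θ u| * (2 * K ^ 2 * ((5 * h : ℕ) / n))) := by
    have h1 : ∀ᵐ ω ∂(P.restrict G), ‖longRunVar P q θ u *
      (localMean (fun i => w ((i : ℝ≥0) / n) ω ^ 2) (n - 5 * h + 1) 0
        - localMean (fun i => w ((i : ℝ≥0) / n) ω ^ 2) n 0)‖
        ≤ |longRunVar P q θ u| * (2 * K ^ 2 * ((5 * h : ℕ) / n)) := hG fun ω hω => by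
      rw [norm_mul, Real.norm_eq_abs, Real.norm_eq_abs]
      gcongr
      refine (abs_localMean_sub_localMean_le (Y := (K : ℝ) ^ 2) (by omega) (by omega)
        fun i hi => ?_).trans ?_
      · rw [abs_pow]
        gcongr
        exact (hK ω hω i n hi.le).2
      · gcongr
        push_cast [Nat.cast_sub hn]
        linarith
    refine (eLpNorm_le_of_ae_bound h1).trans ?_
    exact mul_le_of_le_one_left' (ENNReal.rpow_le_one hν (by simp))
  have bE : eLpNorm (fun ω => longRunVar P q θ u *
      (localMean (fun i => w ((i : ℝ≥0) / n) ω ^ 2) n 0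
        - ∫ s in (0 : ℝ)..1, w s.toNNReal ω ^ 2)) 1 (P.restrict G)
      ≤ ENNReal.ofReal (|longRunVar P q θ u| * (2 * K * √(C * (1 / n)))) := by
    have h1 := eLpNorm_const_smul (longRunVar P q θ u) (fun ω =>
      localMean (fun i => w ((i : ℝ≥0) / n) ω ^ 2) n 0
        - ∫ s in (0 : ℝ)..1, w s.toNNReal ω ^ 2) 1 (P.restrict G)
    refine h1.le.trans ?_
    rw [ENNReal.ofReal_mul (abs_nonneg _), ← ofReal_norm, Real.norm_eq_abs]
    refine mul_le_mul' le_rfl (eLpNorm_riemann_part_le hν hwm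
      (hG fun ω hω i n hi => (hK ω hω i n hi).2) hCw (ae_restrict_of_ae hcont) hn0)
  refine le_trans (le_of_eq ?_) ((eLpNorm_add_le (((mA.add mB).add mC).add
    (((mD _).sub (mD n)).const_mul (longRunVar P q θ u))).aestronglyMeasurable
    (mE.const_mul (longRunVar P q θ u)) le_rfl).trans (add_le_add
    ((eLpNorm_add_le ((mA.add mB).add mC).aestronglyMeasurable
    (((mD _).sub (mD n)).const_mul (longRunVar P q θ u)).aestronglyMeasurable le_rfl).trans
    (add_le_add ((eLpNorm_add_le (mA.add mB).aestronglyMeasurable mC.aestronglyMeasurable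
    le_rfl).trans (add_le_add ((eLpNorm_add_le mA.aestronglyMeasurable mB.aestronglyMeasurable
    le_rfl).trans (add_le_add bA bB)) bC)) bD)) bE))
  congr 1
  funext ω
  have h1 := localMean_blockMean_sub_eq (n := n) (N := n - 5 * h + 1) (h := h)
    (a := fun j => p ((j : ℝ≥0) / n) ω) (b := fun j => w ((j : ℝ≥0) / n) ω)
    (I := ∫ s in (0 : ℝ)..1, w s.toNNReal ω ^ 2) hq hρ
  rw [hLdef] at h1
  rw [intervalIntegral.integral_const_mul]
  simp only [Pi.add_apply, Pi.sub_apply] at h1 ⊢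
  linarith

end

/-! ### Rates -/

lemma isLittleO_natCast_rpow {r s : ℝ} (h : r < s) :
    (fun n : ℕ => (n : ℝ) ^ r) =o[atTop] fun n : ℕ => (n : ℝ) ^ s := by
  have h1 : Tendsto (fun n : ℕ => (n : ℝ) ^ (-(s - r))) atTop (𝓝 0) :=
    (tendsto_rpow_neg_atTop (sub_pos.2 h)).comp tendsto_natCast_atTop_atTop
  refine (isLittleO_iff_tendsto' ?_).2 (h1.congr' ?_)
  · filter_upwards [eventually_gt_atTop 0] with n hn h0
    exact absurd h0 (Real.rpow_pos_of_pos (by exact_mod_cast hn) _).ne'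
  · filter_upwards [eventually_gt_atTop 0] with n hn
    rw [← Real.rpow_sub (by exact_mod_cast hn)]
    congr 1; ring

lemma isBigO_natCast_rpow {r s : ℝ} (h : r ≤ s) :
    (fun n : ℕ => (n : ℝ) ^ r) =O[atTop] fun n : ℕ => (n : ℝ) ^ s := by
  rcases h.eq_or_lt with rfl | h
  · exact isBigO_refl _ _
  · exact (isLittleO_natCast_rpow h).isBigO

lemma isBigO_const_natCast_rpow (c : ℝ) {s : ℝ} (hs : 0 ≤ s) :
    (fun _ : ℕ => c) =O[atTop] fun n : ℕ => (n : ℝ) ^ s := by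
  have := (isBigO_const_const c one_ne_zero atTop).trans
    (by simpa using isBigO_natCast_rpow hs : (fun _ : ℕ => (1 : ℝ)) =O[atTop] _)
  exact this

lemma IsBigO.mul_natCast_rpow {f g : ℕ → ℝ} {r s : ℝ}
    (hf : f =O[atTop] fun n : ℕ => (n : ℝ) ^ r) (hg : g =O[atTop] fun n : ℕ => (n : ℝ) ^ s) :
    (fun n => f n * g n) =O[atTop] fun n : ℕ => (n : ℝ) ^ (r + s) := by
  refine (hf.mul hg).trans_eventuallyEq ?_
  filter_upwards [eventually_gt_atTop 0] with n hn
  rw [Real.rpow_add (by exact_mod_cast hn)]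

lemma IsBigO.sqrt_natCast_rpow {f : ℕ → ℝ} {r : ℝ}
    (hf : f =O[atTop] fun n : ℕ => (n : ℝ) ^ r) :
    (fun n => √(f n)) =O[atTop] fun n : ℕ => (n : ℝ) ^ (r / 2) := by
  refine (hf.sqrt (.of_forall fun n => by positivity)).trans_eventuallyEq (.of_forall fun n => ?_)
  simp only
  rw [Real.sqrt_eq_rpow, ← Real.rpow_mul (Nat.cast_nonneg n)]
  congr 1; ring

lemma tendsto_rpow_mul_ofReal {f : ℕ → ℝ} {r s : ℝ}
    (hf : f =O[atTop] fun n : ℕ => (n : ℝ) ^ s) (h : r + s < 0) :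
    Tendsto (fun n : ℕ => ENNReal.ofReal ((n : ℝ) ^ r) * ENNReal.ofReal (f n)) atTop (𝓝 0) := by
  have h1 := IsBigO.mul_natCast_rpow (isBigO_refl (fun n : ℕ => (n : ℝ) ^ r) atTop) hf
  have h2 : Tendsto (fun n : ℕ => (n : ℝ) ^ (r + s)) atTop (𝓝 0) := by
    have := (tendsto_rpow_neg_atTop (y := -(r + s)) (by linarith)).comp
      (tendsto_natCast_atTop_atTop (R := ℝ))
    simpa [Function.comp_def] using this
  have h3 := ENNReal.tendsto_ofReal (h1.trans_tendsto h2)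
  rw [ENNReal.ofReal_zero] at h3
  exact h3.congr fun n => ENNReal.ofReal_mul (by positivity)

lemma eventually_le_of_isTheta {l : ℕ → ℕ}
    (hl : (fun n => (l n : ℝ)) =Θ[atTop] fun n : ℕ => (n : ℝ) ^ (1 / 8 : ℝ))
    (q : ℕ) : ∀ᶠ n in atTop, q ≤ l n := by
  have h1 : (fun _ : ℕ => (q : ℝ)) =o[atTop] fun n => (l n : ℝ) :=
    ((isBigO_const_natCast_rpow _ le_rfl).trans_isLittleO
      (isLittleO_natCast_rpow (by norm_num))).trans_isTheta hl.symm
  filter_upwards [h1.bound one_pos] with n hn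
  simpa using hn

lemma eventually_add_lt_of_isTheta {h l : ℕ → ℕ}
    (hh : (fun n => (h n : ℝ)) =Θ[atTop] fun n : ℕ => (n : ℝ) ^ (1 / 5 : ℝ))
    (hl : (fun n => (l n : ℝ)) =Θ[atTop] fun n : ℕ => (n : ℝ) ^ (1 / 8 : ℝ)) (q : ℕ) :
    ∀ᶠ n in atTop, l n + q < h n := by
  have h1 : (fun n : ℕ => ((l n : ℝ) + (q + 1))) =o[atTop] fun n => (h n : ℝ) :=
    ((hl.1.add (isBigO_const_natCast_rpow _ (by norm_num))).trans_isLittleO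
      (isLittleO_natCast_rpow (by norm_num))).trans_isTheta hh.symm
  filter_upwards [h1.bound one_pos] with n hn
  rw [one_mul, Real.norm_of_nonneg (by positivity), Real.norm_of_nonneg (by positivity)] at hn
  have : l n + (q + 1) ≤ h n := by exact_mod_cast hn
  omega

lemma eventually_mul_le_of_isTheta {h : ℕ → ℕ}
    (hh : (fun n => (h n : ℝ)) =Θ[atTop] fun n : ℕ => (n : ℝ) ^ (1 / 5 : ℝ)) :
    ∀ᶠ n in atTop, 10 * h n ≤ n := by
  have h1 : (fun n : ℕ => (h n : ℝ)) =o[atTop] fun n : ℕ => (n : ℝ) := by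
    simpa using hh.1.trans_isLittleO (isLittleO_natCast_rpow (s := 1) (by norm_num))
  filter_upwards [h1.bound (c := 1 / 10) (by norm_num)] with n hn
  rw [Real.norm_of_nonneg (by positivity), Real.norm_of_nonneg (by positivity)] at hn
  have : (10 : ℝ) * h n ≤ n := by linarith
  exact_mod_cast this

/-! ### The error in probability -/

/-- Convergence in `L¹` on events of probability arbitrarily close to one implies convergence in
probability. -/
lemma tendstoInMeasure_zero_of_eLpNorm_restrict {P : Measure Ω} {X : ℕ → Ω → ℝ}
    (hX : ∀ n, AEStronglyMeasurable (X n) P)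
    (h : ∀ ζ : ℝ≥0∞, 0 < ζ → ∃ G : Set Ω, MeasurableSet G ∧ P Gᶜ ≤ ζ ∧
      Tendsto (fun n => eLpNorm (X n) 1 (P.restrict G)) atTop (𝓝 0)) :
    TendstoInMeasure P X atTop (fun _ => 0) := by
  refine tendstoInMeasure_zero_of_forall_exists fun ζ hζ => ?_
  obtain ⟨G, hGm, hG, hlim⟩ := h ζ hζ
  refine ⟨G, hG, fun n => G.indicator fun ω => ‖(hX n).mk (X n) ω‖ₑ,
    fun n => (hX n).stronglyMeasurable_mk.measurable.enorm.indicator hGm,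
    .of_forall fun n => ?_, hlim.congr fun n => ?_⟩
  · filter_upwards [(hX n).ae_eq_mk] with ω hω hωG
    rw [Set.indicator_of_mem hωG, ← hω]
  · rw [eLpNorm_one_eq_lintegral_enorm, lintegral_indicator hGm]
    refine lintegral_congr_ae (ae_restrict_of_ae ?_)
    filter_upwards [(hX n).ae_eq_mk] with ω hω
    rw [hω]

lemma aestronglyMeasurable_integral_sq {P : Measure Ω} {w : ℝ≥0 → Ω → ℝ}
    (hw : ∀ t, Measurable (w t)) (hcont : ∀ᵐ ω ∂P, ContinuousOn (w · ω) (Set.Iic 1)) :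
    AEStronglyMeasurable (fun ω => ∫ s in (0 : ℝ)..1, w s.toNNReal ω ^ 2) P := by
  refine aestronglyMeasurable_of_tendsto_ae atTop (f := fun (N : ℕ) ω => localMean (fun i =>
    localMean (fun k => w ((i : ℝ≥0) / (1 : ℕ) + k * (1 / (1 : ℕ) / N)) ω ^ 2) N 0) 1 0)
    (fun N => ?_) ?_
  · exact ((Finset.measurable_sum _ fun i _ => (Finset.measurable_sum _ fun k _ =>
      (hw _).pow_const 2).const_mul _).const_mul _).aestronglyMeasurable
  · filter_upwards [hcont] with ω hω
    exact tendsto_nested_localMean (hω.pow 2) one_pos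

/-- The five error bounds are all `o(n ^ (-1/4))`. -/
lemma tendsto_rpow_mul_error {h l : ℕ → ℕ}
    (hh : (fun n => (h n : ℝ)) =Θ[atTop] fun n : ℕ => (n : ℝ) ^ (1 / 5 : ℝ))
    (hl : (fun n => (l n : ℝ)) =Θ[atTop] fun n : ℕ => (n : ℝ) ^ (1 / 8 : ℝ)) (q : ℕ)
    (R C S L K : ℝ) :
    Tendsto (fun n : ℕ => ENNReal.ofReal ((n : ℝ) ^ (1 / 4 : ℝ)) *
      (ENNReal.ofReal (√((2 * (5 * h n + q : ℕ) + 1) * (8 * (l n + 1) * R) ^ 2 /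
          ((n : ℝ) - 5 * h n + 1))) +
        ENNReal.ofReal (2 * (l n + 1) *
          (√(C * ((5 * h n : ℕ) / n)) * √(C * ((5 * h n : ℕ) / n)))) +
        ENNReal.ofReal (S * (K * √(C * (q / n)))) +
        ENNReal.ofReal (L * (2 * K ^ 2 * ((5 * h n : ℕ) / n))) +
        ENNReal.ofReal (L * (2 * K * √(C * (1 / n)))))) atTop (𝓝 0) := by
  have hinv : (fun n : ℕ => (n : ℝ)⁻¹) =O[atTop] fun n : ℕ => (n : ℝ) ^ (-1 : ℝ) :=
    (isBigO_refl _ _).congr_right fun n => by rw [Real.rpow_neg_one]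
  have hN : (fun n : ℕ => ((n : ℝ) - 5 * h n + 1)⁻¹) =O[atTop] fun n : ℕ => (n : ℝ) ^ (-1 : ℝ) := by
    refine IsBigO.trans (IsBigO.of_bound 2 ?_) hinv
    filter_upwards [eventually_mul_le_of_isTheta hh, eventually_gt_atTop 0] with n hn hn0
    have h1 : (10 : ℝ) * h n ≤ n := by exact_mod_cast hn
    have h2 : (0 : ℝ) < n := by exact_mod_cast hn0
    rw [Real.norm_of_nonneg (by rw [inv_nonneg]; linarith), Real.norm_of_nonneg (by positivity),
      ← inv_inv (2 : ℝ), ← mul_inv]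
    exact inv_anti₀ (by positivity) (by linarith)
  have h5 : (fun n : ℕ => ((5 * h n : ℕ) : ℝ)) =O[atTop] fun n : ℕ => (n : ℝ) ^ (1 / 5 : ℝ) := by
    push_cast
    exact hh.1.const_mul_left 5
  have hl1 : (fun n : ℕ => (l n : ℝ) + 1) =O[atTop] fun n : ℕ => (n : ℝ) ^ (1 / 8 : ℝ) :=
    hl.1.add (isBigO_const_natCast_rpow 1 (by norm_num))
  have hq : ∀ c : ℝ, (fun n : ℕ => √(C * (c / n))) =O[atTop] fun n : ℕ => (n : ℝ) ^ (-1 / 2 : ℝ) :=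
    fun c => IsBigO.sqrt_natCast_rpow ((hinv.const_mul_left c).const_mul_left C)
  have hh5 : (fun n : ℕ => ((5 * h n : ℕ) : ℝ) / n) =O[atTop]
      fun n : ℕ => (n : ℝ) ^ (1 / 5 + -1 : ℝ) := IsBigO.mul_natCast_rpow h5 hinv
  have hs5 := IsBigO.sqrt_natCast_rpow (hh5.const_mul_left C)
  -- the dominant error has exponent `(1/5 + 1/4 - 1) / 2 = -11/40 < -1/4`
  have e1 : (fun n : ℕ => √((2 * (5 * h n + q : ℕ) + 1) * (8 * (l n + 1) * R) ^ 2 /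
      ((n : ℝ) - 5 * h n + 1))) =O[atTop]
      fun n : ℕ => (n : ℝ) ^ ((1 / 5 + (1 / 8 + 1 / 8) + -1) / 2 : ℝ) := by
    refine IsBigO.sqrt_natCast_rpow (IsBigO.mul_natCast_rpow (IsBigO.mul_natCast_rpow ?_ ?_) hN)
    · have := ((h5.add (isBigO_const_natCast_rpow q (by norm_num))).const_mul_left 2).add
        (isBigO_const_natCast_rpow 1 (by norm_num))
      refine this.congr_left fun n => by push_cast; ring
    · have := (IsBigO.mul_natCast_rpow hl1 hl1).const_mul_left ((8 * R) ^ 2)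
      refine this.congr_left fun n => by ring
  have t1 := tendsto_rpow_mul_ofReal (r := 1 / 4) e1 (by norm_num)
  have t2 := tendsto_rpow_mul_ofReal (r := 1 / 4) (IsBigO.mul_natCast_rpow
    (hl1.const_mul_left 2) (IsBigO.mul_natCast_rpow hs5 hs5)) (by norm_num)
  have t3 := tendsto_rpow_mul_ofReal (r := 1 / 4)
    (((hq q).const_mul_left K).const_mul_left S) (by norm_num)
  have t4 := tendsto_rpow_mul_ofReal (r := 1 / 4)
    ((hh5.const_mul_left (2 * K ^ 2)).const_mul_left L) (by norm_num)
  have t5 := tendsto_rpow_mul_ofReal (r := 1 / 4)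
    (((hq 1).const_mul_left (2 * K)).const_mul_left L) (by norm_num)
  have t := (((t1.add t2).add t3).add t4).add t5
  simp only [add_zero, ← mul_add _ (ENNReal.ofReal _) (ENNReal.ofReal _)] at t
  simpa only [← mul_add] using t

end NoisyPrice

theorem mainTheorem5 {Ω : Type*} [mΩ : MeasurableSpace Ω] (P : Measure Ω) [IsProbabilityMeasure P]
    (𝓕 : Filtration ℝ≥0 mΩ)
    -- driving Brownian motions and Poisson random measure
    (W B : ℝ≥0 → Ω → ℝ)
    (hW : NoisyPrice.IsBrownianWrt 𝓕 P W) (hB : NoisyPrice.IsBrownianWrt 𝓕 P B)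
    (hWB : IndepFun (fun ω t => B t ω) (fun ω t => W t ω) P)
    (F : Measure ℝ) [SigmaFinite F] (N : Ω → Measure (ℝ≥0 × ℝ))
    (hN : NoisyPrice.IsPoissonRandomMeasure 𝓕 P F N)
    -- efficient log-price
    (β : ℝ) (hβ : β ∈ Set.Icc (0 : ℝ) 2)
    (a σ : ℝ≥0 → Ω → ℝ) (δ : ℝ≥0 → Ω → ℝ → ℝ) (p : ℝ≥0 → Ω → ℝ)
    (hp : NoisyPrice.IsLogPrice 𝓕 P W F N β a σ δ p)
    (hV : NoisyPrice.HasItoForm 𝓕 P W B σ)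
    -- microstructure noise
    (w : ℝ≥0 → Ω → ℝ) (q : ℕ) (θ : ℕ → ℝ) (u : ℤ → Ω → ℝ)
    (hnoise : NoisyPrice.IsNoise 𝓕 P W B p w q θ u)
    -- tuning sequences
    (h l : ℕ → ℕ)
    (hh : (fun n => (h n : ℝ)) =Θ[atTop] fun n : ℕ => (n : ℝ) ^ (1 / 5 : ℝ))
    (hl : (fun n => (l n : ℝ)) =Θ[atTop] fun n : ℕ => (n : ℝ) ^ (1 / 8 : ℝ)) :
    TendstoInMeasure P
      (fun (n : ℕ) ω => (n : ℝ) ^ (1 / 4 : ℝ) *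
        (NoisyPrice.noiseVarEst (fun i => NoisyPrice.obsPrice p w q θ u n i ω) n (h n) (l n) -
          ∫ s in (0 : ℝ)..1, NoisyPrice.longRunVar P q θ u * w s.toNNReal ω ^ 2))
      atTop (fun _ => 0) := by
  have hw := hnoise.vol_form
  have hpm : ∀ t, Measurable (p t) := fun t => (hp.adapted t).mono (𝓕.le t) le_rfl
  have hwm : ∀ t, Measurable (w t) := fun t => (hw.1 t).mono (𝓕.le t) le_rfl
  obtain ⟨hpL, hpb⟩ := hp.regularity hW hN hβ
  obtain ⟨hwL, hwc⟩ := hw.regularity hW hB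
  have hI := NoisyPrice.aestronglyMeasurable_integral_sq hwm hwc
  obtain ⟨M, hπ⟩ := hnoise.isFinitelyDependent
  refine NoisyPrice.tendstoInMeasure_zero_of_eLpNorm_restrict (fun n => ?_) fun ζ hζ => ?_
  · have hobs : ∀ j, Measurable fun ω => NoisyPrice.obsPrice p w q θ u n j ω := fun j =>
      (hpm _).add ((hwm _).mul (hπ.measurable j))
    simp_rw [intervalIntegral.integral_const_mul]
    exact ((NoisyPrice.measurable_noiseVarEst hobs n (h n) (l n)).aestronglyMeasurable.sub
      (hI.const_mul _)).const_mul _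
  -- localisation of the price and of the noise volatility
  obtain ⟨G₁, hG₁m, hG₁, K₁, C₁, hK₁, hC₁⟩ := hpL.exists_event hpm hpb (ENNReal.half_pos hζ.ne')
  obtain ⟨G₂, hG₂m, hG₂, K₂, C₂, hK₂, hC₂⟩ := hwL.exists_event hwm
    (by filter_upwards [hwc] with ω hω; exact NoisyPrice.hasBoundedIncrements_of_continuousOn hω)
    (ENNReal.half_pos hζ.ne')
  refine ⟨G₁ ∩ G₂, hG₁m.inter hG₂m, NoisyPrice.measure_compl_inter_le hG₁ hG₂, ?_⟩
  have key := fun n (h1 : l n + q < h n) (h2 : q ≤ l n) (h3 : 5 * h n ≤ n) =>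
    hnoise.eLpNorm_noiseVarEst_sub_le hπ hpm hwm (hG₁m.inter hG₂m) (K := max K₁ K₂)
      (C := max C₁ C₂)
      (fun ω hω i n hi => ⟨(hK₁ ω hω.1 i n hi).trans (by exact_mod_cast le_max_left _ _),
        (hK₂ ω hω.2 i n hi).trans (by exact_mod_cast le_max_right _ _)⟩)
      (fun s t hst ht => (lintegral_mono_set Set.inter_subset_left).trans
        ((hC₁ s t hst ht).trans (by gcongr; exact le_max_left _ _)))
      (fun s t hst ht => (lintegral_mono_set Set.inter_subset_right).trans
        ((hC₂ s t hst ht).trans (by gcongr; exact le_max_right _ _)))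
      hwc hI h1 h2 h3
  -- the `L¹` error on the localising event, multiplied by `n ^ (1 / 4)`, tends to zero
  refine tendsto_of_tendsto_of_tendsto_of_le_of_le' tendsto_const_nhds
    (NoisyPrice.tendsto_rpow_mul_error hh hl q (((max K₁ K₂ : ℝ≥0) * (1 + M)) ^ 2) (max C₁ C₂ : ℝ≥0)
      (∑ m ∈ Finset.range (q + 1), |NoisyPrice.lagWeight m * NoisyPrice.autocov P q θ u m|)
      |NoisyPrice.longRunVar P q θ u| (max K₁ K₂ : ℝ≥0)) (.of_forall fun _ => zero_le) ?_
  filter_upwards [NoisyPrice.eventually_add_lt_of_isTheta hh hl q,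
    NoisyPrice.eventually_le_of_isTheta hl q, NoisyPrice.eventually_mul_le_of_isTheta hh]
    with n h1 h2 h3
  refine (eLpNorm_const_smul ((n : ℝ) ^ (1 / 4 : ℝ)) _ 1 _).le.trans (mul_le_mul' ?_
    (key n h1 h2 (by omega)))
  rw [← ofReal_norm, Real.norm_of_nonneg (by positivity)]
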